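/- Notation. Let $n\in\mathbb N$, let $|\cdot|$ be the Euclidean norm, and let $f_1,f_2:\mathbb R^n\times\mathbb R_{\ge0}\to\mathbb R^n$. For $\varepsilon>0$ put $f_\varepsilon=\varepsilon^{-1}f_1+f_2$ and consider the system $$\dot x=f_\varepsilon(x,\tau),\qquad \dot\tau=\varepsilon^{-2}.\tag{S}$$ A solution is a $C^1$ function $(x,\tau):[0,t_s)\to\mathbb R^n\times\mathbb R_{\ge0}$, $0<t_s\le\infty$, that satisfies the equations; it is complete if $t_s=\infty$. Class $\mathcal K$: continuous strictly increasing $\alpha:\mathbb R_{\ge0}\to\mathbb R_{\ge0}$ with $\alpha(0)=0$; class $\mathcal K_\infty$: moreover $\alpha(r)\to\infty$ as $r\to\infty$. Class $\mathcal{KL}$: continuous $\beta:\mathbb R_{\ge0}^2\to\mathbb R_{\ge0}$ with $\beta(\cdot,s)\in\mathcal K_\infty$ for each $s$, $\beta(r,\cdot)$ strictly decreasing for each $r>0$, and $\beta(r,s)\to0$ as $s\to\infty$ for each $r\ge 0$. A function $\phi:\mathbb R^n\to\mathbb R_{\ge0}$ is called positive definite if $\phi(0)=0$ and there is $\alpha\in\mathcal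 K$ with $\alpha(|x|)\le\phi(x)$ for all $x$. For $\beta\in\mathcal{KL}$ and $\Delta>0$, a system $\dot x=F(x,\tau),\ \dot\tau=\varepsilon^{-2}$ is said to satisfy the $(\beta,\Delta)$-bound if every solution from any $(x_0,\tau_0)\in\mathbb R^n\times\mathbb R_{\ge0}$ satisfies $|x(t)|\le\beta(|x_0|,t)+\Delta$ on its domain, and every maximal solution is complete. The origin is $\Delta$-UGUB for a family of such systems indexed by $\varepsilon>0$ if $\Delta>0$ and there are $\beta\in\mathcal{KL}$ and $\varepsilon^*>0$ such that the $(\beta,\Delta)$-bound holds for all $\varepsilon\in(0,\varepsilon^*)$. For $\epsilon>0$ the triple $\delta=(\delta_1,\delta_2,\delta_3)$ is admissible if $\delta_1\ge0$, $\delta_2\ge(1+\epsilon)\delta_1$, $\delta_3>(1+\epsilon)\delta_2$. Put $M_j=\{|x|\ge\delta_j\}$. Assumption 1. There are $\delta_1\ge0$ and $T>0$ such that for $k=1,2$: $f_k$ is continuous; for some $L_k>0$, $|f_k(x_1,\tau)-f_k(x_2,\tau)|\le L_k|x_1-x_2|$ for $x_1,x_2\in M_1$, $\tau\ge0$; $f_k(x,\tau+T)=f_k(x,\tau)$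 and $\int_0^Tf_1(x,\tau)\,d\tau=0$ for all $x\in\mathbb R^n$, $\tau\ge 0$; for each $\tau\ge0$, $f_k(\cdot,\tau)$ is $C^{3-k}$ on an open neighbourhood of $M_1$; and for some $L_3>0$, $|D_xf_1(x_1,\tau_1)f_1(x_1,\tau_2)-D_xf_1(x_2,\tau_1)f_1(x_2,\tau_2)|\le L_3|x_1-x_2|$ for $x_1,x_2\in M_1$, $\tau_1,\tau_2\ge0$. Construction. For admissible $\delta$ let $\hat f_k=\varphi f_k$, where, with $\chi_1(r)=e^{-1/r}$ for $r>0$, $\chi_1(r)=0$ for $r\le0$, and $\chi_2(r)=\chi_1(r)/(\chi_1(r)+\chi_1(1-r))$, we set $\varphi(x)=\chi_2\big(\tfrac{|x|-\delta_1}{\delta_2-\delta_1}\big)$ if $\delta_2>\delta_1$ and $\varphi=1$ if $\delta_2=\delta_1=0$. Let $v_1(x,\tau)=\int_0^\tau\hat f_1(x,s)\,ds$, $[v_1,\hat f_1]=D_x\hat f_1\,v_1-D_xv_1\,\hat f_1$, $\bar f(x)=\frac1{2T}\int_0^T(2\hat f_2+[v_1,\hat f_1])(x,\tau)\,d\tau$,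 $w(x,\tau)=\int_0^\tau(\hat f_2(x,s)+D_x\hat f_1(x,s)v_1(x,s)-\bar f(x))\,ds$, $v_2=w-D_xv_1\,v_1$, and $\Psi(x,\tau)=(\Phi(x,\tau),\tau)$ with $\Phi=x-\varepsilon v_1-\varepsilon^2v_2$, which for small $\varepsilon$ is a bijection of $\mathbb R^n\times\mathbb R_{\ge0}$. The pushforward system is $\dot x=\Psi_*f_\varepsilon(x,\tau)$, $\dot\tau=\varepsilon^{-2}$ with $\Psi_*f_\varepsilon=\big(D_x\Phi\, f_\varepsilon+\varepsilon^{-2}D_\tau\Phi\big)\circ\Psi^{-1}$, and $g$ is defined by $\Psi_*f_\varepsilon=\bar f+\varepsilon g(\cdot,\cdot,\varepsilon)$ for $\varepsilon>0$. Assumption 2. For some $\epsilon>0$ and some admissible $\delta$ with the same $\delta_1$ as in Assumption 1, there are a $C^1$ function $V:\mathbb R^n\to\mathbb R_{\ge0}$, $\alpha_1,\alpha_2\in\mathcal K_\infty$, $c_1,c_2>0$ and a positive definite $\phi$ with $\alpha_1(|x|)\le V(x)\le\alpha_2(|x|)$ and $|\nabla V(x)|\le c_2\phi(x)$ for all $x$,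 $\langle\nabla V(x),\bar f(x)\rangle\le-c_1\phi(x)^2$ for $x\in M_3$, and at least one of: (i) there are $\varepsilon_0,\bar L_g>0$ with $|g(x,\tau,\varepsilon)|\le\bar L_g(\phi(x)+1)$ for $x\in M_3$, $\tau\ge0$, $\varepsilon\in(0,\varepsilon_0]$; (ii) there is $\alpha_3\in\mathcal K$ with $\alpha_3(|x|)|x|\le\phi(x)$ for all $x$. Corollary. Suppose Assumptions 1 and 2 hold. Then for each $\epsilon>0$ and each admissible $\delta$ with that $\delta_1$, there exists $\tilde\Delta>0$ such that the origin is $\tilde\Delta$-UGUB for (S). Moreover there are $\beta\in\mathcal{KL}$, $\Delta>0$, $L_\Psi>0$, $\varepsilon^*>0$ such that for every $\varepsilon\in(0,\varepsilon^*)$: $L_\Psi\varepsilon\le1$; $\Psi$ (built with this $\delta$) is a bijection of $\mathbb R^n\times\mathbb R_{\ge0}$, and for every $\tau\ge0$ the first components of $\Psi(\cdot,\tau)$ and $\Psi^{-1}(\cdot,\tau)$ are Lipschitz with constant $1+L_\Psi\varepsilon$ and have norm at most $L_\Psi\varepsilon$ at $x=0$; the pushforward system satisfies the $(\beta,\Delta)$-bound;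 and (S) satisfies the $(\tilde\beta,\tilde\Delta_\varepsilon)$-bound with $$\tilde\beta(r,s)=2\beta(3r,s),\qquad \tilde\Delta_\varepsilon=(1+L_\Psi\varepsilon)\Delta+L_\Psi\varepsilon+(1+L_\Psi\varepsilon)\,\beta(3L_\Psi\varepsilon,0).$$ -/

import Mathlib

open Set Filter Topology

namespace SecondOrderAveraging

noncomputable section

/-- The Euclidean space of dimension `n`, with its 2-norm. -/
abbrev Euc (n : ℕ) : Type := EuclideanSpace ℝ (Fin n)

/-! ### Comparison functions

Functions on the half-line are represented by functions on `ℝ` whose properties are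
required on `[0, ∞)` only. -/

/-- Class `K`: continuous and strictly increasing on `[0, ∞)`, zero at zero. -/
def ClassK (α : ℝ → ℝ) : Prop :=
  ContinuousOn α (Ici 0) ∧ StrictMonoOn α (Ici 0) ∧ α 0 = 0

/-- Class `K_∞`. -/
def ClassKInf (α : ℝ → ℝ) : Prop :=
  ClassK α ∧ Tendsto α atTop atTop

/-- Class `KL`. Strict decrease in the second argument is asked for positive first arguments
only, since `β 0 s = 0` for all `s`. -/
def ClassKL (β : ℝ → ℝ → ℝ) : Prop :=
  ContinuousOn (fun p : ℝ × ℝ => β p.1 p.2) (Ici 0 ×ˢ Ici 0) ∧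
  (∀ s, 0 ≤ s → ClassKInf (fun r => β r s)) ∧
  (∀ r, 0 < r → StrictAntiOn (β r) (Ici 0)) ∧
  (∀ r, 0 ≤ r → Tendsto (β r) atTop (𝓝 0))

/-- Positive definiteness on the whole space: zero at the origin, and bounded below by a
class-`K` function of the norm. -/
def PosDefFun {n : ℕ} (φ : Euc n → ℝ) : Prop :=
  φ 0 = 0 ∧ ∃ α : ℝ → ℝ, ClassK α ∧ ∀ x, α ‖x‖ ≤ φ x

/-! ### Systems `x' = F(x, τ)`, `τ' = ε⁻²` and their solutions -/

/-- The time domain `[0, ts)`, where `ts` may be `⊤`. -/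
def timeDom (ts : EReal) : Set ℝ := {t | 0 ≤ t ∧ (t : EReal) < ts}

/-- `(x, τ)` is a (continuously differentiable, not necessarily maximal) solution on `[0, ts)` of
`x' = F(x, τ)`, `τ' = ε⁻²` from `(x₀, τ₀)`, with values in `ℝⁿ × [0, ∞)`. -/
structure IsSolution {n : ℕ} (F : Euc n → ℝ → Euc n) (ε : ℝ) (x₀ : Euc n) (τ₀ : ℝ)
    (ts : EReal) (x : ℝ → Euc n) (τ : ℝ → ℝ) : Prop where
  pos : 0 < ts
  init_x : x 0 = x₀
  init_tau : τ 0 = τ₀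
  tau_nonneg : ∀ t ∈ timeDom ts, 0 ≤ τ t
  deriv_x : ∀ t ∈ timeDom ts, HasDerivWithinAt x (F (x t) (τ t)) (timeDom ts) t
  deriv_tau : ∀ t ∈ timeDom ts, HasDerivWithinAt τ ((ε ^ 2)⁻¹) (timeDom ts) t
  cont_deriv : ContinuousOn (fun t => F (x t) (τ t)) (timeDom ts)

/-- A solution that has no extension, as a solution, to a longer time interval. -/
def IsMaximalSolution {n : ℕ} (F : Euc n → ℝ → Euc n) (ε : ℝ) (x₀ : Euc n) (τ₀ : ℝ)
    (ts : EReal) (x : ℝ → Euc n) (τ : ℝ → ℝ) : Prop :=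
  IsSolution F ε x₀ τ₀ ts x τ ∧
  ∀ (ts' : EReal) (x' : ℝ → Euc n) (τ' : ℝ → ℝ), IsSolution F ε x₀ τ₀ ts' x' τ' → ts ≤ ts' →
    (∀ t ∈ timeDom ts, x' t = x t ∧ τ' t = τ t) → ts' = ts

/-- Every solution of `x' = F(x, τ)`, `τ' = ε⁻²` with `τ₀ ≥ 0` satisfies
`|x(t)| ≤ β(|x₀|, t) + Δ` as long as it is defined, and every maximal solution is complete. -/
def UltimateBound {n : ℕ} (F : Euc n → ℝ → Euc n) (ε : ℝ) (β : ℝ → ℝ → ℝ) (Δ : ℝ) : Prop :=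
  ∀ (x₀ : Euc n) (τ₀ : ℝ), 0 ≤ τ₀ → ∀ (ts : EReal) (x : ℝ → Euc n) (τ : ℝ → ℝ),
    (IsSolution F ε x₀ τ₀ ts x τ → ∀ t ∈ timeDom ts, ‖x t‖ ≤ β ‖x₀‖ t + Δ) ∧
    (IsMaximalSolution F ε x₀ τ₀ ts x τ → ts = ⊤)

/-- The origin is `Δ`-uniformly globally ultimately bounded for the family `F ε` of systems. -/
def UGUB {n : ℕ} (F : ℝ → Euc n → ℝ → Euc n) (Δ : ℝ) : Prop :=
  0 < Δ ∧ ∃ β : ℝ → ℝ → ℝ, ClassKL β ∧ ∃ εs : ℝ, 0 < εs ∧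
    ∀ ε ∈ Ioo 0 εs, UltimateBound (F ε) ε β Δ

/-- The oscillatory vector field `ε⁻¹ f₁ + f₂`. -/
def oscField {n : ℕ} (f₁ f₂ : Euc n → ℝ → Euc n) (ε : ℝ) (x : Euc n) (τ : ℝ) : Euc n :=
  ε⁻¹ • f₁ x τ + f₂ x τ

/-! ### Standing regularity assumption on the vector fields -/

/-- Jacobian with respect to the space variable. -/
def Dx {n : ℕ} (f : Euc n → ℝ → Euc n) (x : Euc n) (τ : ℝ) : Euc n →L[ℝ] Euc n :=
  fderiv ℝ (fun y => f y τ) x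

/-- The closed set `{x : |x| ≥ δ}`. -/
def outside (n : ℕ) (δ : ℝ) : Set (Euc n) := {x | δ ≤ ‖x‖}

/-- `f` is, for each `τ ≥ 0`, of class `C^k` in `x` on the closed set `K`, i.e. on an open
neighbourhood of `K`. -/
def SmoothInX {n : ℕ} (k : ℕ) (f : Euc n → ℝ → Euc n) (K : Set (Euc n)) : Prop :=
  ∀ τ, 0 ≤ τ → ∃ U : Set (Euc n), IsOpen U ∧ K ⊆ U ∧ ContDiffOn ℝ k (fun x => f x τ) U

/-- Continuity, Lipschitz, periodicity, zero-mean and smoothness conditions on `f₁`, `f₂`. -/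
structure Regular {n : ℕ} (f₁ f₂ : Euc n → ℝ → Euc n) (δ₁ T : ℝ) : Prop where
  delta_nonneg : 0 ≤ δ₁
  cont₁ : ContinuousOn (fun p : Euc n × ℝ => f₁ p.1 p.2) (univ ×ˢ Ici 0)
  cont₂ : ContinuousOn (fun p : Euc n × ℝ => f₂ p.1 p.2) (univ ×ˢ Ici 0)
  lip₁ : ∃ L₁ > 0, ∀ x₁ ∈ outside n δ₁, ∀ x₂ ∈ outside n δ₁, ∀ τ, 0 ≤ τ →
    ‖f₁ x₁ τ - f₁ x₂ τ‖ ≤ L₁ * ‖x₁ - x₂‖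
  lip₂ : ∃ L₂ > 0, ∀ x₁ ∈ outside n δ₁, ∀ x₂ ∈ outside n δ₁, ∀ τ, 0 ≤ τ →
    ‖f₂ x₁ τ - f₂ x₂ τ‖ ≤ L₂ * ‖x₁ - x₂‖
  period_pos : 0 < T
  periodic₁ : ∀ x τ, 0 ≤ τ → f₁ x (τ + T) = f₁ x τ
  periodic₂ : ∀ x τ, 0 ≤ τ → f₂ x (τ + T) = f₂ x τ
  zero_mean : ∀ x, ∫ τ in (0 : ℝ)..T, f₁ x τ = 0
  smooth₁ : SmoothInX 2 f₁ (outside n δ₁)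
  smooth₂ : SmoothInX 1 f₂ (outside n δ₁)
  lip₃ : ∃ L₃ > 0, ∀ x₁ ∈ outside n δ₁, ∀ x₂ ∈ outside n δ₁, ∀ τ₁ τ₂, 0 ≤ τ₁ → 0 ≤ τ₂ →
    ‖Dx f₁ x₁ τ₁ (f₁ x₁ τ₂) - Dx f₁ x₂ τ₁ (f₁ x₂ τ₂)‖ ≤ L₃ * ‖x₁ - x₂‖

/-! ### The near-identity transformation -/

/-- The constraint on `ε` (here `e`) and `δ = (δ₁, δ₂, δ₃)`. -/
def Deltas (e δ₁ δ₂ δ₃ : ℝ) : Prop :=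
  0 ≤ δ₁ ∧ (1 + e) * δ₁ ≤ δ₂ ∧ (1 + e) * δ₂ < δ₃

/-- The smooth reverse bump function, `0` for `|x| ≤ δ₁` and `1` for `|x| ≥ δ₂`.
`Real.smoothTransition r` is `χ(r) / (χ(r) + χ(1 - r))` with `χ(r) = exp(-1/r)` for `r > 0` and
`χ(r) = 0` for `r ≤ 0`. -/
def bump {n : ℕ} (δ₁ δ₂ : ℝ) (x : Euc n) : ℝ :=
  if δ₁ < δ₂ then Real.smoothTransition ((‖x‖ - δ₁) / (δ₂ - δ₁)) else 1

/-- The truncated vector field `bump • f`. -/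
def hat {n : ℕ} (δ₁ δ₂ : ℝ) (f : Euc n → ℝ → Euc n) (x : Euc n) (τ : ℝ) : Euc n :=
  bump δ₁ δ₂ x • f x τ

/-- `v₁(x, τ) = ∫₀^τ h₁(x, s) ds`. -/
def v₁ {n : ℕ} (h₁ : Euc n → ℝ → Euc n) (x : Euc n) (τ : ℝ) : Euc n :=
  ∫ s in (0 : ℝ)..τ, h₁ x s

/-- Lie bracket in the space variable, `[a, b] = (Dₓ b) a - (Dₓ a) b`. -/
def bracket {n : ℕ} (a b : Euc n → ℝ → Euc n) (x : Euc n) (τ : ℝ) : Euc n :=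
  Dx b x τ (a x τ) - Dx a x τ (b x τ)

/-- Second-order average `(1 / 2T) ∫₀^T (2 h₂ + [v₁, h₁]) dτ`. -/
def average {n : ℕ} (T : ℝ) (h₁ h₂ : Euc n → ℝ → Euc n) (x : Euc n) : Euc n :=
  (1 / (2 * T)) • ∫ τ in (0 : ℝ)..T, ((2 : ℝ) • h₂ x τ + bracket (v₁ h₁) h₁ x τ)

/-- `w(x, τ) = ∫₀^τ (h₂ + (Dₓ h₁) v₁ - average) ds`. -/
def w {n : ℕ} (T : ℝ) (h₁ h₂ : Euc n → ℝ → Euc n) (x : Euc n) (τ : ℝ) : Euc n :=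
  ∫ s in (0 : ℝ)..τ, (h₂ x s + Dx h₁ x s (v₁ h₁ x s) - average T h₁ h₂ x)

/-- `v₂ = w - (Dₓ v₁) v₁`. -/
def v₂ {n : ℕ} (T : ℝ) (h₁ h₂ : Euc n → ℝ → Euc n) (x : Euc n) (τ : ℝ) : Euc n :=
  w T h₁ h₂ x τ - Dx (v₁ h₁) x τ (v₁ h₁ x τ)

/-- The second-order average vector field of the truncated fields. -/
def fbar {n : ℕ} (δ₁ δ₂ T : ℝ) (f₁ f₂ : Euc n → ℝ → Euc n) : Euc n → Euc n :=
  average T (hat δ₁ δ₂ f₁) (hat δ₁ δ₂ f₂)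

/-- The near-identity transformation `Ψ(x, τ) = (x - ε v₁(x, τ) - ε² v₂(x, τ), τ)`. -/
def Ψ {n : ℕ} (δ₁ δ₂ T : ℝ) (f₁ f₂ : Euc n → ℝ → Euc n) (ε : ℝ) (p : Euc n × ℝ) : Euc n × ℝ :=
  (p.1 - ε • v₁ (hat δ₁ δ₂ f₁) p.1 p.2
    - ε ^ 2 • v₂ T (hat δ₁ δ₂ f₁) (hat δ₁ δ₂ f₂) p.1 p.2, p.2)

/-- The extended phase space `ℝⁿ × [0, ∞)`. -/
def phase (n : ℕ) : Set (Euc n × ℝ) := univ ×ˢ Ici 0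

/-- Inverse of a self-map of `ℝⁿ × [0, ∞)` (meaningful when the map is a bijection). -/
def phaseInv {n : ℕ} (P : Euc n × ℝ → Euc n × ℝ) : Euc n × ℝ → Euc n × ℝ :=
  Function.invFunOn P (phase n)

/-- Pushforward of `x' = F(x, τ)`, `τ' = ε⁻²` under `P`, where `P` preserves `τ`:
`(Dₓ(π₁ ∘ P) F + ε⁻² D_τ(π₁ ∘ P)) ∘ P⁻¹`. The `τ`-derivative is taken within `[0, ∞)`. -/
def pushforward {n : ℕ} (P : Euc n × ℝ → Euc n × ℝ) (F : Euc n → ℝ → Euc n) (ε : ℝ)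
    (x : Euc n) (τ : ℝ) : Euc n :=
  let q := phaseInv P (x, τ)
  fderiv ℝ (fun y => (P (y, q.2)).1) q.1 (F q.1 q.2)
    + (ε ^ 2)⁻¹ • derivWithin (fun σ => (P (q.1, σ)).1) (Ici 0) q.2

/-- The pushforward under `Ψ` of the oscillatory system. -/
def pushedField {n : ℕ} (δ₁ δ₂ T : ℝ) (f₁ f₂ : Euc n → ℝ → Euc n) (ε : ℝ) :
    Euc n → ℝ → Euc n :=
  pushforward (Ψ δ₁ δ₂ T f₁ f₂ ε) (oscField f₁ f₂ ε) ε

/-- The remainder `g`, defined by `Ψ_* f_ε = f̄ + ε g` for `ε > 0`. -/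
def remainder {n : ℕ} (δ₁ δ₂ T : ℝ) (f₁ f₂ : Euc n → ℝ → Euc n) (x : Euc n) (τ ε : ℝ) : Euc n :=
  ε⁻¹ • (pushedField δ₁ δ₂ T f₁ f₂ ε x τ - fbar δ₁ δ₂ T f₁ f₂ x)

/-- On `(0, εs)`: `Ψ` is a bijection of `ℝⁿ × [0, ∞)`; `Ψ` and `Ψ⁻¹` move the origin by at most
`L ε` and are Lipschitz in `x` with constant `1 + L ε ≤ 2`. -/
def NearIdentityBounds {n : ℕ} (P : ℝ → Euc n × ℝ → Euc n × ℝ) (L εs : ℝ) : Prop :=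
  ∀ ε ∈ Ioo 0 εs, L * ε ≤ 1 ∧ BijOn (P ε) (phase n) (phase n) ∧
    ∀ τ, 0 ≤ τ →
      ‖(P ε (0, τ)).1‖ ≤ L * ε ∧
      ‖(phaseInv (P ε) (0, τ)).1‖ ≤ L * ε ∧
      ∀ x₁ x₂ : Euc n,
        ‖(P ε (x₁, τ)).1 - (P ε (x₂, τ)).1‖ ≤ (1 + L * ε) * ‖x₁ - x₂‖ ∧
        ‖(phaseInv (P ε) (x₁, τ)).1 - (phaseInv (P ε) (x₂, τ)).1‖ ≤ (1 + L * ε) * ‖x₁ - x₂‖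

/-! ### Lyapunov assumption on the average vector field -/

/-- Lyapunov conditions for the average field, with the growth condition on the remainder. -/
def LyapunovCondition {n : ℕ} (f₁ f₂ : Euc n → ℝ → Euc n) (δ₁ T : ℝ) : Prop :=
  ∃ e δ₂ δ₃ : ℝ, 0 < e ∧ Deltas e δ₁ δ₂ δ₃ ∧
  ∃ (V φ : Euc n → ℝ) (α₁ α₂ : ℝ → ℝ) (c₁ c₂ : ℝ),
    ContDiff ℝ 1 V ∧ PosDefFun φ ∧ ClassKInf α₁ ∧ ClassKInf α₂ ∧ 0 < c₁ ∧ 0 < c₂ ∧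
    (∀ x, α₁ ‖x‖ ≤ V x ∧ V x ≤ α₂ ‖x‖) ∧
    (∀ x, ‖gradient V x‖ ≤ c₂ * φ x) ∧
    (∀ x ∈ outside n δ₃,
      inner ℝ (gradient V x) (fbar δ₁ δ₂ T f₁ f₂ x) ≤ -c₁ * φ x ^ 2) ∧
    ((∃ ε₀ > 0, ∃ Lg > 0, ∀ x ∈ outside n δ₃, ∀ τ, 0 ≤ τ → ∀ ε ∈ Ioc 0 ε₀,
        ‖remainder δ₁ δ₂ T f₁ f₂ x τ ε‖ ≤ Lg * (φ x + 1)) ∨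
      (∃ α₃ : ℝ → ℝ, ClassK α₃ ∧ ∀ x, α₃ ‖x‖ * ‖x‖ ≤ φ x))

/-! ### The transformed bounds -/

/-- The modified class-`KL` function `2 β(3 r, s)`. -/
def betaTilde (β : ℝ → ℝ → ℝ) (r s : ℝ) : ℝ := 2 * β (3 * r) s

/-- The modified bound `(1 + L ε) Δ + L ε + (1 + L ε) β(3 L ε, 0)`. -/
def deltaTilde (L Δ : ℝ) (β : ℝ → ℝ → ℝ) (ε : ℝ) : ℝ :=
  (1 + L * ε) * Δ + L * ε + (1 + L * ε) * β (3 * L * ε) 0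

end

end SecondOrderAveraging

open scoped ContDiff Interval

namespace SecondOrderAveraging

/-! ### Smoothness of the cut-off -/

section Bump

open Polynomial

variable {E : Type*} [NormedAddCommGroup E] [InnerProductSpace ℝ E]

/-! The map Φ = x - εv₁ - ε²v₂ is chosen so that ε⁻² times its time derivative cancels the ε⁻¹ term
of the field and the oscillating part of the order-one term. The exact identity behind this is an
integration by parts: v₂ is the time primitive of f̂₂ - (Dₓv₁)f̂₁ - f̄ (`v₂_eq`), a periodic field
of mean zero (`average_eq`). Hence v₁ and v₂ are periodic, Lipschitz and C¹ in x, which `Correctors`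
records, and Φ is a small Lipschitz perturbation of the identity. Where the truncation is inactive
at the preimage, the pushforward is f̄ plus an error O(ε(1+|x|))
(`Correctors.pushforward_sub_average_le`).

For large |x| this error, or the one granted by alternative (i), is at most εMφ(x). So the
derivative of V along the pushed field is at most -c₁φ² + εc₂Mφ², which for small ε lies below a
negative constant. V then falls at a uniform rate outside a ball, and this gives the (β,Δ)-bound
(`exists_ultimateBound_of_lyapunov`). The bound returns to (S) because Φ maps solutions to solutions
and its inverse is Lipschitz (`Correctors.ultimateBound_of_pushforward`).

Two points need care. The Lyapunov assumption may concern another truncation than the given one; but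
v₁, v₂, f̄ and the pushforward depend only on the fields near one space point, so for large |x| the
two truncations give the same objects (`pushforward_congr`, `average_congr`). And the fields are
merely continuous near the origin, so completeness of maximal solutions rests on Peano's theorem: a
bounded solution on a finite interval can be continued (`IsSolution.exists_continuation`). -/

theorem hasFDerivAt_norm_of_ne {x : E} (hx : x ≠ 0) :
    HasFDerivAt (fun y : E => ‖y‖) (‖x‖⁻¹ • innerSL ℝ x) x := by
  have h := (hasStrictFDerivAt_norm_sq x).hasFDerivAt.sqrt (by simpa using hx)
  have hn : ‖x‖ ≠ 0 := by simpa using hx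
  simp only [Real.sqrt_sq (norm_nonneg _)] at h
  convert h using 1
  ext y
  simp
  field_simp

/-- A function of the norm that vanishes to infinite order at the origin is smooth. -/
theorem contDiff_flat_comp_norm (m : ℕ) : ∀ (p : ℝ[X]) (G : ℝ → ℝ), ContDiff ℝ ∞ G →
    ContDiff ℝ m (fun x : E => p.eval (‖x‖⁻¹) * expNegInvGlue ‖x‖ * G ‖x‖) := by
  induction m with
  | zero =>
    intro p G hG
    rw [Nat.cast_zero, contDiff_zero]
    exact ((expNegInvGlue.continuous_polynomial_eval_inv_mul p).comp continuous_norm).mul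
      (hG.continuous.comp continuous_norm)
  | succ m ih =>
    intro p G hG
    have hG' : ContDiff ℝ ∞ (deriv G) := by
      have : ContDiff ℝ (∞ + 1) G := hG
      exact (contDiff_succ_iff_deriv.1 this).2.2
    -- `q` is the polynomial for which the derivative of p(1/r)e^{-1/r} is q(1/r)e^{-1/r}.
    set q : ℝ[X] := X ^ 2 * (p - derivative p) with hq
    have hd : ∀ r : ℝ, HasDerivAt (fun r => p.eval (r⁻¹) * expNegInvGlue r * G r)
        (q.eval r⁻¹ * expNegInvGlue r * G r + p.eval r⁻¹ * expNegInvGlue r * deriv G r) r :=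
      fun r => (expNegInvGlue.hasDerivAt_polynomial_eval_inv_mul p r).mul
        (hG.differentiable (by simp) r).hasDerivAt
    rw [Nat.cast_succ, contDiff_succ_iff_hasFDerivAt]
    -- A radial function F(|x|) has gradient (F'(|x|)/|x|)x. The division by |x| is one more factor
    -- `X`, so the coefficient stays in the same class and the induction hypothesis applies.
    refine ⟨fun x => ((X * q).eval ‖x‖⁻¹ * expNegInvGlue ‖x‖ * G ‖x‖ +
      (X * p).eval ‖x‖⁻¹ * expNegInvGlue ‖x‖ * deriv G ‖x‖) • innerSL ℝ x, ?_, fun x => ?_⟩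
    · exact ((ih (X * q) G hG).add (ih (X * p) _ hG')).smul (innerSL ℝ).contDiff
    · by_cases hx : x = 0
      · subst hx
        have h0 := (hd 0).isLittleO
        simp only [expNegInvGlue.zero, mul_zero, zero_mul, add_zero, smul_zero, sub_zero] at h0
        refine .of_isLittleO ?_
        simp only [norm_zero, expNegInvGlue.zero, mul_zero, zero_mul, add_zero, sub_zero,
          map_zero, zero_smul, zero_apply]
        have ht : Tendsto (fun x : E => ‖x‖) (𝓝 0) (𝓝 0) := by
          simpa using (continuous_norm (E := E)).tendsto 0
        exact (h0.comp_tendsto ht).trans_isBigO (Asymptotics.isBigO_refl _ _).norm_left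
      · have h := (hd ‖x‖).comp_hasFDerivAt x (hasFDerivAt_norm_of_ne hx)
        refine h.congr_fderiv ?_
        rw [smul_smul]
        congr 1
        simp only [eval_mul, eval_X]
        ring

end Bump

/-! ### The cut-off function and smoothness of the truncated fields. -/

section Cutoff

variable {n : ℕ} {δ₁ δ₂ : ℝ}

theorem contDiff_bump (h₁ : 0 ≤ δ₁) (m : ℕ) : ContDiff ℝ m (bump δ₁ δ₂ : Euc n → ℝ) := by
  by_cases h : δ₁ < δ₂
  · have hb : (bump δ₁ δ₂ : Euc n → ℝ) =
        fun x => Real.smoothTransition ((‖x‖ - δ₁) / (δ₂ - δ₁)) := by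
      funext x; simp [bump, h]
    have hd : 0 < δ₂ - δ₁ := sub_pos.2 h
    rw [hb, contDiff_iff_contDiffAt]
    intro x
    by_cases hx : x = 0
    · rcases h₁.eq_or_lt with h0 | h0
      · subst h0
        -- With δ₁ = 0 the argument |x|/δ₂ is not smooth at the origin. Smoothness comes from the
        -- flat numerator e^{-1/r}; the reciprocal of the denominator plays the role of `G`.
        have hs : ContDiff ℝ ∞ (fun r => (expNegInvGlue r + expNegInvGlue (1 - r))⁻¹) :=
          (expNegInvGlue.contDiff.add (expNegInvGlue.contDiff.comp
            (contDiff_const.sub contDiff_id))).inv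
            fun r => (Real.smoothTransition.pos_denom r).ne'
        have := (contDiff_flat_comp_norm (E := Euc n) m 1 _ hs).comp
          (contDiff_const_smul (δ₂⁻¹ : ℝ))
        refine ContDiff.contDiffAt (Eq.mp (congrArg _ (funext fun y => ?_)) this)
        have h2 : |δ₂| = δ₂ := abs_of_pos h
        simp [Real.smoothTransition, norm_smul, div_eq_mul_inv, h2, mul_comm]
      · have : (fun x : Euc n => Real.smoothTransition ((‖x‖ - δ₁) / (δ₂ - δ₁))) =ᶠ[𝓝 x]
            fun _ => 0 := by
          have : ∀ᶠ y : Euc n in 𝓝 x, ‖y‖ < δ₁ :=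
            continuous_norm.continuousAt.eventually_lt continuousAt_const (by simpa [hx])
          filter_upwards [this] with y hy
          exact Real.smoothTransition.zero_of_nonpos
            (div_nonpos_of_nonpos_of_nonneg (by linarith) hd.le)
        exact contDiffAt_const.congr_of_eventuallyEq this
    · exact Real.smoothTransition.contDiffAt.comp (n := (m : ℕ∞)) x
        (((contDiffAt_norm ℝ hx).sub contDiffAt_const).div_const _)
  · have hb : (bump δ₁ δ₂ : Euc n → ℝ) = fun _ => 1 := by
      funext x; simp [bump, h]
    rw [hb]; exact contDiff_const

theorem bump_nonneg (x : Euc n) : 0 ≤ bump δ₁ δ₂ x := by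
  unfold bump; split_ifs
  · exact Real.smoothTransition.nonneg _
  · exact zero_le_one

theorem bump_le_one (x : Euc n) : bump δ₁ δ₂ x ≤ 1 := by
  unfold bump; split_ifs
  · exact Real.smoothTransition.le_one _
  · exact le_rfl

theorem bump_eq_one {x : Euc n} (hx : δ₂ ≤ ‖x‖) : bump δ₁ δ₂ x = 1 := by
  unfold bump; split_ifs with h
  · exact Real.smoothTransition.one_of_one_le ((one_le_div (sub_pos.2 h)).2 (by linarith))
  · rfl

theorem isOpen_bump_ne (h₁ : 0 ≤ δ₁) : IsOpen {x : Euc n | bump δ₁ δ₂ x ≠ 0} :=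
  isOpen_ne.preimage (contDiff_bump h₁ 0).continuous

/-- The truncation constraint: either there is room between the radii, or both vanish. -/
theorem Deltas.lt_or_eq {e δ₃ : ℝ} (he : 0 < e) (hδ : Deltas e δ₁ δ₂ δ₃) :
    δ₁ < δ₂ ∨ (δ₁ = 0 ∧ δ₂ = 0) := by
  obtain ⟨h0, h12, -⟩ := hδ
  rcases h0.eq_or_lt with h | h
  · subst h
    rcases (show 0 ≤ δ₂ by simpa using h12).eq_or_lt with h' | h'
    · exact Or.inr ⟨rfl, h'.symm⟩
    · exact Or.inl h'
  · left; nlinarith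

theorem Deltas.le {e δ₃ : ℝ} (he : 0 < e) (hδ : Deltas e δ₁ δ₂ δ₃) : δ₁ ≤ δ₂ := by
  rcases hδ.lt_or_eq he with h | ⟨h, h'⟩
  · exact h.le
  · rw [h, h']

theorem mem_outside_of_bump_ne (h : δ₁ < δ₂ ∨ (δ₁ = 0 ∧ δ₂ = 0)) {x : Euc n}
    (hx : bump δ₁ δ₂ x ≠ 0) : x ∈ outside n δ₁ := by
  rcases h with h | ⟨h, -⟩
  · by_contra hlt
    refine hx ?_
    have : ‖x‖ < δ₁ := not_le.1 hlt
    simp only [bump, h, if_true]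
    exact Real.smoothTransition.zero_of_nonpos
      (div_nonpos_of_nonpos_of_nonneg (by linarith) (by linarith))
  · simp [outside, h]

theorem bump_eventually_zero (h : δ₁ < δ₂ ∨ (δ₁ = 0 ∧ δ₂ = 0)) {x : Euc n}
    (hx : x ∉ outside n δ₁) : ∀ᶠ y in 𝓝 x, bump δ₁ δ₂ y = 0 := by
  have : ∀ᶠ y : Euc n in 𝓝 x, ‖y‖ < δ₁ :=
    continuous_norm.continuousAt.eventually_lt continuousAt_const (not_le.1 hx)
  filter_upwards [this] with y hy
  by_contra hne
  exact absurd (mem_outside_of_bump_ne h hne) (not_le.2 hy)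

theorem outside_mem_nhds (h₁ : 0 ≤ δ₁) (h : δ₁ < δ₂ ∨ (δ₁ = 0 ∧ δ₂ = 0)) {x : Euc n}
    (hx : bump δ₁ δ₂ x ≠ 0) : outside n δ₁ ∈ 𝓝 x :=
  mem_of_superset ((isOpen_bump_ne h₁).mem_nhds hx) fun _ hy => mem_outside_of_bump_ne h hy

/-- The values 0 and 1 are the global extrema of the cut-off, so its derivative vanishes wherever
they are attained, boundary spheres included. -/
theorem fderiv_bump_of_zero {x : Euc n} (hx : bump δ₁ δ₂ x = 0) :
    fderiv ℝ (bump δ₁ δ₂) x = 0 :=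
  IsLocalMin.fderiv_eq_zero (Eventually.of_forall fun y => by rw [hx]; exact bump_nonneg y)

theorem fderiv_bump_of_one {x : Euc n} (hx : bump δ₁ δ₂ x = 1) :
    fderiv ℝ (bump δ₁ δ₂) x = 0 :=
  IsLocalMax.fderiv_eq_zero (Eventually.of_forall fun y => by rw [hx]; exact bump_le_one y)

theorem contDiff_hat (h₁ : 0 ≤ δ₁) (h : δ₁ < δ₂ ∨ (δ₁ = 0 ∧ δ₂ = 0)) {k : ℕ}
    {f : Euc n → ℝ → Euc n} (hf : SmoothInX k f (outside n δ₁)) {τ : ℝ} (hτ : 0 ≤ τ) :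
    ContDiff ℝ k (fun x => hat δ₁ δ₂ f x τ) := by
  rw [contDiff_iff_contDiffAt]
  intro x
  by_cases hx : x ∈ outside n δ₁
  · obtain ⟨U, hU, hsub, hc⟩ := hf τ hτ
    exact (contDiff_bump h₁ k).contDiffAt.smul (hc.contDiffAt (hU.mem_nhds (hsub hx)))
  · refine (contDiffAt_const (c := (0 : Euc n))).congr_of_eventuallyEq ?_
    filter_upwards [bump_eventually_zero h hx] with y hy
    simp [hat, hy]

theorem SmoothInX.contDiffAt {k : ℕ} {f : Euc n → ℝ → Euc n} {K : Set (Euc n)}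
    (hf : SmoothInX k f K) {τ : ℝ} (hτ : 0 ≤ τ) {x : Euc n} (hx : x ∈ K) :
    ContDiffAt ℝ k (fun x => f x τ) x := by
  obtain ⟨U, hU, hsub, hc⟩ := hf τ hτ
  exact hc.contDiffAt (hU.mem_nhds (hsub hx))

end Cutoff

/-! ### Lipschitz estimates for the truncated fields -/

section Lipschitz

variable {E P Q Z : Type*} [NormedAddCommGroup E] [NormedSpace ℝ E]
  [NormedAddCommGroup P] [NormedSpace ℝ P] [NormedAddCommGroup Q] [NormedSpace ℝ Q]
  [NormedAddCommGroup Z] [NormedSpace ℝ Z]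

omit [NormedSpace ℝ E] in
/-- A bilinear product of bounded Lipschitz maps is Lipschitz; the second factor need only be
controlled where the first one does not vanish. -/
theorem lipschitz_bilinear (B : P →L[ℝ] Q →L[ℝ] Z) {D S : Set E} {p : E → P} {q : E → Q}
    {Kp Kq Cp Cq : ℝ} (hKp : 0 ≤ Kp) (hKq : 0 ≤ Kq) (hCp : 0 ≤ Cp)
    (hCq : 0 ≤ Cq)
    (hp : ∀ x ∈ D, ∀ y ∈ D, ‖p x - p y‖ ≤ Kp * ‖x - y‖) (hpC : ∀ x ∈ D, ‖p x‖ ≤ Cp)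
    (hpS : ∀ x, x ∉ S → p x = 0)
    (hq : ∀ x ∈ D ∩ S, ∀ y ∈ D ∩ S, ‖q x - q y‖ ≤ Kq * ‖x - y‖)
    (hqC : ∀ x ∈ D ∩ S, ‖q x‖ ≤ Cq) :
    ∀ x ∈ D, ∀ y ∈ D,
      ‖B (p x) (q x) - B (p y) (q y)‖ ≤ ‖B‖ * (Kp * Cq + Cp * Kq) * ‖x - y‖ := by
  have key : ∀ x ∈ D, ∀ y ∈ D, y ∈ S →
      ‖B (p x) (q x) - B (p y) (q y)‖ ≤ ‖B‖ * (Kp * Cq + Cp * Kq) * ‖x - y‖ := by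
    intro x hx y hy hyS
    have h1 : ‖B (p x - p y) (q y)‖ ≤ ‖B‖ * (Kp * ‖x - y‖) * Cq := by
      refine (B.le_opNorm₂ _ _).trans ?_
      have := hp x hx y hy
      have := hqC y ⟨hy, hyS⟩
      gcongr
    by_cases hxS : x ∈ S
    · have h2 : ‖B (p x) (q x - q y)‖ ≤ ‖B‖ * Cp * (Kq * ‖x - y‖) := by
        refine (B.le_opNorm₂ _ _).trans ?_
        have := hq x ⟨hx, hxS⟩ y ⟨hy, hyS⟩
        have := hpC x hx
        gcongr
      have e : B (p x) (q x) - B (p y) (q y) = B (p x) (q x - q y) + B (p x - p y) (q y) := by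
        simp
      rw [e]
      refine (norm_add_le _ _).trans ((add_le_add h2 h1).trans (le_of_eq ?_))
      ring
    · have e : B (p x) (q x) - B (p y) (q y) = B (p x - p y) (q y) := by
        simp [hpS x hxS]
      rw [e]
      refine h1.trans ?_
      have : 0 ≤ ‖B‖ * (Cp * Kq) * ‖x - y‖ := by positivity
      linarith
  intro x hx y hy
  by_cases hyS : y ∈ S
  · exact key x hx y hy hyS
  · by_cases hxS : x ∈ S
    · rw [norm_sub_rev, norm_sub_rev x]
      exact key y hy x hx hxS
    · have h0 : ‖B (p x) (q x) - B (p y) (q y)‖ = 0 := by simp [hpS x hxS, hpS y hyS]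
      rw [h0]
      positivity

omit [NormedSpace ℝ Z] in
/-- Lipschitz bounds inside and outside a ball give a global Lipschitz bound. -/
theorem lipschitz_of_ball_of_outside {F : E → Z} {R K : ℝ}
    (hin : ∀ x ∈ Metric.closedBall (0 : E) R, ∀ y ∈ Metric.closedBall (0 : E) R,
      ‖F x - F y‖ ≤ K * ‖x - y‖)
    (hout : ∀ x y, R ≤ ‖x‖ → R ≤ ‖y‖ → ‖F x - F y‖ ≤ K * ‖x - y‖) (x y : E) :
    ‖F x - F y‖ ≤ K * ‖x - y‖ := by
  simp only [mem_closedBall_zero_iff] at hin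
  have key : ∀ x y : E, ‖x‖ ≤ R → R ≤ ‖y‖ → ‖F x - F y‖ ≤ K * ‖x - y‖ := by
    intro x y hx hy
    have hc : ContinuousOn (fun t : ℝ => ‖x + t • (y - x)‖) (Icc 0 1) := by fun_prop
    -- The segment from `x` to `y` meets the sphere of radius `R` at a point `z`. Distances add up
    -- along the segment, so the constant does not grow.
    obtain ⟨t, ht, hz⟩ := intermediate_value_Icc zero_le_one hc
      (show R ∈ Icc _ _ from ⟨by simpa using hx, by simpa using hy⟩)
    simp only at hz
    set z := x + t • (y - x) with hzdef
    have h1 := hin x hx z hz.le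
    have h2 := hout z y hz.ge hy
    have e1 : ‖x - z‖ = t * ‖x - y‖ := by
      rw [hzdef, show x - (x + t • (y - x)) = t • (x - y) by module, norm_smul,
        Real.norm_of_nonneg ht.1]
    have e2 : ‖z - y‖ = (1 - t) * ‖x - y‖ := by
      rw [hzdef, show x + t • (y - x) - y = (1 - t) • (x - y) by module, norm_smul,
        Real.norm_of_nonneg (by linarith [ht.2])]
    calc ‖F x - F y‖ = ‖(F x - F z) + (F z - F y)‖ := by congr 1; abel
      _ ≤ K * ‖x - z‖ + K * ‖z - y‖ := (norm_add_le _ _).trans (add_le_add h1 h2)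
      _ = K * ‖x - y‖ := by rw [e1, e2]; ring
  rcases le_total ‖x‖ R with hx | hx <;> rcases le_total ‖y‖ R with hy | hy
  · exact hin x hx y hy
  · exact key x y hx hy
  · rw [norm_sub_rev, norm_sub_rev x]; exact key y x hy hx
  · exact hout x y hx hy

end Lipschitz

/-! ### Uniform bounds for the truncated fields and their quadratic products. -/

section Truncated

variable {n : ℕ} {δ₁ δ₂ T : ℝ} {f : Euc n → ℝ → Euc n}

/-- Every estimate uniform in τ ≥ 0 is reduced by this to the compact interval [0,T]. -/
theorem exists_period_reduction {α : Type*} {f : ℝ → α} (hT : 0 < T)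
    (hf : ∀ τ, 0 ≤ τ → f (τ + T) = f τ) {τ : ℝ} (hτ : 0 ≤ τ) :
    f (τ - ⌊τ / T⌋₊ * T) = f τ ∧ τ - ⌊τ / T⌋₊ * T ∈ Icc 0 T := by
  have h1 : (⌊τ / T⌋₊ : ℝ) * T ≤ τ := (le_div_iff₀ hT).1 (Nat.floor_le (by positivity))
  have h2 : τ < (⌊τ / T⌋₊ + 1 : ℝ) * T := (div_lt_iff₀ hT).1 (Nat.lt_floor_add_one _)
  refine ⟨?_, ⟨by linarith, by linarith⟩⟩
  have : ∀ (m : ℕ) (σ : ℝ), 0 ≤ σ → f (σ + m * T) = f σ := by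
    intro m
    induction m with
    | zero => simp
    | succ m ih =>
      intro σ hσ
      rw [Nat.cast_succ, add_one_mul, ← add_assoc, hf _ (by positivity), ih σ hσ]
  rw [← this ⌊τ / T⌋₊ _ (by linarith)]
  congr 1; ring

theorem exists_bound_on_ball (hT : 0 < T)
    (hc : ContinuousOn (fun p : Euc n × ℝ => f p.1 p.2) (univ ×ˢ Ici 0))
    (hper : ∀ x τ, 0 ≤ τ → f x (τ + T) = f x τ) (R : ℝ) :
    ∃ C, 0 ≤ C ∧ ∀ x ∈ Metric.closedBall (0 : Euc n) R, ∀ τ, 0 ≤ τ → ‖f x τ‖ ≤ C := by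
  obtain ⟨C, hC⟩ := ((isCompact_closedBall (0 : Euc n) R).prod
    (isCompact_Icc (a := (0 : ℝ)) (b := T))).exists_bound_of_continuousOn
    (hc.mono (prod_mono (subset_univ _) fun _ h => h.1))
  refine ⟨max C 0, le_max_right _ _, fun x hx τ hτ => ?_⟩
  obtain ⟨h1, h2⟩ := exists_period_reduction (f := f x) hT (hper x) hτ
  rw [← h1]
  exact (hC (x, _) ⟨hx, h2⟩).trans (le_max_left _ _)

/-- Uniform bounds of the cut-off and its derivative. -/
theorem exists_bump_bounds (h₁ : 0 ≤ δ₁) :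
    ∃ K, 0 ≤ K ∧
      (∀ x ∈ Metric.closedBall (0 : Euc n) δ₂, ∀ y ∈ Metric.closedBall (0 : Euc n) δ₂,
        ‖bump δ₁ δ₂ x - bump δ₁ δ₂ y‖ ≤ K * ‖x - y‖) ∧
      (∀ x ∈ Metric.closedBall (0 : Euc n) δ₂, ‖fderiv ℝ (bump δ₁ δ₂) x‖ ≤ K) ∧
      (∀ x ∈ Metric.closedBall (0 : Euc n) δ₂, ∀ y ∈ Metric.closedBall (0 : Euc n) δ₂,
        ‖fderiv ℝ (bump δ₁ δ₂) x - fderiv ℝ (bump δ₁ δ₂) y‖ ≤ K * ‖x - y‖) := by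
  have hb : ContDiff ℝ 2 (bump δ₁ δ₂ : Euc n → ℝ) := contDiff_bump h₁ 2
  have hb' : ContDiff ℝ 1 (fderiv ℝ (bump δ₁ δ₂ : Euc n → ℝ)) :=
    hb.fderiv_right (by norm_num)
  have hcomp := isCompact_closedBall (0 : Euc n) δ₂
  obtain ⟨C, hC⟩ := hcomp.exists_bound_of_continuousOn hb'.continuous.continuousOn
  obtain ⟨C', hC'⟩ := hcomp.exists_bound_of_continuousOn
    (hb'.continuous_fderiv (by norm_num)).continuousOn
  refine ⟨max (max C C') 0, le_max_right _ _, ?_, ?_, ?_⟩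
  · intro x hx y hy
    exact (convex_closedBall (0 : Euc n) δ₂).norm_image_sub_le_of_norm_fderiv_le
      (fun z _ => (hb.differentiable (by norm_num)) z)
      (fun z hz => (hC z hz).trans ((le_max_left _ _).trans (le_max_left _ _))) hy hx
  · exact fun x hx => (hC x hx).trans ((le_max_left _ _).trans (le_max_left _ _))
  · intro x hx y hy
    exact (convex_closedBall (0 : Euc n) δ₂).norm_image_sub_le_of_norm_fderiv_le
      (fun z _ => (hb'.differentiable (by norm_num)) z)
      (fun z hz => (hC' z hz).trans ((le_max_right _ _).trans (le_max_left _ _))) hy hx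

/-- The field is Lipschitz only on |x| ≥ δ₁, but the cut-off vanishes elsewhere. Inside the ball of
radius δ₂ the product estimate uses boundedness of the field; outside it the truncation does
nothing. -/
theorem hat_lipschitz (h₁ : 0 ≤ δ₁) (h₁₂ : δ₁ ≤ δ₂) (h : δ₁ < δ₂ ∨ (δ₁ = 0 ∧ δ₂ = 0))
    (hT : 0 < T)
    (hc : ContinuousOn (fun p : Euc n × ℝ => f p.1 p.2) (univ ×ˢ Ici 0))
    (hper : ∀ x τ, 0 ≤ τ → f x (τ + T) = f x τ)
    (hlip : ∃ L > 0, ∀ x₁ ∈ outside n δ₁, ∀ x₂ ∈ outside n δ₁, ∀ τ, 0 ≤ τ →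
      ‖f x₁ τ - f x₂ τ‖ ≤ L * ‖x₁ - x₂‖) :
    ∃ K, 0 ≤ K ∧ ∀ τ, 0 ≤ τ → ∀ x y,
      ‖hat δ₁ δ₂ f x τ - hat δ₁ δ₂ f y τ‖ ≤ K * ‖x - y‖ := by
  obtain ⟨L, hL, hlip⟩ := hlip
  obtain ⟨C, hC0, hC⟩ := exists_bound_on_ball hT hc hper δ₂
  obtain ⟨Kb, hKb, hb1, -, -⟩ := exists_bump_bounds (n := n) (δ₂ := δ₂) h₁
  set B : ℝ →L[ℝ] Euc n →L[ℝ] Euc n := ContinuousLinearMap.lsmul ℝ ℝ with hB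
  refine ⟨max L (‖B‖ * (Kb * C + 1 * L)), hL.le.trans (le_max_left _ _), fun τ hτ => ?_⟩
  refine lipschitz_of_ball_of_outside (R := δ₂) ?_ ?_
  · intro x hx y hy
    have := lipschitz_bilinear B (D := Metric.closedBall (0 : Euc n) δ₂)
      (S := {x | bump δ₁ δ₂ x ≠ 0}) (p := bump δ₁ δ₂) (q := fun x => f x τ)
      hKb hL.le zero_le_one hC0 hb1
      (fun x _ => by rw [Real.norm_of_nonneg (bump_nonneg x)]; exact bump_le_one x)
      (fun x hx => by simpa using hx)
      (fun x hx y hy => hlip x (mem_outside_of_bump_ne h hx.2) y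
        (mem_outside_of_bump_ne h hy.2) τ hτ)
      (fun x hx => hC x hx.1 τ hτ) x hx y hy
    refine this.trans ?_
    gcongr
    exact le_max_right _ _
  · intro x y hx hy
    simp only [hat, bump_eq_one hx, bump_eq_one hy, one_smul]
    refine (hlip x (h₁₂.trans hx) y (h₁₂.trans hy) τ hτ).trans ?_
    gcongr
    exact le_max_left _ _

theorem Dx_hat_apply (h₁ : 0 ≤ δ₁) (h : δ₁ < δ₂ ∨ (δ₁ = 0 ∧ δ₂ = 0))
    (hf : SmoothInX 2 f (outside n δ₁)) {x : Euc n} (hx : bump δ₁ δ₂ x ≠ 0) {r : ℝ}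
    (hr : 0 ≤ r) (y : Euc n) :
    Dx (hat δ₁ δ₂ f) x r y
      = bump δ₁ δ₂ x • Dx f x r y + (fderiv ℝ (bump δ₁ δ₂) x y) • f x r := by
  have h1 : DifferentiableAt ℝ (bump δ₁ δ₂) x :=
    (contDiff_bump h₁ 1).differentiable (by norm_num) x
  have h2 : DifferentiableAt ℝ (fun z => f z r) x :=
    (hf.contDiffAt hr (mem_outside_of_bump_ne h hx)).differentiableAt (by norm_num)
  unfold Dx hat
  rw [fderiv_fun_smul h1 h2]
  simp

theorem Dx_norm_le (h₁ : 0 ≤ δ₁) (h : δ₁ < δ₂ ∨ (δ₁ = 0 ∧ δ₂ = 0)) {L : ℝ} (hL : 0 ≤ L)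
    (hlip : ∀ x₁ ∈ outside n δ₁, ∀ x₂ ∈ outside n δ₁, ∀ τ, 0 ≤ τ →
      ‖f x₁ τ - f x₂ τ‖ ≤ L * ‖x₁ - x₂‖) {x : Euc n} (hx : bump δ₁ δ₂ x ≠ 0) {r : ℝ}
    (hr : 0 ≤ r) : ‖Dx f x r‖ ≤ L := by
  have := norm_fderiv_le_of_lipschitzOn ℝ (f := fun z => f z r) (C := L.toNNReal)
    (outside_mem_nhds h₁ h hx)
    (LipschitzOnWith.of_dist_le_mul fun y hy z hz => by
      rw [dist_eq_norm, dist_eq_norm, Real.coe_toNNReal _ hL]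
      exact hlip y hy z hz r hr)
  rwa [Real.coe_toNNReal _ hL] at this

/-- The product rule gives (Df̂)f̂ = φ²(Df)f + φ(Dφ·f)f with cut-off φ. The third Lipschitz
hypothesis controls the first term, and the second is supported in a ball, where all factors are
bounded. -/
theorem Dx_hat_hat_lipschitz (h₁ : 0 ≤ δ₁) (h₁₂ : δ₁ ≤ δ₂)
    (h : δ₁ < δ₂ ∨ (δ₁ = 0 ∧ δ₂ = 0)) (hT : 0 < T)
    (hc : ContinuousOn (fun p : Euc n × ℝ => f p.1 p.2) (univ ×ˢ Ici 0))
    (hper : ∀ x τ, 0 ≤ τ → f x (τ + T) = f x τ)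
    (hlip : ∃ L > 0, ∀ x₁ ∈ outside n δ₁, ∀ x₂ ∈ outside n δ₁, ∀ τ, 0 ≤ τ →
      ‖f x₁ τ - f x₂ τ‖ ≤ L * ‖x₁ - x₂‖)
    (hf : SmoothInX 2 f (outside n δ₁))
    (hlip₃ : ∃ L₃ > 0, ∀ x₁ ∈ outside n δ₁, ∀ x₂ ∈ outside n δ₁, ∀ τ₁ τ₂, 0 ≤ τ₁ → 0 ≤ τ₂ →
      ‖Dx f x₁ τ₁ (f x₁ τ₂) - Dx f x₂ τ₁ (f x₂ τ₂)‖ ≤ L₃ * ‖x₁ - x₂‖) :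
    ∃ K, 0 ≤ K ∧ ∀ r s, 0 ≤ r → 0 ≤ s → ∀ x y,
      ‖Dx (hat δ₁ δ₂ f) x r (hat δ₁ δ₂ f x s) - Dx (hat δ₁ δ₂ f) y r (hat δ₁ δ₂ f y s)‖
        ≤ K * ‖x - y‖ := by
  obtain ⟨Kh, hKh0, hKh⟩ := hat_lipschitz h₁ h₁₂ h hT hc hper hlip
  obtain ⟨L, hL, hlip⟩ := hlip
  obtain ⟨L₃, hL₃, hlip₃⟩ := hlip₃
  obtain ⟨C, hC0, hC⟩ := exists_bound_on_ball hT hc hper δ₂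
  obtain ⟨Kb, hKb, hb1, hb2, hb3⟩ := exists_bump_bounds (n := n) (δ₂ := δ₂) h₁
  set B : ℝ →L[ℝ] Euc n →L[ℝ] Euc n := ContinuousLinearMap.lsmul ℝ ℝ with hB
  set B' : ℝ →L[ℝ] ℝ →L[ℝ] ℝ := ContinuousLinearMap.lsmul ℝ ℝ with hB'
  set I := ContinuousLinearMap.id ℝ (Euc n →L[ℝ] ℝ) with hI
  set D := Metric.closedBall (0 : Euc n) δ₂ with hD
  set S : Set (Euc n) := {x | bump δ₁ δ₂ x ≠ 0} with hS
  set M₁ := ‖B'‖ * (Kb * 1 + 1 * Kb) with hM₁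
  set M₂ := ‖B‖ * (M₁ * (L * C) + 1 * L₃) with hM₂
  set N₁ := ‖I‖ * (Kb * C + Kb * L) with hN₁
  set N₂ := ‖B‖ * (N₁ * C + (Kb * C) * Kh) with hN₂
  refine ⟨max L₃ (M₂ + N₂), hL₃.le.trans (le_max_left _ _), fun r s hr hs => ?_⟩
  refine lipschitz_of_ball_of_outside (R := δ₂) ?_ ?_
  · have hb01 : ∀ x, ‖bump δ₁ δ₂ (x : Euc n)‖ ≤ 1 := fun x => by
      rw [Real.norm_of_nonneg (bump_nonneg x)]; exact bump_le_one x
    -- In the second term the factor φ moves from f(x,s) to f(x,r), which becomes f̂(x,r) and is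
    -- already globally Lipschitz. Where φ = 0 both sides vanish, whatever the value of `Dx f`
    -- there.
    have e : ∀ x, Dx (hat δ₁ δ₂ f) x r (hat δ₁ δ₂ f x s)
        = B (B' (bump δ₁ δ₂ x) (bump δ₁ δ₂ x)) (Dx f x r (f x s))
          + B (I (fderiv ℝ (bump δ₁ δ₂) x) (f x s)) (hat δ₁ δ₂ f x r) := by
      intro x
      by_cases hx : bump δ₁ δ₂ x = 0
      · simp [hat, hx, hB, hB']
      · rw [Dx_hat_apply h₁ h hf hx hr]
        simp only [hat, map_smul, smul_eq_mul, hB, hB', hI, ContinuousLinearMap.lsmul_apply,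
          ContinuousLinearMap.id_apply, smul_smul]
    have hbS : ∀ x, x ∉ S → bump δ₁ δ₂ x = 0 := fun x hx => by simpa [hS] using hx
    have hbb := lipschitz_bilinear B' (D := D) (S := S)
      (p := bump δ₁ δ₂) (q := fun x => bump δ₁ δ₂ x) hKb hKb zero_le_one zero_le_one hb1
      (fun x _ => hb01 x) hbS (fun x hx y hy => hb1 x hx.1 y hy.1) (fun x _ => hb01 x)
    have hT₁C : ∀ x ∈ D ∩ S, ‖Dx f x r (f x s)‖ ≤ L * C := fun x hx =>
      ((Dx f x r).le_opNorm _).trans (mul_le_mul (Dx_norm_le h₁ h hL.le hlip hx.2 hr)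
        (hC x hx.1 s hs) (norm_nonneg _) hL.le)
    have hM := lipschitz_bilinear B (D := D) (S := S)
      (p := fun x => B' (bump δ₁ δ₂ x) (bump δ₁ δ₂ x)) (q := fun x => Dx f x r (f x s))
      (by positivity) hL₃.le zero_le_one (by positivity) hbb
      (fun x _ => by
        simp only [hB', ContinuousLinearMap.lsmul_apply, smul_eq_mul, norm_mul]
        exact mul_le_one₀ (hb01 x) (norm_nonneg _) (hb01 x))
      (fun x hx => by simp [hB', hbS x hx])
      (fun x hx y hy => hlip₃ x (mem_outside_of_bump_ne h hx.2) y
        (mem_outside_of_bump_ne h hy.2) r s hr hs) hT₁C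
    have hdb := lipschitz_bilinear I (D := D) (S := S)
      (p := fderiv ℝ (bump δ₁ δ₂)) (q := fun x => f x s) hKb hL.le hKb hC0 hb3 hb2
      (fun x hx => fderiv_bump_of_zero (hbS x hx))
      (fun x hx y hy => hlip x (mem_outside_of_bump_ne h hx.2) y
        (mem_outside_of_bump_ne h hy.2) s hs) (fun x hx => hC x hx.1 s hs)
    have hN := lipschitz_bilinear B (D := D) (S := univ)
      (p := fun x => I (fderiv ℝ (bump δ₁ δ₂) x) (f x s)) (q := fun x => hat δ₁ δ₂ f x r)
      (by positivity) hKh0 (by positivity) hC0 hdb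
      (fun x hx => ((fderiv ℝ (bump δ₁ δ₂) x).le_opNorm _).trans
        (mul_le_mul (hb2 x hx) (hC x hx s hs) (norm_nonneg _) hKb))
      (fun x hx => absurd (mem_univ x) hx) (fun x _ y _ => hKh r hr x y)
      (fun x hx => by
        rw [hat, norm_smul]
        exact (mul_le_mul (hb01 x) (hC x hx.1 r hr) (norm_nonneg _) zero_le_one).trans
          (one_mul C).le)
    intro x hx y hy
    rw [e, e, add_sub_add_comm]
    refine (norm_add_le _ _).trans ((add_le_add (hM x hx y hy) (hN x hx y hy)).trans ?_)
    rw [← add_mul]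
    gcongr
    exact le_max_right _ _
  · intro x y hx hy
    have hone : ∀ x : Euc n, δ₂ ≤ ‖x‖ → Dx (hat δ₁ δ₂ f) x r (hat δ₁ δ₂ f x s)
        = Dx f x r (f x s) := by
      intro x hx
      have h1 := bump_eq_one (δ₁ := δ₁) hx
      rw [Dx_hat_apply h₁ h hf (by rw [h1]; exact one_ne_zero) hr, fderiv_bump_of_one h1]
      simp [hat, h1]
    rw [hone x hx, hone y hy]
    refine (hlip₃ x (h₁₂.trans hx) y (h₁₂.trans hy) r s hr hs).trans ?_
    gcongr
    exact le_max_left _ _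

end Truncated

/-! ### Integrals depending on a parameter -/

section Parametric

open MeasureTheory

variable {n : ℕ}

/-- In finite dimension an operator is a finite sum of rank-one terms built from its columns, so
measurability can be tested on vectors. -/
theorem aestronglyMeasurable_clm {μ : Measure ℝ} {A : ℝ → Euc n →L[ℝ] Euc n}
    (h : ∀ v, AEStronglyMeasurable (fun r => A r v) μ) : AEStronglyMeasurable A μ := by
  have e : A = fun r => ∑ i, ContinuousLinearMap.smulRightL ℝ (Euc n) (Euc n)
      (EuclideanSpace.proj i) (A r (EuclideanSpace.single i 1)) := by
    funext r
    ext1 v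
    have hv : v = ∑ i, v i • EuclideanSpace.single i (1 : ℝ) := by
      ext j
      simp [Pi.single_apply]
    conv_lhs => rw [hv]
    simp
  rw [e]
  refine Finset.aestronglyMeasurable_fun_sum _ fun i _ => ?_
  exact (ContinuousLinearMap.smulRightL ℝ (Euc n) (Euc n)
    (EuclideanSpace.proj i)).continuous.comp_aestronglyMeasurable (h _)

/-- The fields are smooth in x for each τ separately, so the Jacobian need not be continuous in τ.
It is measurable as a limit of difference quotients. -/
theorem aestronglyMeasurable_Dx {μ : Measure ℝ} {F : Euc n → ℝ → Euc n}
    (hF : ∀ x, AEStronglyMeasurable (F x) μ) {x : Euc n}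
    (hd : ∀ᵐ r ∂μ, DifferentiableAt ℝ (fun y => F y r) x) :
    AEStronglyMeasurable (Dx F x) μ := by
  refine aestronglyMeasurable_clm fun v => ?_
  refine aestronglyMeasurable_of_tendsto_ae atTop
    (f := fun (m : ℕ) r => (m : ℝ) • (F (x + (m : ℝ)⁻¹ • v) r - F x r)) (fun m => ?_) ?_
  · exact ((hF _).sub (hF x)).const_smul (m : ℝ)
  · filter_upwards [hd] with r hr
    exact hr.hasFDerivAt.lim v (by simpa using tendsto_natCast_atTop_atTop)

theorem Dx_norm_le_of_lipschitz {F : Euc n → ℝ → Euc n} {K r : ℝ} (hK : 0 ≤ K)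
    (hlip : ∀ x y, ‖F x r - F y r‖ ≤ K * ‖x - y‖) (x : Euc n) : ‖Dx F x r‖ ≤ K := by
  have := norm_fderiv_le_of_lipschitz ℝ (f := fun z => F z r) (C := K.toNNReal) (x₀ := x)
    (LipschitzWith.of_dist_le_mul fun y z => by
      rw [dist_eq_norm, dist_eq_norm, Real.coe_toNNReal _ hK]
      exact hlip y z)
  rwa [Real.coe_toNNReal _ hK] at this

variable {F : Euc n → ℝ → Euc n} {b K : ℝ}

theorem ae_uIoc_mem_Icc (hb : 0 ≤ b) :
    ∀ᵐ r ∂(volume.restrict (Ι (0 : ℝ) b)), r ∈ Icc 0 b := by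
  rw [uIoc_of_le hb]
  filter_upwards [ae_restrict_mem measurableSet_Ioc] with r hr using ⟨hr.1.le, hr.2⟩

/-- The uniform Lipschitz constant is the dominating function for differentiation under the
integral, so no joint continuity of the Jacobian is required. -/
theorem hasFDerivAt_parametric (hb : 0 ≤ b) (hK : 0 ≤ K)
    (hint : ∀ x, IntervalIntegrable (F x) volume 0 b)
    (hlip : ∀ r ∈ Icc 0 b, ∀ x y, ‖F x r - F y r‖ ≤ K * ‖x - y‖)
    (hd : ∀ r ∈ Icc 0 b, Differentiable ℝ (fun x => F x r)) (x : Euc n) :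
    IntervalIntegrable (Dx F x) volume 0 b ∧
      HasFDerivAt (fun x => ∫ r in (0 : ℝ)..b, F x r) (∫ r in (0 : ℝ)..b, Dx F x r) x := by
  have hm : ∀ x, AEStronglyMeasurable (F x) (volume.restrict (Ι 0 b)) := fun x =>
    (intervalIntegrable_iff.1 (hint x)).aestronglyMeasurable
  refine hasFDerivAt_integral_of_dominated_loc_of_lip_interval (bound := fun _ => K)
    univ_mem (Eventually.of_forall hm) (hint x)
    (aestronglyMeasurable_Dx hm ?_) ?_ intervalIntegrable_const ?_
  · filter_upwards [ae_uIoc_mem_Icc hb] with r hr using hd r hr x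
  · filter_upwards [ae_uIoc_mem_Icc hb] with r hr
    refine LipschitzOnWith.of_dist_le_mul fun y _ z _ => ?_
    rw [dist_eq_norm, dist_eq_norm, Real.coe_nnabs, abs_of_nonneg hK]
    exact hlip r hr y z
  · filter_upwards [ae_uIoc_mem_Icc hb] with r hr using (hd r hr x).hasFDerivAt

theorem continuous_integral_Dx (hb : 0 ≤ b) (hK : 0 ≤ K)
    (hint : ∀ x, IntervalIntegrable (F x) volume 0 b)
    (hlip : ∀ r ∈ Icc 0 b, ∀ x y, ‖F x r - F y r‖ ≤ K * ‖x - y‖)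
    (hd : ∀ r ∈ Icc 0 b, ContDiff ℝ 1 (fun x => F x r)) :
    Continuous fun x => ∫ r in (0 : ℝ)..b, Dx F x r := by
  have hm : ∀ x, AEStronglyMeasurable (F x) (volume.restrict (Ι 0 b)) := fun x =>
    (intervalIntegrable_iff.1 (hint x)).aestronglyMeasurable
  refine intervalIntegral.continuous_of_dominated_interval (bound := fun _ => K)
    (fun x => aestronglyMeasurable_Dx hm ?_) (fun x => ?_) intervalIntegrable_const ?_
  · filter_upwards [ae_uIoc_mem_Icc hb] with r hr using (hd r hr).differentiable (by simp) x
  · refine (ae_restrict_iff' measurableSet_uIoc).1 ?_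
    filter_upwards [ae_uIoc_mem_Icc hb] with r hr
    exact Dx_norm_le_of_lipschitz hK (hlip r hr) x
  · refine (ae_restrict_iff' measurableSet_uIoc).1 ?_
    filter_upwards [ae_uIoc_mem_Icc hb] with r hr
    exact (hd r hr).continuous_fderiv (by simp)

theorem contDiff_parametric (hb : 0 ≤ b) (hK : 0 ≤ K)
    (hint : ∀ x, IntervalIntegrable (F x) volume 0 b)
    (hlip : ∀ r ∈ Icc 0 b, ∀ x y, ‖F x r - F y r‖ ≤ K * ‖x - y‖)
    (hd : ∀ r ∈ Icc 0 b, ContDiff ℝ 1 (fun x => F x r)) :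
    ContDiff ℝ 1 fun x => ∫ r in (0 : ℝ)..b, F x r :=
  contDiff_one_iff_hasFDerivAt.2 ⟨_, continuous_integral_Dx hb hK hint hlip hd, fun x =>
    (hasFDerivAt_parametric hb hK hint hlip
      (fun r hr => (hd r hr).differentiable (by simp)) x).2⟩

theorem norm_integral_sub_le (hb : 0 ≤ b)
    (hint : ∀ x, IntervalIntegrable (F x) volume 0 b)
    (hlip : ∀ r ∈ Icc 0 b, ∀ x y, ‖F x r - F y r‖ ≤ K * ‖x - y‖) (x y : Euc n) :
    ‖(∫ r in (0 : ℝ)..b, F x r) - ∫ r in (0 : ℝ)..b, F y r‖ ≤ b * K * ‖x - y‖ := by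
  rw [← intervalIntegral.integral_sub (hint x) (hint y)]
  refine (intervalIntegral.norm_integral_le_of_norm_le_const (C := K * ‖x - y‖)
    fun r hr => ?_).trans (le_of_eq ?_)
  · rw [uIoc_of_le hb] at hr
    exact hlip r ⟨hr.1.le, hr.2⟩ x y
  · rw [sub_zero, abs_of_nonneg hb]; ring

end Parametric

/-! ### Periodic fields and their primitives -/

/-- Jointly continuous, `T`-periodic time-dependent fields that are `K`-Lipschitz and
continuously differentiable in space. -/
structure PeriodicField {n : ℕ} (h : Euc n → ℝ → Euc n) (T K : ℝ) : Prop where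
  period_pos : 0 < T
  const_nonneg : 0 ≤ K
  cont : ContinuousOn (fun p : Euc n × ℝ => h p.1 p.2) (univ ×ˢ Ici 0)
  lip : ∀ τ, 0 ≤ τ → ∀ x y, ‖h x τ - h y τ‖ ≤ K * ‖x - y‖
  per : ∀ x τ, 0 ≤ τ → h x (τ + T) = h x τ
  smooth : ∀ τ, 0 ≤ τ → ContDiff ℝ 1 (fun x => h x τ)

namespace PeriodicField

open MeasureTheory

variable {n : ℕ} {h h' : Euc n → ℝ → Euc n} {T K K' : ℝ}

theorem continuousOn_time (H : PeriodicField h T K) (x : Euc n) : ContinuousOn (h x) (Ici 0) :=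
  H.cont.comp (f := fun τ => (x, τ)) (by fun_prop) fun _ hτ => ⟨mem_univ _, hτ⟩

theorem intervalIntegrable (H : PeriodicField h T K) (x : Euc n) {a b : ℝ} (ha : 0 ≤ a)
    (hb : 0 ≤ b) : IntervalIntegrable (h x) volume a b :=
  ((H.continuousOn_time x).mono fun _ ht => (le_inf ha hb).trans ht.1).intervalIntegrable

theorem Dx_norm_le (H : PeriodicField h T K) {r : ℝ} (hr : 0 ≤ r) (x : Euc n) :
    ‖Dx h x r‖ ≤ K :=
  Dx_norm_le_of_lipschitz H.const_nonneg (H.lip r hr) x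

theorem intervalIntegrable_Dx (H : PeriodicField h T K) (x : Euc n) {b : ℝ} (hb : 0 ≤ b) :
    IntervalIntegrable (Dx h x) volume 0 b :=
  (hasFDerivAt_parametric hb H.const_nonneg (fun x => H.intervalIntegrable x le_rfl hb)
    (fun r hr => H.lip r hr.1) (fun r hr => (H.smooth r hr.1).differentiable (by simp)) x).1

theorem hasFDerivAt_primitive (H : PeriodicField h T K) (x : Euc n) {b : ℝ} (hb : 0 ≤ b) :
    HasFDerivAt (fun y => v₁ h y b) (∫ r in (0 : ℝ)..b, Dx h x r) x :=
  (hasFDerivAt_parametric hb H.const_nonneg (fun x => H.intervalIntegrable x le_rfl hb)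
    (fun r hr => H.lip r hr.1) (fun r hr => (H.smooth r hr.1).differentiable (by simp)) x).2

theorem Dx_primitive (H : PeriodicField h T K) (x : Euc n) {b : ℝ} (hb : 0 ≤ b) :
    Dx (v₁ h) x b = ∫ r in (0 : ℝ)..b, Dx h x r :=
  (H.hasFDerivAt_primitive x hb).fderiv

theorem Dx_primitive_sub_le (H : PeriodicField h T K) (x : Euc n) {a b : ℝ} (ha : 0 ≤ a)
    (hb : 0 ≤ b) : ‖Dx (v₁ h) x b - Dx (v₁ h) x a‖ ≤ K * |b - a| := by
  rw [H.Dx_primitive x hb, H.Dx_primitive x ha, intervalIntegral.integral_interval_sub_left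
    (H.intervalIntegrable_Dx x hb) (H.intervalIntegrable_Dx x ha)]
  refine intervalIntegral.norm_integral_le_of_norm_le_const fun r hr => ?_
  exact H.Dx_norm_le ((le_inf ha hb).trans (uIoc_subset_uIcc hr).1) x

/-- `Dx h` itself may fail to be jointly continuous, but its time integral is: continuous in x for a
fixed endpoint by dominated convergence, and Lipschitz in the endpoint uniformly in x. -/
theorem continuousOn_Dx_primitive (H : PeriodicField h T K) :
    ContinuousOn (fun p : Euc n × ℝ => Dx (v₁ h) p.1 p.2) (univ ×ˢ Ici 0) := by
  rintro ⟨x, b⟩ ⟨-, hb⟩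
  have hb : 0 ≤ b := hb
  have hc : Continuous fun y => Dx (v₁ h) y b := by
    have := continuous_integral_Dx hb H.const_nonneg (fun x => H.intervalIntegrable x le_rfl hb)
      (fun r hr => H.lip r hr.1) (fun r hr => H.smooth r hr.1)
    refine this.congr fun y => (H.Dx_primitive y hb).symm
  have h1 : Tendsto (fun p : Euc n × ℝ => Dx (v₁ h) p.1 b)
      (𝓝[univ ×ˢ Ici 0] (x, b)) (𝓝 (Dx (v₁ h) x b)) :=
    ((hc.comp continuous_fst).tendsto (x, b)).mono_left nhdsWithin_le_nhds
  have h2 : Tendsto (fun p : Euc n × ℝ => Dx (v₁ h) p.1 p.2 - Dx (v₁ h) p.1 b)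
      (𝓝[univ ×ˢ Ici 0] (x, b)) (𝓝 0) := by
    refine squeeze_zero_norm' (a := fun p : Euc n × ℝ => K * |p.2 - b|) ?_ ?_
    · filter_upwards [self_mem_nhdsWithin] with p hp
      exact H.Dx_primitive_sub_le p.1 hb hp.2
    · have : Continuous fun p : Euc n × ℝ => K * |p.2 - b| := by fun_prop
      simpa using (this.tendsto (x, b)).mono_left nhdsWithin_le_nhds
  have := h2.add h1
  simpa [ContinuousWithinAt] using this

theorem hasDerivWithinAt_primitive (H : PeriodicField h T K) (x : Euc n) {τ : ℝ} (hτ : 0 ≤ τ) :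
    HasDerivWithinAt (v₁ h x) (h x τ) (Ici 0) τ := by
  have hc := H.continuousOn_time x
  -- Freezing the field at time 0 for negative times makes the integrand continuous on ℝ; the
  -- primitive on [0,∞) is unchanged.
  have hext : Continuous fun s => h x (max s 0) :=
    hc.comp_continuous (by fun_prop) fun s => mem_Ici.2 (le_max_right _ _)
  have h1 : HasDerivAt (fun t => ∫ s in (0 : ℝ)..t, h x (max s 0)) (h x (max τ 0)) τ :=
    hext.deriv_integral _ _ _ ▸ (intervalIntegral.differentiable_integral_of_continuous
      hext τ).hasDerivAt
  rw [max_eq_left hτ] at h1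
  refine h1.hasDerivWithinAt.congr (fun t ht => ?_) ?_
  · refine intervalIntegral.integral_congr fun s hs => ?_
    rw [uIcc_of_le ht] at hs
    simp only [max_eq_left hs.1]
  · refine intervalIntegral.integral_congr fun s hs => ?_
    rw [uIcc_of_le hτ] at hs
    simp only [max_eq_left hs.1]

theorem primitive_add_period (H : PeriodicField h T K) (x : Euc n) {τ : ℝ} (hτ : 0 ≤ τ) :
    v₁ h x (τ + T) = v₁ h x T + v₁ h x τ := by
  have hT := H.period_pos.le
  unfold v₁
  rw [← intervalIntegral.integral_add_adjacent_intervals (b := T)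
    (H.intervalIntegrable x le_rfl hT) (H.intervalIntegrable x hT (by positivity))]
  congr 1
  have := intervalIntegral.integral_comp_add_right (a := 0) (b := τ) (h x) T
  rw [zero_add] at this
  rw [← this]
  refine intervalIntegral.integral_congr fun s hs => ?_
  rw [uIcc_of_le hτ] at hs
  exact H.per x s hs.1

theorem primitive_lipschitz (H : PeriodicField h T K) {τ : ℝ} (hτ : 0 ≤ τ) (x y : Euc n) :
    ‖v₁ h x τ - v₁ h y τ‖ ≤ τ * K * ‖x - y‖ :=
  norm_integral_sub_le hτ (fun x => H.intervalIntegrable x le_rfl hτ)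
    (fun r hr => H.lip r hr.1) x y

theorem continuousOn_primitive (H : PeriodicField h T K) :
    ContinuousOn (fun p : Euc n × ℝ => v₁ h p.1 p.2) (univ ×ˢ Ici 0) := by
  rintro ⟨x, b⟩ ⟨-, hb⟩
  have hb : 0 ≤ b := hb
  have h1 : Tendsto (fun p : Euc n × ℝ => v₁ h x p.2)
      (𝓝[univ ×ˢ Ici 0] (x, b)) (𝓝 (v₁ h x b)) := by
    have := (H.hasDerivWithinAt_primitive x hb).continuousWithinAt
    refine this.tendsto.comp (tendsto_nhdsWithin_iff.2 ⟨?_, ?_⟩)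
    · exact (continuous_snd.tendsto (x, b)).mono_left nhdsWithin_le_nhds
    · filter_upwards [self_mem_nhdsWithin] with p hp using hp.2
  have h2 : Tendsto (fun p : Euc n × ℝ => v₁ h p.1 p.2 - v₁ h x p.2)
      (𝓝[univ ×ˢ Ici 0] (x, b)) (𝓝 0) := by
    refine squeeze_zero_norm' (a := fun p : Euc n × ℝ => p.2 * K * ‖p.1 - x‖) ?_ ?_
    · filter_upwards [self_mem_nhdsWithin] with p hp
      exact H.primitive_lipschitz hp.2 _ _
    · have : Continuous fun p : Euc n × ℝ => p.2 * K * ‖p.1 - x‖ := by fun_prop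
      simpa using (this.tendsto (x, b)).mono_left nhdsWithin_le_nhds
  have := h2.add h1
  simpa [ContinuousWithinAt] using this

/-- The primitive of a zero-mean periodic field is again such a field. -/
theorem primitive (H : PeriodicField h T K) (h0 : ∀ x, v₁ h x T = 0) :
    PeriodicField (v₁ h) T (T * K) where
  period_pos := H.period_pos
  const_nonneg := mul_nonneg H.period_pos.le H.const_nonneg
  cont := H.continuousOn_primitive
  per x τ hτ := by rw [H.primitive_add_period x hτ, h0, zero_add]
  smooth τ hτ := contDiff_parametric hτ H.const_nonneg
    (fun x => H.intervalIntegrable x le_rfl hτ) (fun r hr => H.lip r hr.1)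
    (fun r hr => H.smooth r hr.1)
  lip τ hτ x y := by
    obtain ⟨h1, h2⟩ := exists_period_reduction (f := fun τ => fun x => v₁ h x τ) H.period_pos
      (fun τ hτ => by funext x; rw [H.primitive_add_period x hτ, h0, zero_add]) hτ
    rw [← congrFun h1 x, ← congrFun h1 y]
    refine (H.primitive_lipschitz h2.1 x y).trans ?_
    have := H.const_nonneg
    gcongr
    exact h2.2

theorem sub (H : PeriodicField h T K) (H' : PeriodicField h' T K') :
    PeriodicField (fun x τ => h x τ - h' x τ) T (K + K') where
  period_pos := H.period_pos
  const_nonneg := add_nonneg H.const_nonneg H'.const_nonneg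
  cont := H.cont.sub H'.cont
  per x τ hτ := by rw [H.per x τ hτ, H'.per x τ hτ]
  smooth τ hτ := (H.smooth τ hτ).sub (H'.smooth τ hτ)
  lip τ hτ x y := by
    rw [sub_sub_sub_comm, add_mul]
    exact (norm_sub_le _ _).trans (add_le_add (H.lip τ hτ x y) (H'.lip τ hτ x y))

theorem norm_zero_le (H : PeriodicField h T K) : ∃ C, 0 ≤ C ∧ ∀ τ, 0 ≤ τ → ‖h 0 τ‖ ≤ C := by
  obtain ⟨C, hC0, hC⟩ := exists_bound_on_ball H.period_pos H.cont H.per 0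
  exact ⟨C, hC0, fun τ hτ => hC 0 (by simp) τ hτ⟩

end PeriodicField

/-! ### The averaging identities -/

section ByParts

open MeasureTheory

variable {E : Type*} [NormedAddCommGroup E] [NormedSpace ℝ E]

/-- Increments of second order force the derivative to vanish. This replaces the product rule for
primitives of merely bounded integrable functions, which need not be differentiable everywhere. -/
theorem eq_of_quadratic_increments {D : ℝ → E} {τ M : ℝ} (hτ : 0 ≤ τ)
    (h : ∀ s t, 0 ≤ s → s ≤ t → t ≤ τ → ‖D t - D s‖ ≤ M * (t - s) ^ 2) : D τ = D 0 := by
  have hM : ∀ s t, s ∈ Icc 0 τ → t ∈ Icc 0 τ → ‖D t - D s‖ ≤ M * (t - s) ^ 2 := by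
    intro s t hs ht
    rcases le_total s t with hst | hst
    · exact h s t hs.1 hst ht.2
    · rw [norm_sub_rev, show (t - s) ^ 2 = (s - t) ^ 2 by ring]
      exact h t s ht.1 hst hs.2
  have hO : ∀ x ∈ Icc 0 τ, HasDerivWithinAt D 0 (Icc 0 τ) x := by
    intro x hx
    rw [hasDerivWithinAt_iff_isLittleO]
    simp only [smul_zero, sub_zero]
    refine Asymptotics.IsBigO.trans_isLittleO (g := fun t => (t - x) ^ 2) ?_ ?_
    · refine Asymptotics.IsBigO.of_bound M ?_
      filter_upwards [self_mem_nhdsWithin] with t ht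
      rw [Real.norm_of_nonneg (sq_nonneg _)]
      exact hM x t hx ht
    · refine Asymptotics.IsLittleO.mono ?_ nhdsWithin_le_nhds
      simpa using Asymptotics.isLittleO_pow_sub_sub x one_lt_two
  refine constant_of_has_deriv_right_zero (f := D) (a := 0) (b := τ)
    (fun x hx => (hO x hx).continuousWithinAt) (fun x hx => ?_) τ ⟨hτ, le_rfl⟩
  refine ((hO x ⟨hx.1, hx.2.le⟩).mono (Icc_subset_Icc_left hx.1)).mono_of_mem_nhdsWithin ?_
  exact Icc_mem_nhdsGE hx.2

theorem intervalIntegrable_apply {a : ℝ → E →L[ℝ] E} {b : ℝ → E} {s t K C : ℝ}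
    (ha : IntervalIntegrable a volume s t) (hb : IntervalIntegrable b volume s t)
    (haK : ∀ r ∈ Ι s t, ‖a r‖ ≤ K) (hbC : ∀ r ∈ Ι s t, ‖b r‖ ≤ C) :
    IntervalIntegrable (fun r => a r (b r)) volume s t := by
  refine (intervalIntegrable_const (c := K * C)).mono_fun
    ((ContinuousLinearMap.id ℝ (E →L[ℝ] E)).aestronglyMeasurable_comp₂
      (intervalIntegrable_iff.1 ha).aestronglyMeasurable
      (intervalIntegrable_iff.1 hb).aestronglyMeasurable) ?_
  filter_upwards [ae_restrict_mem measurableSet_uIoc] with r hr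
  refine ((a r).le_opNorm _).trans ((mul_le_mul (haK r hr) (hbC r hr) (norm_nonneg _)
    ((norm_nonneg _).trans (haK r hr))).trans (le_abs_self _))

/-- Integration by parts for an operator-valued and a vector-valued primitive. -/
theorem integral_by_parts [CompleteSpace E] {a : ℝ → E →L[ℝ] E} {b : ℝ → E} {τ K C : ℝ}
    (hτ : 0 ≤ τ)
    (ha : IntervalIntegrable a volume 0 τ) (hb : IntervalIntegrable b volume 0 τ)
    (haK : ∀ r ∈ Icc 0 τ, ‖a r‖ ≤ K) (hbC : ∀ r ∈ Icc 0 τ, ‖b r‖ ≤ C) :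
    IntervalIntegrable (fun s => a s (∫ r in (0 : ℝ)..s, b r)) volume 0 τ ∧
    IntervalIntegrable (fun s => (∫ r in (0 : ℝ)..s, a r) (b s)) volume 0 τ ∧
    (∫ s in (0 : ℝ)..τ, a s (∫ r in (0 : ℝ)..s, b r)) +
      (∫ s in (0 : ℝ)..τ, (∫ r in (0 : ℝ)..s, a r) (b s)) =
      (∫ r in (0 : ℝ)..τ, a r) (∫ r in (0 : ℝ)..τ, b r) := by
  set A : ℝ → E →L[ℝ] E := fun t => ∫ r in (0 : ℝ)..t, a r with hA
  set B : ℝ → E := fun t => ∫ r in (0 : ℝ)..t, b r with hB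
  have hK : 0 ≤ K := (norm_nonneg _).trans (haK 0 ⟨le_rfl, hτ⟩)
  have hC : 0 ≤ C := (norm_nonneg _).trans (hbC 0 ⟨le_rfl, hτ⟩)
  have sub0 : ∀ {s t}, 0 ≤ s → s ≤ t → t ≤ τ → [[s, t]] ⊆ [[0, τ]] := by
    intro s t h0 hst ht
    rw [uIcc_of_le hst, uIcc_of_le hτ]
    exact Icc_subset_Icc h0 ht
  have hai : ∀ s t, 0 ≤ s → s ≤ t → t ≤ τ → IntervalIntegrable a volume s t :=
    fun s t h0 hst ht => ha.mono_set (sub0 h0 hst ht)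
  have hbi : ∀ s t, 0 ≤ s → s ≤ t → t ≤ τ → IntervalIntegrable b volume s t :=
    fun s t h0 hst ht => hb.mono_set (sub0 h0 hst ht)
  have hAd : ∀ s t, 0 ≤ s → s ≤ t → t ≤ τ → A t - A s = ∫ r in s..t, a r :=
    fun s t h0 hst ht => intervalIntegral.integral_interval_sub_left
      (hai 0 t le_rfl (h0.trans hst) ht) (hai 0 s le_rfl h0 (hst.trans ht))
  have hBd : ∀ s t, 0 ≤ s → s ≤ t → t ≤ τ → B t - B s = ∫ r in s..t, b r :=
    fun s t h0 hst ht => intervalIntegral.integral_interval_sub_left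
      (hbi 0 t le_rfl (h0.trans hst) ht) (hbi 0 s le_rfl h0 (hst.trans ht))
  have hAn : ∀ s t, 0 ≤ s → s ≤ t → t ≤ τ → ‖A t - A s‖ ≤ K * (t - s) := by
    intro s t h0 hst ht
    rw [hAd s t h0 hst ht, ← abs_of_nonneg (sub_nonneg.2 hst)]
    refine intervalIntegral.norm_integral_le_of_norm_le_const fun r hr => haK r ?_
    rw [uIoc_of_le hst] at hr
    exact ⟨h0.trans hr.1.le, hr.2.trans ht⟩
  have hBn : ∀ s t, 0 ≤ s → s ≤ t → t ≤ τ → ‖B t - B s‖ ≤ C * (t - s) := by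
    intro s t h0 hst ht
    rw [hBd s t h0 hst ht, ← abs_of_nonneg (sub_nonneg.2 hst)]
    refine intervalIntegral.norm_integral_le_of_norm_le_const fun r hr => hbC r ?_
    rw [uIoc_of_le hst] at hr
    exact ⟨h0.trans hr.1.le, hr.2.trans ht⟩
  have hA0 : A 0 = 0 := by simp [hA]
  have hB0 : B 0 = 0 := by simp [hB]
  have hAC : ∀ r ∈ Icc 0 τ, ‖A r‖ ≤ K * τ := fun r hr => by
    have := hAn 0 r le_rfl hr.1 hr.2
    rw [hA0, sub_zero, sub_zero] at this
    exact this.trans (by have := hr.2; gcongr)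
  have hBC : ∀ r ∈ Icc 0 τ, ‖B r‖ ≤ C * τ := fun r hr => by
    have := hBn 0 r le_rfl hr.1 hr.2
    rw [hB0, sub_zero, sub_zero] at this
    exact this.trans (by have := hr.2; gcongr)
  have hIoc : ∀ r ∈ Ι 0 τ, r ∈ Icc 0 τ := fun r hr => by
    rw [uIoc_of_le hτ] at hr; exact ⟨hr.1.le, hr.2⟩
  have hAI : IntervalIntegrable A volume 0 τ :=
    (intervalIntegral.continuousOn_primitive_interval' ha left_mem_uIcc).intervalIntegrable
  have hBI : IntervalIntegrable B volume 0 τ :=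
    (intervalIntegral.continuousOn_primitive_interval' hb left_mem_uIcc).intervalIntegrable
  have h1 : IntervalIntegrable (fun s => a s (B s)) volume 0 τ :=
    intervalIntegrable_apply ha hBI (fun r hr => haK r (hIoc r hr))
      (fun r hr => hBC r (hIoc r hr))
  have h2 : IntervalIntegrable (fun s => A s (b s)) volume 0 τ :=
    intervalIntegrable_apply hAI hb (fun r hr => hAC r (hIoc r hr))
      (fun r hr => hbC r (hIoc r hr))
  refine ⟨h1, h2, ?_⟩
  have h12 := h1.add h2
  rw [← intervalIntegral.integral_add h1 h2]
  -- The difference of the two sides, as a function of the endpoint, is shown to have quadratic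
  -- increments.
  have key := eq_of_quadratic_increments (M := 2 * K * C) hτ
    (D := fun t => A t (B t) - ∫ s in (0 : ℝ)..t, (a s (B s) + A s (b s))) ?_
  · simp only [hA0, zero_apply, intervalIntegral.integral_same, sub_zero] at key
    exact (sub_eq_zero.1 key).symm
  · intro s t h0 hst ht
    have hsub := sub0 h0 hst ht
    have ia := hai s t h0 hst ht
    have ib := hbi s t h0 hst ht
    have e1 : (∫ r in (0 : ℝ)..t, (a r (B r) + A r (b r))) -
        ∫ r in (0 : ℝ)..s, (a r (B r) + A r (b r)) = ∫ r in s..t, (a r (B r) + A r (b r)) :=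
      intervalIntegral.integral_interval_sub_left
        (h12.mono_set (sub0 le_rfl (h0.trans hst) ht)) (h12.mono_set (sub0 le_rfl h0 (hst.trans ht)))
    have iaB : IntervalIntegrable (fun r => a r (B t)) volume s t :=
      ⟨ia.1.apply_continuousLinearMap _, ia.2.apply_continuousLinearMap _⟩
    have iAb : IntervalIntegrable (fun r => A s (b r)) volume s t :=
      ⟨(A s).integrable_comp ib.1, (A s).integrable_comp ib.2⟩
    have e2 : A t (B t) - A s (B s) = ∫ r in s..t, (a r (B t) + A s (b r)) := by
      rw [intervalIntegral.integral_add iaB iAb, ContinuousLinearMap.intervalIntegral_comp_comm _ ib,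
        ← ContinuousLinearMap.intervalIntegral_apply ia, ← hAd s t h0 hst ht,
        ← hBd s t h0 hst ht]
      simp
    -- Each term now pairs a bounded factor with an increment of `A` or `B` of size O(t - s), under
    -- an integral of length t - s.
    have e3 : A t (B t) - (∫ r in (0 : ℝ)..t, (a r (B r) + A r (b r))) -
        (A s (B s) - ∫ r in (0 : ℝ)..s, (a r (B r) + A r (b r)))
        = ∫ r in s..t, (a r (B t - B r) - (A r - A s) (b r)) := by
      rw [sub_sub_sub_comm, e1, e2, ← intervalIntegral.integral_sub (iaB.add iAb)
        (h12.mono_set hsub)]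
      refine intervalIntegral.integral_congr fun r _ => ?_
      simp only [map_sub, sub_apply]
      abel
    rw [e3]
    refine (intervalIntegral.norm_integral_le_of_norm_le_const
      (C := K * (C * (t - s)) + (K * (t - s)) * C) fun r hr => ?_).trans (le_of_eq ?_)
    · rw [uIoc_of_le hst] at hr
      have hr0 : 0 ≤ r := h0.trans hr.1.le
      have hr1 : r ≤ τ := hr.2.trans ht
      refine (norm_sub_le _ _).trans (add_le_add ?_ ?_)
      · refine (ContinuousLinearMap.le_opNorm _ _).trans
          (mul_le_mul (haK r ⟨hr0, hr1⟩) ?_ (norm_nonneg _) hK)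
        refine (hBn r t hr0 hr.2 ht).trans ?_
        have := hr.1.le
        gcongr
      · refine (ContinuousLinearMap.le_opNorm _ _).trans
          (mul_le_mul ?_ (hbC r ⟨hr0, hr1⟩) (norm_nonneg _) (by
            have := sub_nonneg.2 hst
            positivity))
        refine (hAn s r h0 hr.1.le hr1).trans ?_
        have := hr.2
        gcongr
    · rw [abs_of_nonneg (sub_nonneg.2 hst)]; ring

end ByParts

/-! ### The second-order average and corrector as integrals of one slow field. -/

section Averaging

open MeasureTheory

variable {n : ℕ} {h₁ h₂ : Euc n → ℝ → Euc n} {T K₁ K₂ K₃ : ℝ}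

/-- The quadratic drift `(Dₓ v₁) h₁` generated by the fast field. -/
noncomputable def drift (h : Euc n → ℝ → Euc n) (x : Euc n) (s : ℝ) : Euc n :=
  Dx (v₁ h) x s (h x s)

/-- The slow field together with the drift of the fast field. -/
noncomputable def slow (h₁ h₂ : Euc n → ℝ → Euc n) (x : Euc n) (s : ℝ) : Euc n :=
  h₂ x s - drift h₁ x s

/-- Deviation of the slow field from its average. -/
noncomputable def slowDev (T : ℝ) (h₁ h₂ : Euc n → ℝ → Euc n) (x : Euc n) (s : ℝ) : Euc n :=
  slow h₁ h₂ x s - average T h₁ h₂ x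

namespace PeriodicField

theorem drift_eq (H : PeriodicField h₁ T K₁) (x : Euc n) {s : ℝ} (hs : 0 ≤ s) :
    drift h₁ x s = ∫ r in (0 : ℝ)..s, Dx h₁ x r (h₁ x s) := by
  rw [drift, H.Dx_primitive x hs,
    ContinuousLinearMap.intervalIntegral_apply (H.intervalIntegrable_Dx x hs)]

/-- Bounds on the two factors of (Dₓv₁)h₁ alone would not give a global Lipschitz estimate, since h₁
may grow linearly. Written as ∫₀ˢ Dₓh₁(x,r)h₁(x,s)dr, the drift is an integral of exactly the
products controlled by `hlip`. Mean zero of h₁ makes Dₓv₁ periodic. -/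
theorem drift (H : PeriodicField h₁ T K₁) (h0 : ∀ x, v₁ h₁ x T = 0)
    (hsm : ∀ τ, 0 ≤ τ → ContDiff ℝ 2 (fun x => h₁ x τ)) (hK₃ : 0 ≤ K₃)
    (hlip : ∀ r s, 0 ≤ r → 0 ≤ s → ∀ x y,
      ‖Dx h₁ x r (h₁ x s) - Dx h₁ y r (h₁ y s)‖ ≤ K₃ * ‖x - y‖) :
    PeriodicField (drift h₁) T (T * K₃) := by
  have hint : ∀ s, 0 ≤ s → ∀ x,
      IntervalIntegrable (fun r => Dx h₁ x r (h₁ x s)) volume 0 s := fun s hs x =>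
    ⟨(H.intervalIntegrable_Dx x hs).1.apply_continuousLinearMap _,
      (H.intervalIntegrable_Dx x hs).2.apply_continuousLinearMap _⟩
  have hper : ∀ x τ, 0 ≤ τ → SecondOrderAveraging.drift h₁ x (τ + T)
      = SecondOrderAveraging.drift h₁ x τ := by
    intro x τ hτ
    have e : (fun y => v₁ h₁ y (τ + T)) = fun y => v₁ h₁ y τ := by
      funext y
      rw [H.primitive_add_period y hτ, h0, zero_add]
    rw [SecondOrderAveraging.drift, SecondOrderAveraging.drift, Dx, Dx, e, H.per x τ hτ]
  have hl : ∀ s, 0 ≤ s → ∀ x y, ‖SecondOrderAveraging.drift h₁ x s -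
      SecondOrderAveraging.drift h₁ y s‖ ≤ s * K₃ * ‖x - y‖ := by
    intro s hs x y
    rw [H.drift_eq x hs, H.drift_eq y hs]
    exact norm_integral_sub_le hs (F := fun x r => Dx h₁ x r (h₁ x s)) (hint s hs)
      (fun r hr => hlip r s hr.1 hs) x y
  refine ⟨H.period_pos, mul_nonneg H.period_pos.le hK₃,
    H.continuousOn_Dx_primitive.clm_apply H.cont, ?_, hper, ?_⟩
  · intro τ hτ x y
    obtain ⟨h1, h2⟩ := exists_period_reduction
      (f := fun τ => fun x => SecondOrderAveraging.drift h₁ x τ) H.period_pos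
      (fun τ hτ => by funext x; exact hper x τ hτ) hτ
    rw [← congrFun h1 x, ← congrFun h1 y]
    refine (hl _ h2.1 x y).trans ?_
    gcongr
    exact h2.2
  · intro s hs
    have e : (fun x => SecondOrderAveraging.drift h₁ x s)
        = fun x => ∫ r in (0 : ℝ)..s, Dx h₁ x r (h₁ x s) := by
      funext x; exact H.drift_eq x hs
    rw [e]
    refine contDiff_parametric hs hK₃ (F := fun x r => Dx h₁ x r (h₁ x s)) (hint s hs)
      (fun r hr => hlip r s hr.1 hs) fun r hr => ?_
    exact ((hsm r hr.1).fderiv_right (m := 1) (by norm_num)).clm_apply (H.smooth s hs)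

/-- Integration by parts for the primitive of the fast field. -/
theorem integral_Dx_add_integral_drift (H : PeriodicField h₁ T K₁) (x : Euc n) {τ : ℝ}
    (hτ : 0 ≤ τ) :
    IntervalIntegrable (fun s => Dx h₁ x s (v₁ h₁ x s)) volume 0 τ ∧
    IntervalIntegrable (SecondOrderAveraging.drift h₁ x) volume 0 τ ∧
    (∫ s in (0 : ℝ)..τ, Dx h₁ x s (v₁ h₁ x s)) + (∫ s in (0 : ℝ)..τ,
      SecondOrderAveraging.drift h₁ x s) = Dx (v₁ h₁) x τ (v₁ h₁ x τ) := by
  obtain ⟨C, hC⟩ := (isCompact_Icc (a := (0 : ℝ)) (b := τ)).exists_bound_of_continuousOn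
    ((H.continuousOn_time x).mono fun r hr => hr.1)
  obtain ⟨i1, i2, e⟩ := integral_by_parts hτ (H.intervalIntegrable_Dx x hτ)
    (H.intervalIntegrable x le_rfl hτ) (fun r hr => H.Dx_norm_le hr.1 x) hC
  have hd : EqOn (fun s => (∫ r in (0 : ℝ)..s, Dx h₁ x r) (h₁ x s))
      (SecondOrderAveraging.drift h₁ x) [[0, τ]] := by
    intro s hs
    rw [uIcc_of_le hτ] at hs
    simp only [SecondOrderAveraging.drift, H.Dx_primitive x hs.1]
  refine ⟨i1, i2.congr (fun s hs => hd (uIoc_subset_uIcc hs)), ?_⟩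
  rw [← intervalIntegral.integral_congr hd, H.Dx_primitive x hτ]
  exact e

end PeriodicField

/-- Over a full period the boundary term of the integration by parts vanishes, so ∫(Dₓh₁)v₁ =
-∫(Dₓv₁)h₁. The bracket therefore integrates to -2 times the drift, and the factor 1/2 in the
average absorbs the 2. -/
theorem average_eq (H₁ : PeriodicField h₁ T K₁) (h0 : ∀ x, v₁ h₁ x T = 0)
    (H₂ : PeriodicField h₂ T K₂) (x : Euc n) :
    average T h₁ h₂ x = T⁻¹ • v₁ (slow h₁ h₂) x T := by
  have hT := H₁.period_pos
  obtain ⟨i1, i2, e⟩ := H₁.integral_Dx_add_integral_drift x hT.le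
  have i3 := H₂.intervalIntegrable x le_rfl hT.le
  rw [h0, map_zero] at e
  have e1 : (∫ τ in (0 : ℝ)..T, ((2 : ℝ) • h₂ x τ + bracket (v₁ h₁) h₁ x τ))
      = (2 : ℝ) • (∫ τ in (0 : ℝ)..T, h₂ x τ) + ((∫ τ in (0 : ℝ)..T, Dx h₁ x τ (v₁ h₁ x τ)) -
        ∫ τ in (0 : ℝ)..T, drift h₁ x τ) := by
    rw [← intervalIntegral.integral_smul, ← intervalIntegral.integral_sub i1 i2]
    exact intervalIntegral.integral_add (i3.smul (2 : ℝ)) (i1.sub i2)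
  have e2 : v₁ (slow h₁ h₂) x T = (∫ τ in (0 : ℝ)..T, h₂ x τ) -
      ∫ τ in (0 : ℝ)..T, drift h₁ x τ := by
    rw [← intervalIntegral.integral_sub i3 i2]
    rfl
  rw [average, e1, e2, eq_neg_of_add_eq_zero_left e]
  have : T ≠ 0 := hT.ne'
  rw [show (1 / (2 * T)) = T⁻¹ * (1 / 2) by field_simp]
  module

/-- Integration by parts trades ∫(Dₓh₁)v₁ - (Dₓv₁)v₁ for -∫(Dₓv₁)h₁. Regularity and the time
derivative of v₂ are then those of a primitive. -/
theorem v₂_eq (H₁ : PeriodicField h₁ T K₁) (H₂ : PeriodicField h₂ T K₂) (x : Euc n) {τ : ℝ}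
    (hτ : 0 ≤ τ) : v₂ T h₁ h₂ x τ = v₁ (slowDev T h₁ h₂) x τ := by
  obtain ⟨i1, i2, e⟩ := H₁.integral_Dx_add_integral_drift x hτ
  have i3 := H₂.intervalIntegrable x le_rfl hτ
  have i4 : IntervalIntegrable (fun _ : ℝ => average T h₁ h₂ x) volume 0 τ :=
    intervalIntegrable_const
  have e1 : w T h₁ h₂ x τ = (∫ s in (0 : ℝ)..τ, h₂ x s) +
      (∫ s in (0 : ℝ)..τ, Dx h₁ x s (v₁ h₁ x s)) - ∫ s in (0 : ℝ)..τ, average T h₁ h₂ x := by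
    rw [← intervalIntegral.integral_add i3 i1, ← intervalIntegral.integral_sub (i3.add i1) i4]
    rfl
  have e2 : v₁ (slowDev T h₁ h₂) x τ = (∫ s in (0 : ℝ)..τ, h₂ x s) -
      (∫ s in (0 : ℝ)..τ, drift h₁ x s) - ∫ s in (0 : ℝ)..τ, average T h₁ h₂ x := by
    rw [← intervalIntegral.integral_sub i3 i2, ← intervalIntegral.integral_sub (i3.sub i2) i4]
    rfl
  rw [v₂, e1, e2, ← e]
  abel

end Averaging

/-! ### The near-identity transformation -/

section ChainRule

variable {n : ℕ}

/-- Chain rule along a curve in the extended phase space, for a field with jointly continuous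
space derivative and a one-sided time derivative. -/
theorem hasDerivWithinAt_along {V : Euc n → ℝ → Euc n} {x : ℝ → Euc n} {τ : ℝ → ℝ}
    {s : Set ℝ} {t : ℝ} {x' v : Euc n} {τ' : ℝ}
    (hV : ∀ τ, 0 ≤ τ → Differentiable ℝ (fun y => V y τ))
    (hc : ContinuousOn (fun p : Euc n × ℝ => Dx V p.1 p.2) (univ ×ˢ Ici 0))
    (hv : HasDerivWithinAt (V (x t)) v (Ici 0) (τ t))
    (hx : HasDerivWithinAt x x' s t) (hτ : HasDerivWithinAt τ τ' s t)
    (hτs : ∀ r ∈ s, 0 ≤ τ r) (ht : t ∈ s) :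
    HasDerivWithinAt (fun r => V (x r) (τ r)) (Dx V (x t) (τ t) x' + τ' • v) s t := by
  have h2 : HasDerivWithinAt (fun r => V (x t) (τ r)) (τ' • v) s t :=
    hv.scomp t hτ hτs
  set A := Dx V (x t) (τ t) with hA
  -- The time derivative is needed only at the fixed point `x t`. The space increment is taken at
  -- the moving time `τ r`, where joint continuity of the Jacobian keeps it close to `A` in the mean
  -- value inequality.
  have h1 : HasDerivWithinAt (fun r => V (x r) (τ r) - V (x t) (τ r)) (A x') s t := by
    have hxO : (fun r => x r - x t) =O[𝓝[s] t] fun r => r - t := hx.hasFDerivWithinAt.isBigO_sub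
    have ho : (fun r => V (x r) (τ r) - V (x t) (τ r) - A (x r - x t)) =o[𝓝[s] t]
        fun r => x r - x t := by
      rw [Asymptotics.isLittleO_iff]
      intro η hη
      have hcw := hc (x t, τ t) ⟨mem_univ _, hτs t ht⟩
      have hev := Metric.continuousWithinAt_iff.1 hcw η hη
      obtain ⟨δ, hδ, hball⟩ := hev
      have e1 : ∀ᶠ r in 𝓝[s] t, x r ∈ Metric.ball (x t) δ :=
        hx.continuousWithinAt.eventually (Metric.ball_mem_nhds _ hδ)
      have e2 : ∀ᶠ r in 𝓝[s] t, τ r ∈ Metric.ball (τ t) δ :=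
        hτ.continuousWithinAt.eventually (Metric.ball_mem_nhds _ hδ)
      filter_upwards [e1, e2, self_mem_nhdsWithin] with r hr1 hr2 hrs
      refine (convex_ball (x t) δ).norm_image_sub_le_of_norm_hasFDerivWithin_le'
        (f := fun y => V y (τ r)) (f' := fun y => Dx V y (τ r)) (φ := A) (fun y _ =>
          ((hV _ (hτs r hrs)) y).hasFDerivAt.hasFDerivWithinAt) (fun y hy => ?_)
        (Metric.mem_ball_self hδ) hr1
      rw [← dist_eq_norm]
      refine (hball (x := (y, τ r)) ⟨mem_univ _, hτs r hrs⟩ ?_).le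
      rw [Prod.dist_eq]
      exact max_lt hy hr2
    have ho2 : (fun r => A (x r - x t - (r - t) • x')) =o[𝓝[s] t] fun r => r - t :=
      (A.isBigO_comp _ _).trans_isLittleO (hasDerivWithinAt_iff_isLittleO.1 hx)
    rw [hasDerivWithinAt_iff_isLittleO]
    refine ((ho.trans_isBigO hxO).add ho2).congr_left fun r => ?_
    simp only [map_sub, map_smul]
    abel
  refine (h1.add h2).congr (fun r _ => ?_) ?_ <;> simp

end ChainRule

/-- The map `(x, τ) ↦ (x - ε V(x, τ) - ε² W(x, τ), τ)`. -/
noncomputable def nearId {n : ℕ} (V W : Euc n → ℝ → Euc n) (ε : ℝ) (p : Euc n × ℝ) : Euc n × ℝ :=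
  (p.1 - ε • V p.1 p.2 - ε ^ 2 • W p.1 p.2, p.2)

/-- First and second order correctors `V`, `W` of the fast field `h₁` and the slow field `h₂` with
average `p`, with uniform bounds. -/
structure Correctors {n : ℕ} (h₁ h₂ V W : Euc n → ℝ → Euc n) (p : Euc n → Euc n) (K : ℝ) :
    Prop where
  pos : 0 < K
  cont₁ : ContinuousOn (fun q : Euc n × ℝ => h₁ q.1 q.2) (univ ×ˢ Ici 0)
  cont₂ : ContinuousOn (fun q : Euc n × ℝ => h₂ q.1 q.2) (univ ×ˢ Ici 0)
  growth₁ : ∀ x τ, 0 ≤ τ → ‖h₁ x τ‖ ≤ K * (1 + ‖x‖)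
  growth₂ : ∀ x τ, 0 ≤ τ → ‖h₂ x τ‖ ≤ K * (1 + ‖x‖)
  lip_avg : ∀ x y, ‖p x - p y‖ ≤ K * ‖x - y‖
  contV : ContinuousOn (fun q : Euc n × ℝ => V q.1 q.2) (univ ×ˢ Ici 0)
  contW : ContinuousOn (fun q : Euc n × ℝ => W q.1 q.2) (univ ×ˢ Ici 0)
  zeroV : ∀ τ, 0 ≤ τ → ‖V 0 τ‖ ≤ K
  zeroW : ∀ τ, 0 ≤ τ → ‖W 0 τ‖ ≤ K
  lipV : ∀ τ, 0 ≤ τ → ∀ x y, ‖V x τ - V y τ‖ ≤ K * ‖x - y‖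
  lipW : ∀ τ, 0 ≤ τ → ∀ x y, ‖W x τ - W y τ‖ ≤ K * ‖x - y‖
  diffV : ∀ τ, 0 ≤ τ → Differentiable ℝ (fun x => V x τ)
  diffW : ∀ τ, 0 ≤ τ → Differentiable ℝ (fun x => W x τ)
  contDV : ContinuousOn (fun q : Euc n × ℝ => Dx V q.1 q.2) (univ ×ˢ Ici 0)
  contDW : ContinuousOn (fun q : Euc n × ℝ => Dx W q.1 q.2) (univ ×ˢ Ici 0)
  derivV : ∀ x τ, 0 ≤ τ → HasDerivWithinAt (V x) (h₁ x τ) (Ici 0) τ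
  derivW : ∀ x τ, 0 ≤ τ →
    HasDerivWithinAt (W x) (h₂ x τ - Dx V x τ (h₁ x τ) - p x) (Ici 0) τ

namespace Correctors

variable {n : ℕ} {h₁ h₂ V W : Euc n → ℝ → Euc n} {p : Euc n → Euc n} {K ε : ℝ}

theorem shift_lipschitz (D : Correctors h₁ h₂ V W p K) (hε : 0 < ε) (hε1 : ε ≤ 1) {τ : ℝ}
    (hτ : 0 ≤ τ) (x y : Euc n) :
    ‖(ε • V x τ + ε ^ 2 • W x τ) - (ε • V y τ + ε ^ 2 • W y τ)‖ ≤ 2 * K * ε * ‖x - y‖ := by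
  have e : (ε • V x τ + ε ^ 2 • W x τ) - (ε • V y τ + ε ^ 2 • W y τ)
      = ε • (V x τ - V y τ) + ε ^ 2 • (W x τ - W y τ) := by module
  have hK := D.pos.le
  rw [e]
  refine (norm_add_le _ _).trans ?_
  rw [norm_smul, norm_smul, Real.norm_of_nonneg hε.le, Real.norm_of_nonneg (by positivity)]
  have h1 := D.lipV τ hτ x y
  have h2 := D.lipW τ hτ x y
  have h3 : ε ^ 2 ≤ ε := by nlinarith
  calc _ ≤ ε * (K * ‖x - y‖) + ε * (K * ‖x - y‖) := by gcongr
    _ = _ := by ring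

theorem shift_zero (D : Correctors h₁ h₂ V W p K) (hε : 0 < ε) (hε1 : ε ≤ 1) {τ : ℝ}
    (hτ : 0 ≤ τ) : ‖ε • V 0 τ + ε ^ 2 • W 0 τ‖ ≤ 2 * K * ε := by
  refine (norm_add_le _ _).trans ?_
  rw [norm_smul, norm_smul, Real.norm_of_nonneg hε.le, Real.norm_of_nonneg (by positivity)]
  have h1 := D.zeroV τ hτ
  have h2 := D.zeroW τ hτ
  have h3 : ε ^ 2 ≤ ε := by nlinarith
  have hK := D.pos.le
  calc _ ≤ ε * K + ε * K := by gcongr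
    _ = _ := by ring

theorem shift_growth (D : Correctors h₁ h₂ V W p K) (hε : 0 < ε) (hε1 : ε ≤ 1) {τ : ℝ}
    (hτ : 0 ≤ τ) (x : Euc n) : ‖ε • V x τ + ε ^ 2 • W x τ‖ ≤ 2 * K * ε * (1 + ‖x‖) := by
  have h1 := D.shift_lipschitz hε hε1 hτ x 0
  have h2 := D.shift_zero hε hε1 hτ
  rw [sub_zero] at h1
  have := norm_sub_norm_le (ε • V x τ + ε ^ 2 • W x τ) (ε • V 0 τ + ε ^ 2 • W 0 τ)
  linarith

theorem nearId_fst (V W : Euc n → ℝ → Euc n) (ε : ℝ) (x : Euc n) (τ : ℝ) :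
    (nearId V W ε (x, τ)).1 = x - (ε • V x τ + ε ^ 2 • W x τ) := by
  simp only [nearId]; abel

theorem nearId_lipschitz (D : Correctors h₁ h₂ V W p K) (hε : 0 < ε) (hε1 : ε ≤ 1) {τ : ℝ}
    (hτ : 0 ≤ τ) (x y : Euc n) :
    ‖(nearId V W ε (x, τ)).1 - (nearId V W ε (y, τ)).1‖ ≤ (1 + 2 * K * ε) * ‖x - y‖ := by
  rw [nearId_fst, nearId_fst, sub_sub_sub_comm, add_mul, one_mul]
  exact (norm_sub_le _ _).trans (add_le_add le_rfl (D.shift_lipschitz hε hε1 hτ x y))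

theorem nearId_expansive (D : Correctors h₁ h₂ V W p K) (hε : 0 < ε) (hε1 : ε ≤ 1) {τ : ℝ}
    (hτ : 0 ≤ τ) (x y : Euc n) :
    (1 - 2 * K * ε) * ‖x - y‖ ≤ ‖(nearId V W ε (x, τ)).1 - (nearId V W ε (y, τ)).1‖ := by
  rw [nearId_fst, nearId_fst, sub_sub_sub_comm, sub_mul, one_mul]
  have := norm_sub_norm_le (x - y)
    ((ε • V x τ + ε ^ 2 • W x τ) - (ε • V y τ + ε ^ 2 • W y τ))
  have := D.shift_lipschitz hε hε1 hτ x y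
  linarith

theorem norm_sub_le_nearId (D : Correctors h₁ h₂ V W p K) (hε : 0 < ε) (hε1 : ε ≤ 1)
    (hεK : 4 * K * ε ≤ 1) {τ : ℝ} (hτ : 0 ≤ τ) (x y : Euc n) :
    ‖x - y‖ ≤ (1 + 4 * K * ε) *
      ‖(nearId V W ε (x, τ)).1 - (nearId V W ε (y, τ)).1‖ := by
  have h := D.nearId_expansive hε hε1 hτ x y
  have hK := D.pos
  have hc : 0 < K * ε := by positivity
  -- With u = Kε ≤ 1/4 the product is 1 + 2u - 8u² ≥ 1.
  have h1 : 1 ≤ (1 + 4 * K * ε) * (1 - 2 * K * ε) := by nlinarith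
  calc ‖x - y‖ ≤ (1 + 4 * K * ε) * (1 - 2 * K * ε) * ‖x - y‖ :=
        le_mul_of_one_le_left (norm_nonneg _) h1
    _ = (1 + 4 * K * ε) * ((1 - 2 * K * ε) * ‖x - y‖) := by ring
    _ ≤ _ := by gcongr

theorem bijOn (D : Correctors h₁ h₂ V W p K) (hε : 0 < ε) (hε1 : ε ≤ 1)
    (hεK : 4 * K * ε ≤ 1) : BijOn (nearId V W ε) (phase n) (phase n) := by
  refine ⟨fun q hq => ⟨mem_univ _, hq.2⟩, ?_, ?_⟩
  · rintro ⟨x, τ⟩ ⟨-, hτ⟩ ⟨y, σ⟩ - he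
    obtain rfl : τ = σ := congrArg Prod.snd he
    have := D.norm_sub_le_nearId hε hε1 hεK hτ x y
    rw [he, sub_self, norm_zero, mul_zero] at this
    rw [sub_eq_zero.1 (norm_le_zero_iff.1 this)]
  · rintro ⟨z, τ⟩ ⟨-, hτ⟩
    have hτ : 0 ≤ τ := hτ
    have hK := D.pos
    -- A preimage of `z` is a fixed point of this map, whose Lipschitz constant is 2Kε ≤ 1/2.
    have hc : ContractingWith (1 / 2) fun x => z + (ε • V x τ + ε ^ 2 • W x τ) := by
      refine ⟨by norm_num, LipschitzWith.of_dist_le_mul fun x y => ?_⟩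
      rw [dist_eq_norm, dist_eq_norm, add_sub_add_left_eq_sub]
      refine (D.shift_lipschitz hε hε1 hτ x y).trans ?_
      gcongr
      norm_num
      linarith
    refine ⟨(hc.fixedPoint, τ), ⟨mem_univ _, hτ⟩, Prod.ext ?_ rfl⟩
    rw [nearId_fst]
    have := hc.fixedPoint_isFixedPt
    simp only [Function.IsFixedPt] at this
    nth_rw 1 [← this]
    simp

/-- The space component of the inverse transformation. -/
theorem phaseInv_spec (D : Correctors h₁ h₂ V W p K) (hε : 0 < ε) (hε1 : ε ≤ 1)
    (hεK : 4 * K * ε ≤ 1) (x : Euc n) {τ : ℝ} (hτ : 0 ≤ τ) :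
    phaseInv (nearId V W ε) (x, τ) = ((phaseInv (nearId V W ε) (x, τ)).1, τ) ∧
      (nearId V W ε ((phaseInv (nearId V W ε) (x, τ)).1, τ)).1 = x := by
  have h : nearId V W ε (phaseInv (nearId V W ε) (x, τ)) = (x, τ) :=
    (D.bijOn hε hε1 hεK).invOn_invFunOn.2 ⟨mem_univ _, hτ⟩
  have h2 : (phaseInv (nearId V W ε) (x, τ)).2 = τ := congrArg Prod.snd h
  have h1 : phaseInv (nearId V W ε) (x, τ) = ((phaseInv (nearId V W ε) (x, τ)).1, τ) :=
    Prod.ext rfl h2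
  refine ⟨h1, ?_⟩
  rw [← h1, h]

theorem phaseInv_apply (D : Correctors h₁ h₂ V W p K) (hε : 0 < ε) (hε1 : ε ≤ 1)
    (hεK : 4 * K * ε ≤ 1) (x : Euc n) {τ : ℝ} (hτ : 0 ≤ τ) :
    phaseInv (nearId V W ε) ((nearId V W ε (x, τ)).1, τ) = (x, τ) :=
  (D.bijOn hε hε1 hεK).invOn_invFunOn.1
    (show (x, τ) ∈ phase n from ⟨mem_univ _, hτ⟩)

theorem phaseInv_lipschitz (D : Correctors h₁ h₂ V W p K) (hε : 0 < ε) (hε1 : ε ≤ 1)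
    (hεK : 4 * K * ε ≤ 1) {τ : ℝ} (hτ : 0 ≤ τ) (x y : Euc n) :
    ‖(phaseInv (nearId V W ε) (x, τ)).1 - (phaseInv (nearId V W ε) (y, τ)).1‖
      ≤ (1 + 4 * K * ε) * ‖x - y‖ := by
  have := D.norm_sub_le_nearId hε hε1 hεK hτ (phaseInv (nearId V W ε) (x, τ)).1
    (phaseInv (nearId V W ε) (y, τ)).1
  rwa [(D.phaseInv_spec hε hε1 hεK x hτ).2, (D.phaseInv_spec hε hε1 hεK y hτ).2] at this

theorem nearId_zero (D : Correctors h₁ h₂ V W p K) (hε : 0 < ε) (hε1 : ε ≤ 1) {τ : ℝ}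
    (hτ : 0 ≤ τ) : ‖(nearId V W ε (0, τ)).1‖ ≤ 2 * K * ε := by
  rw [nearId_fst, zero_sub, norm_neg]
  exact D.shift_zero hε hε1 hτ

theorem phaseInv_sub_le (D : Correctors h₁ h₂ V W p K) (hε : 0 < ε) (hε1 : ε ≤ 1)
    (hεK : 4 * K * ε ≤ 1) (x : Euc n) {τ : ℝ} (hτ : 0 ≤ τ) :
    ‖(phaseInv (nearId V W ε) (x, τ)).1 - x‖ ≤ 4 * K * ε * (1 + ‖x‖) := by
  set y := (phaseInv (nearId V W ε) (x, τ)).1 with hy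
  have h := (D.phaseInv_spec hε hε1 hεK x hτ).2
  rw [← hy, nearId_fst] at h
  have e : y - x = ε • V y τ + ε ^ 2 • W y τ := by
    rw [← sub_eq_zero, ← sub_eq_zero.2 h]; abel
  have h1 := D.shift_growth hε hε1 hτ y
  rw [← e] at h1
  -- This gives |y - x| ≤ 2Kε(1 + |x| + |y - x|); since 2Kε ≤ 1/2, the last term is absorbed at the
  -- cost of doubling the constant.
  have h2 : ‖y‖ ≤ ‖x‖ + ‖y - x‖ := by
    have := norm_add_le x (y - x); simpa using this
  have hc : 0 < K * ε := mul_pos D.pos hε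
  have hyx := norm_nonneg (y - x)
  nlinarith

theorem phaseInv_zero (D : Correctors h₁ h₂ V W p K) (hε : 0 < ε) (hε1 : ε ≤ 1)
    (hεK : 4 * K * ε ≤ 1) {τ : ℝ} (hτ : 0 ≤ τ) :
    ‖(phaseInv (nearId V W ε) (0, τ)).1‖ ≤ 4 * K * ε := by
  simpa using D.phaseInv_sub_le hε hε1 hεK 0 hτ

/-- The forward map would allow the constant 2K; the inverse dictates 4K. -/
theorem nearIdentityBounds (D : Correctors h₁ h₂ V W p K) {εs : ℝ} (h1 : εs ≤ 1)
    (hK : 4 * K * εs ≤ 1) : NearIdentityBounds (nearId V W) (4 * K) εs := by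
  intro ε hε
  have hp := D.pos
  have hεK : 4 * K * ε ≤ 1 := le_trans (by have := hε.2.le; gcongr) hK
  have hε1 : ε ≤ 1 := hε.2.le.trans h1
  refine ⟨hεK, D.bijOn hε.1 hε1 hεK, fun τ hτ => ⟨?_, D.phaseInv_zero hε.1 hε1 hεK hτ,
    fun x y => ⟨?_, D.phaseInv_lipschitz hε.1 hε1 hεK hτ x y⟩⟩⟩
  · refine (D.nearId_zero hε.1 hε1 hτ).trans ?_
    have := mul_pos hp hε.1
    linarith
  · refine (D.nearId_lipschitz hε.1 hε1 hτ x y).trans ?_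
    have := mul_pos hp hε.1
    exact mul_le_mul_of_nonneg_right (by linarith) (norm_nonneg _)

theorem Dx_nearId (D : Correctors h₁ h₂ V W p K) (x : Euc n) {τ : ℝ} (hτ : 0 ≤ τ) :
    fderiv ℝ (fun y => (nearId V W ε (y, τ)).1) x
      = ContinuousLinearMap.id ℝ (Euc n) - ε • Dx V x τ - ε ^ 2 • Dx W x τ := by
  have h1 := ((D.diffV τ hτ) x).hasFDerivAt
  have h2 := ((D.diffW τ hτ) x).hasFDerivAt
  exact (((hasFDerivAt_id x).sub (h1.const_smul ε)).sub (h2.const_smul (ε ^ 2))).fderiv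

theorem derivWithin_nearId (D : Correctors h₁ h₂ V W p K) (x : Euc n) {τ : ℝ} (hτ : 0 ≤ τ) :
    derivWithin (fun σ => (nearId V W ε (x, σ)).1) (Ici 0) τ
      = -(ε • h₁ x τ) - ε ^ 2 • (h₂ x τ - Dx V x τ (h₁ x τ) - p x) := by
  have h := (((hasDerivWithinAt_const τ (Ici 0) x).sub ((D.derivV x τ hτ).const_smul ε)).sub
    ((D.derivW x τ hτ).const_smul (ε ^ 2))).derivWithin (uniqueDiffOn_Ici 0 τ hτ)
  rw [zero_sub] at h
  exact h

theorem pushforward_eq (D : Correctors h₁ h₂ V W p K) (hε : 0 < ε) (hε1 : ε ≤ 1)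
    (hεK : 4 * K * ε ≤ 1) (F : Euc n → ℝ → Euc n) (x : Euc n) {τ : ℝ} (hτ : 0 ≤ τ)
    {y : Euc n} (hy : y = (phaseInv (nearId V W ε) (x, τ)).1) :
    pushforward (nearId V W ε) F ε x τ =
      (ContinuousLinearMap.id ℝ (Euc n) - ε • Dx V y τ - ε ^ 2 • Dx W y τ) (F y τ)
        + (ε ^ 2)⁻¹ • (-(ε • h₁ y τ) - ε ^ 2 • (h₂ y τ - Dx V y τ (h₁ y τ) - p y)) := by
  have h := (D.phaseInv_spec hε hε1 hεK x hτ).1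
  rw [← hy] at h
  simp only [pushforward, h, D.Dx_nearId y hτ, D.derivWithin_nearId y hτ]

theorem Dx_le (D : Correctors h₁ h₂ V W p K) {τ : ℝ} (hτ : 0 ≤ τ) (x : Euc n) :
    ‖Dx V x τ‖ ≤ K ∧ ‖Dx W x τ‖ ≤ K :=
  ⟨Dx_norm_le_of_lipschitz D.pos.le (D.lipV τ hτ) x,
    Dx_norm_le_of_lipschitz D.pos.le (D.lipW τ hτ) x⟩

/-- Where the system is the one the correctors were built for, the transformed field differs from
the average by `O(ε)`. -/
theorem pushforward_sub_average_le (D : Correctors h₁ h₂ V W p K) (hε : 0 < ε) (hε1 : ε ≤ 1)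
    (hεK : 4 * K * ε ≤ 1) {F : Euc n → ℝ → Euc n} {x : Euc n} {τ : ℝ} (hτ : 0 ≤ τ)
    (hF : ∀ y, y = (phaseInv (nearId V W ε) (x, τ)).1 → F y τ = oscField h₁ h₂ ε y τ) :
    ‖pushforward (nearId V W ε) F ε x τ - p x‖ ≤ ε * (10 * K ^ 2) * (1 + ‖x‖) := by
  obtain ⟨y, hy⟩ : ∃ y, y = (phaseInv (nearId V W ε) (x, τ)).1 := ⟨_, rfl⟩
  rw [D.pushforward_eq hε hε1 hεK F x hτ hy, hF y hy]
  have hyx := D.phaseInv_sub_le hε hε1 hεK x hτ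
  rw [← hy] at hyx
  obtain ⟨hV, hW⟩ := D.Dx_le hτ y
  have hK := D.pos
  -- The cancellation: ε⁻¹h₁ is removed by ∂_τV = h₁, and h₂ - (DₓV)h₁ by ∂_τW, leaving p(y) and
  -- terms carrying a factor ε.
  have e : (ContinuousLinearMap.id ℝ (Euc n) - ε • Dx V y τ - ε ^ 2 • Dx W y τ)
        (oscField h₁ h₂ ε y τ)
        + (ε ^ 2)⁻¹ • (-(ε • h₁ y τ) - ε ^ 2 • (h₂ y τ - Dx V y τ (h₁ y τ) - p y)) - p x
      = (p y - p x) - ε • (Dx V y τ (h₂ y τ)) - ε • (Dx W y τ (h₁ y τ))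
        - ε ^ 2 • (Dx W y τ (h₂ y τ)) := by
    simp only [oscField, sub_apply, smul_apply,
      ContinuousLinearMap.id_apply, map_add, map_smul, smul_sub, smul_smul, smul_neg]
    have e1 : ε⁻¹ * ε = 1 := inv_mul_cancel₀ hε.ne'
    have e2 : (ε ^ 2)⁻¹ * ε = ε⁻¹ := by field_simp
    have e3 : (ε ^ 2)⁻¹ * ε ^ 2 = 1 := inv_mul_cancel₀ (by positivity)
    have e4 : ε⁻¹ * ε ^ 2 = ε := by field_simp
    simp only [e1, e2, e3, e4, one_smul]
    abel
  rw [e]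
  have hy1 : 1 + ‖y‖ ≤ 2 * (1 + ‖x‖) := by
    have : ‖y‖ ≤ ‖x‖ + ‖y - x‖ := by
      have := norm_add_le x (y - x); simpa using this
    have h0 := norm_nonneg x
    nlinarith
  have b1 : ‖p y - p x‖ ≤ K * (4 * K * ε * (1 + ‖x‖)) :=
    (D.lip_avg y x).trans (by gcongr)
  have hg1 : ‖h₁ y τ‖ ≤ K * (2 * (1 + ‖x‖)) := (D.growth₁ y τ hτ).trans (by gcongr)
  have hg2 : ‖h₂ y τ‖ ≤ K * (2 * (1 + ‖x‖)) := (D.growth₂ y τ hτ).trans (by gcongr)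
  have b2 : ‖ε • (Dx V y τ (h₂ y τ))‖ ≤ ε * (K * (K * (2 * (1 + ‖x‖)))) := by
    rw [norm_smul, Real.norm_of_nonneg hε.le]
    gcongr
    exact (ContinuousLinearMap.le_opNorm _ _).trans (by gcongr)
  have b3 : ‖ε • (Dx W y τ (h₁ y τ))‖ ≤ ε * (K * (K * (2 * (1 + ‖x‖)))) := by
    rw [norm_smul, Real.norm_of_nonneg hε.le]
    gcongr
    exact (ContinuousLinearMap.le_opNorm _ _).trans (by gcongr)
  have b4 : ‖ε ^ 2 • (Dx W y τ (h₂ y τ))‖ ≤ ε * (K * (K * (2 * (1 + ‖x‖)))) := by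
    rw [norm_smul, Real.norm_of_nonneg (by positivity)]
    have h3 : ε ^ 2 ≤ ε := by nlinarith
    gcongr
    exact (ContinuousLinearMap.le_opNorm _ _).trans (by gcongr)
  -- The constant is 10 = 4 + 2 + 2 + 2: displacement of the preimage in the average, then the three
  -- remainder terms.
  refine (norm_sub_le _ _).trans ?_
  refine (add_le_add ((norm_sub_le _ _).trans (add_le_add
    ((norm_sub_le _ _).trans (add_le_add b1 b2)) b3)) b4).trans (le_of_eq ?_)
  ring

/-- With y the preimage of (x,τ), the Lipschitz inverse gives |Ψ⁻¹(z,σ) - y| ≤ 2|z - Φ(y,σ)| in the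
space component. Only continuity of Φ(y,·) in time remains to be used. -/
theorem continuousOn_phaseInv (D : Correctors h₁ h₂ V W p K) (hε : 0 < ε) (hε1 : ε ≤ 1)
    (hεK : 4 * K * ε ≤ 1) :
    ContinuousOn (fun q : Euc n × ℝ => (phaseInv (nearId V W ε) q).1) (univ ×ˢ Ici 0) := by
  rintro ⟨x, τ⟩ ⟨-, hτ⟩
  have hτ : 0 ≤ τ := hτ
  set y := (phaseInv (nearId V W ε) (x, τ)).1 with hy
  have hspec := (D.phaseInv_spec hε hε1 hεK x hτ).2
  rw [← hy] at hspec
  rw [ContinuousWithinAt, ← hy, tendsto_iff_norm_sub_tendsto_zero]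
  have hc : ContinuousWithinAt (fun q : Euc n × ℝ => (nearId V W ε (y, q.2)).1)
      (univ ×ˢ Ici 0) (x, τ) := by
    have hm : ContinuousWithinAt (fun q : Euc n × ℝ => (y, q.2)) (univ ×ˢ Ici 0) (x, τ) := by
      fun_prop
    have hV := (D.contV (y, τ) ⟨mem_univ _, hτ⟩).comp (f := fun q : Euc n × ℝ => (y, q.2))
      (s := univ ×ˢ Ici 0) (x := (x, τ)) hm (fun q hq => ⟨mem_univ _, hq.2⟩)
    have hW := (D.contW (y, τ) ⟨mem_univ _, hτ⟩).comp (f := fun q : Euc n × ℝ => (y, q.2))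
      (s := univ ×ˢ Ici 0) (x := (x, τ)) hm (fun q hq => ⟨mem_univ _, hq.2⟩)
    exact ((continuousWithinAt_const.sub (hV.const_smul ε)).sub (hW.const_smul (ε ^ 2)))
  have hlim : Tendsto (fun q : Euc n × ℝ => 2 * ‖q.1 - (nearId V W ε (y, q.2)).1‖)
      (𝓝[univ ×ˢ Ici 0] (x, τ)) (𝓝 0) := by
    have h1 : Tendsto (fun q : Euc n × ℝ => 2 * ‖q.1 - (nearId V W ε (y, q.2)).1‖)
        (𝓝[univ ×ˢ Ici 0] (x, τ)) (𝓝 (2 * ‖x - (nearId V W ε (y, τ)).1‖)) :=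
      (((continuousWithinAt_fst (s := univ ×ˢ Ici 0) (p := (x, τ))).sub hc).norm).const_mul 2
    rwa [hspec, sub_self, norm_zero, mul_zero] at h1
  refine squeeze_zero' (Eventually.of_forall fun _ => norm_nonneg _) ?_ hlim
  filter_upwards [self_mem_nhdsWithin] with q hq
  obtain ⟨z, σ⟩ := q
  have hσ : 0 ≤ σ := hq.2
  have h1 := D.phaseInv_lipschitz hε hε1 hεK hσ z (nearId V W ε (y, σ)).1
  rw [D.phaseInv_apply hε hε1 hεK y hσ] at h1
  refine h1.trans ?_
  gcongr
  linarith

theorem continuousOn_pushforward (D : Correctors h₁ h₂ V W p K) (hε : 0 < ε) (hε1 : ε ≤ 1)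
    (hεK : 4 * K * ε ≤ 1) {F : Euc n → ℝ → Euc n}
    (hF : ContinuousOn (fun q : Euc n × ℝ => F q.1 q.2) (univ ×ˢ Ici 0)) :
    ContinuousOn (fun q : Euc n × ℝ => pushforward (nearId V W ε) F ε q.1 q.2)
      (univ ×ˢ Ici 0) := by
  have hm : ContinuousOn (fun q : Euc n × ℝ => ((phaseInv (nearId V W ε) q).1, q.2))
      (univ ×ˢ Ici 0) := (D.continuousOn_phaseInv hε hε1 hεK).prodMk continuousOn_snd
  have hmap : MapsTo (fun q : Euc n × ℝ => ((phaseInv (nearId V W ε) q).1, q.2))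
      (univ ×ˢ Ici 0) (univ ×ˢ Ici 0) := fun q hq => ⟨mem_univ _, hq.2⟩
  have hp : Continuous p := (LipschitzWith.of_dist_le_mul (K := K.toNNReal) fun x y => by
    rw [dist_eq_norm, dist_eq_norm, Real.coe_toNNReal _ D.pos.le]
    exact D.lip_avg x y).continuous
  have hbase : ContinuousOn (fun q : Euc n × ℝ =>
      (ContinuousLinearMap.id ℝ (Euc n) - ε • Dx V q.1 q.2 - ε ^ 2 • Dx W q.1 q.2) (F q.1 q.2)
        + (ε ^ 2)⁻¹ • (-(ε • h₁ q.1 q.2) -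
          ε ^ 2 • (h₂ q.1 q.2 - Dx V q.1 q.2 (h₁ q.1 q.2) - p q.1))) (univ ×ˢ Ici 0) := by
    refine ((((continuousOn_const.sub (D.contDV.const_smul ε)).sub
      (D.contDW.const_smul (ε ^ 2))).clm_apply hF)).add
      ((((D.cont₁.const_smul ε).neg).sub (((D.cont₂.sub (D.contDV.clm_apply D.cont₁)).sub
        (hp.comp continuous_fst).continuousOn).const_smul (ε ^ 2))).const_smul ((ε ^ 2)⁻¹))
  refine (hbase.comp hm hmap).congr fun q hq => ?_
  exact D.pushforward_eq hε hε1 hεK F q.1 hq.2 rfl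

/-- Only this direction is needed: a bound valid for all solutions of the pushed system is read off
along the images of solutions of the original one. -/
theorem isSolution_pushforward (D : Correctors h₁ h₂ V W p K) (hε : 0 < ε) (hε1 : ε ≤ 1)
    (hεK : 4 * K * ε ≤ 1) {F : Euc n → ℝ → Euc n}
    (hF : ContinuousOn (fun q : Euc n × ℝ => F q.1 q.2) (univ ×ˢ Ici 0))
    {x₀ : Euc n} {τ₀ : ℝ} {ts : EReal} {x : ℝ → Euc n} {τ : ℝ → ℝ}
    (h : IsSolution F ε x₀ τ₀ ts x τ) :
    IsSolution (pushforward (nearId V W ε) F ε) ε (nearId V W ε (x₀, τ₀)).1 τ₀ ts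
      (fun t => (nearId V W ε (x t, τ t)).1) τ where
  pos := h.pos
  init_x := by rw [h.init_x, h.init_tau]
  init_tau := h.init_tau
  tau_nonneg := h.tau_nonneg
  deriv_tau := h.deriv_tau
  deriv_x := by
    intro t ht
    have hτ := h.tau_nonneg t ht
    have hV := hasDerivWithinAt_along D.diffV D.contDV (D.derivV (x t) _ hτ) (h.deriv_x t ht)
      (h.deriv_tau t ht) h.tau_nonneg ht
    have hW := hasDerivWithinAt_along D.diffW D.contDW (D.derivW (x t) _ hτ) (h.deriv_x t ht)
      (h.deriv_tau t ht) h.tau_nonneg ht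
    have := ((h.deriv_x t ht).sub (hV.const_smul ε)).sub (hW.const_smul (ε ^ 2))
    refine this.congr_deriv ?_
    rw [D.pushforward_eq hε hε1 hεK F _ hτ (y := x t)
      (by rw [D.phaseInv_apply hε hε1 hεK _ hτ])]
    simp only [sub_apply, smul_apply, ContinuousLinearMap.id_apply]
    module
  cont_deriv := by
    refine (D.continuousOn_pushforward hε hε1 hεK hF).comp
      (f := fun t => ((nearId V W ε (x t, τ t)).1, τ t)) ?_
      (fun t ht => ⟨mem_univ _, h.tau_nonneg t ht⟩)
    have hx : ContinuousOn x (timeDom ts) := fun t ht => (h.deriv_x t ht).continuousWithinAt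
    have hτ : ContinuousOn τ (timeDom ts) := fun t ht => (h.deriv_tau t ht).continuousWithinAt
    have hxτ : ContinuousOn (fun t => (x t, τ t)) (timeDom ts) := hx.prodMk hτ
    have hm : MapsTo (fun t => (x t, τ t)) (timeDom ts) (univ ×ˢ Ici 0) :=
      fun t ht => ⟨mem_univ _, h.tau_nonneg t ht⟩
    exact ((hx.sub ((D.contV.comp hxτ hm).const_smul ε)).sub
      ((D.contW.comp hxτ hm).const_smul (ε ^ 2))).prodMk hτ

end Correctors

/-! ### Existence and continuation of solutions -/

section Peano

open MeasureTheory

variable {n : ℕ}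

theorem norm_integral_max_sub_le {g : ℝ → Euc n} {M : ℝ} (hg : Continuous g)
    (hM : ∀ s, ‖g s‖ ≤ M) (a b : ℝ) :
    ‖(∫ s in (0 : ℝ)..max a 0, g s) - ∫ s in (0 : ℝ)..max b 0, g s‖ ≤ M * |a - b| := by
  have hM0 : 0 ≤ M := (norm_nonneg _).trans (hM 0)
  rw [intervalIntegral.integral_interval_sub_left (hg.intervalIntegrable _ _)
    (hg.intervalIntegrable _ _)]
  refine (intervalIntegral.norm_integral_le_of_norm_le_const fun s _ => hM s).trans ?_
  exact mul_le_mul_of_nonneg_left (abs_max_sub_max_le_abs a b 0) hM0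

/-- Solutions of the delayed integral equation, built by the method of steps. -/
theorem exists_delayed_solution {G : ℝ → Euc n → Euc n} {M : ℝ}
    (hG : Continuous fun p : ℝ × Euc n => G p.1 p.2) (hM : ∀ t x, ‖G t x‖ ≤ M)
    (x₀ : Euc n) {h : ℝ} (hh : 0 < h) (m : ℕ) :
    ∃ X : ℝ → Euc n, (∀ s t, ‖X s - X t‖ ≤ M * |s - t|) ∧
      ∀ t, t ≤ m * h → X t = x₀ + ∫ s in (0 : ℝ)..max t 0, G s (X (s - h)) := by
  have hM0 : 0 ≤ M := (norm_nonneg _).trans (hM 0 0)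
  induction m with
  | zero =>
    refine ⟨fun _ => x₀, fun s t => by simp; positivity, fun t ht => ?_⟩
    rw [max_eq_right (by simpa using ht)]
    simp
  | succ m ih =>
    obtain ⟨X, hX, hX'⟩ := ih
    have hXc : Continuous X := (LipschitzWith.of_dist_le_mul (K := M.toNNReal) fun s t => by
      rw [dist_eq_norm, Real.dist_eq, Real.coe_toNNReal _ hM0]
      exact hX s t).continuous
    have hgc : Continuous fun s => G s (X (s - h)) :=
      hG.comp (f := fun s => (s, X (s - h))) (by fun_prop)
    -- The delay `h` means that times up to (m+1)h only consult the previous solution up to mh. The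
    -- Lipschitz constant is always `M`, independent of `h`.
    refine ⟨fun t => x₀ + ∫ s in (0 : ℝ)..max t 0, G s (X (s - h)), fun s t => ?_,
      fun t ht => ?_⟩
    · rw [add_sub_add_left_eq_sub]
      exact norm_integral_max_sub_le hgc (fun s => hM _ _) s t
    · refine congrArg (x₀ + ·) (intervalIntegral.integral_congr fun s hs => ?_)
      rw [uIcc_of_le (le_max_right _ _)] at hs
      have hsm : s - h ≤ m * h := by
        rcases le_total t 0 with h0 | h0
        · rw [max_eq_right h0] at hs
          have := hs.2
          have : 0 ≤ m * h := by positivity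
          linarith
        · rw [max_eq_left h0] at hs
          have := hs.2
          push_cast at ht
          linarith
      simp only
      rw [← hX' _ hsm]

/-- Peano's theorem for a bounded continuous field, as an integral equation on `[0, 1]`. -/
theorem exists_integral_solution {G : ℝ → Euc n → Euc n} {M : ℝ}
    (hG : Continuous fun p : ℝ × Euc n => G p.1 p.2) (hM : ∀ t x, ‖G t x‖ ≤ M)
    (x₀ : Euc n) :
    ∃ X : ℝ → Euc n, Continuous X ∧
      ∀ t ∈ Icc (0 : ℝ) 1, X t = x₀ + ∫ s in (0 : ℝ)..t, G s (X s) := by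
  have hM0 : 0 ≤ M := (norm_nonneg _).trans (hM 0 0)
  have hpos : ∀ k : ℕ, 0 < 1 / ((k : ℝ) + 1) := fun k => by positivity
  -- With delay 1/(k+1), k+1 steps cover exactly [0,1].
  choose Y hYlip hY using fun k : ℕ => exists_delayed_solution hG hM x₀ (hpos k) (k + 1)
  have hYc : ∀ k, Continuous (Y k) := fun k =>
    (LipschitzWith.of_dist_le_mul (K := M.toNNReal) fun s t => by
      rw [dist_eq_norm, Real.dist_eq, Real.coe_toNNReal _ hM0]
      exact hYlip k s t).continuous
  have hY0 : ∀ k, Y k 0 = x₀ := fun k => by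
    rw [hY k 0 (by positivity)]; simp
  have hY1 : ∀ k, ∀ t ∈ Icc (0 : ℝ) 1,
      Y k t = x₀ + ∫ s in (0 : ℝ)..t, G s (Y k (s - 1 / ((k : ℝ) + 1))) := fun k t ht => by
    have := hY k t (by
      have : ((k + 1 : ℕ) : ℝ) * (1 / ((k : ℝ) + 1)) = 1 := by push_cast; field_simp
      rw [this]; exact ht.2)
    rwa [max_eq_left ht.1] at this
  let f : ℕ → BoundedContinuousFunction (Icc (0 : ℝ) 1) (Euc n) := fun k =>
    BoundedContinuousFunction.mkOfCompact ⟨fun t => Y k t, (hYc k).comp continuous_subtype_val⟩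
  have hcomp : IsCompact (closure (range f)) := by
    refine BoundedContinuousFunction.arzela_ascoli (Metric.closedBall x₀ M)
      (isCompact_closedBall _ _) _ ?_ ?_
    · rintro g t ⟨k, rfl⟩
      rw [Metric.mem_closedBall, dist_eq_norm, ← hY0 k]
      refine (hYlip k t 0).trans ?_
      rw [sub_zero, abs_of_nonneg t.2.1]
      exact mul_le_of_le_one_right hM0 t.2.2
    · refine Metric.equicontinuous_of_continuity_modulus (fun r => M * r) ?_ _ ?_
      · have : Continuous fun r : ℝ => M * r := by fun_prop
        simpa using this.tendsto 0
      · rintro s t ⟨g, k, rfl⟩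
        have := hYlip k s t
        rwa [← dist_eq_norm, ← Real.dist_eq] at this
  obtain ⟨g, -, φ, hφ, hlim⟩ := hcomp.tendsto_subseq (x := f)
    fun k => subset_closure (mem_range_self k)
  have hpt : ∀ t : Icc (0 : ℝ) 1, Tendsto (fun j => Y (φ j) t) atTop (𝓝 (g t)) := fun t =>
    (BoundedContinuousFunction.tendsto_iff_tendstoUniformly.1 hlim).tendsto_at t
  refine ⟨fun t => g (projIcc 0 1 zero_le_one t), g.continuous.comp continuous_projIcc,
    fun t ht => ?_⟩
  have hX : ∀ s (hs : s ∈ Icc (0 : ℝ) 1), Tendsto (fun j => Y (φ j) s) atTop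
      (𝓝 (g (projIcc 0 1 zero_le_one s))) := fun s hs => by
    rw [projIcc_of_mem zero_le_one hs]
    exact hpt ⟨s, hs⟩
  refine tendsto_nhds_unique (hX t ht) ?_
  have e : (fun j => Y (φ j) t) = fun j => x₀ + ∫ s in (0 : ℝ)..t,
      G s (Y (φ j) (s - 1 / ((φ j : ℝ) + 1))) := by
    funext j; exact hY1 (φ j) t ht
  rw [e]
  refine tendsto_const_nhds.add ?_
  refine intervalIntegral.tendsto_integral_filter_of_dominated_convergence (fun _ => M)
    (Eventually.of_forall fun j => ?_) (Eventually.of_forall fun j => ae_of_all _ fun s _ => hM _ _)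
    intervalIntegrable_const (ae_of_all _ fun s hs => ?_)
  · have := hYc (φ j)
    exact (hG.comp (f := fun s => (s, Y (φ j) (s - 1 / ((φ j : ℝ) + 1))))
      (by fun_prop)).aestronglyMeasurable
  · rw [uIoc_of_le ht.1] at hs
    have hs' : s ∈ Icc (0 : ℝ) 1 := ⟨hs.1.le, hs.2.trans ht.2⟩
    -- The common Lipschitz constant makes the vanishing delay disappear in the limit.
    have hd : Tendsto (fun j => Y (φ j) (s - 1 / ((φ j : ℝ) + 1)) - Y (φ j) s) atTop (𝓝 0) := by
      refine squeeze_zero_norm (a := fun j => M * (1 / ((φ j : ℝ) + 1))) (fun j => ?_) ?_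
      · refine (hYlip (φ j) _ _).trans (le_of_eq ?_)
        rw [sub_sub_cancel_left, abs_neg, abs_of_pos (hpos _)]
      · have := (tendsto_one_div_add_atTop_nhds_zero_nat (𝕜 := ℝ)).comp hφ.tendsto_atTop
        simpa using this.const_mul M
    have h2 := hd.add (hX s hs')
    simp only [sub_add_cancel, zero_add] at h2
    exact (hG.tendsto (s, _)).comp (tendsto_const_nhds.prodMk_nhds h2)

end Peano

/-! ### Local existence, continuation of bounded solutions, completeness. -/

section Continuation

open MeasureTheory

variable {n : ℕ} {F : Euc n → ℝ → Euc n} {ε : ℝ} {x₀ : Euc n} {τ₀ : ℝ} {ts : EReal}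
  {x : ℝ → Euc n} {τ : ℝ → ℝ}

theorem timeDom_coe (b : ℝ) : timeDom (b : EReal) = Ico 0 b := by
  ext t; simp [timeDom]

theorem convex_timeDom (ts : EReal) : Convex ℝ (timeDom ts) := by
  refine OrdConnected.convex ⟨fun a ha b hb c hc => ⟨ha.1.trans hc.1, ?_⟩⟩
  exact lt_of_le_of_lt (EReal.coe_le_coe_iff.2 hc.2) hb.2

theorem zero_mem_timeDom (h : 0 < ts) : (0 : ℝ) ∈ timeDom ts := ⟨le_rfl, by simpa using h⟩

theorem Icc_subset_timeDom {t : ℝ} (ht : t ∈ timeDom ts) : Icc 0 t ⊆ timeDom ts :=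
  fun _ hs => ⟨hs.1, lt_of_le_of_lt (EReal.coe_le_coe_iff.2 hs.2) ht.2⟩

theorem IsSolution.tau_eq (h : IsSolution F ε x₀ τ₀ ts x τ) {t : ℝ} (ht : t ∈ timeDom ts) :
    τ t = τ₀ + t * (ε ^ 2)⁻¹ := by
  have h0 := zero_mem_timeDom h.pos
  have := (convex_timeDom ts).norm_image_sub_le_of_norm_hasDerivWithin_le
    (f := fun s => τ s - s * (ε ^ 2)⁻¹) (f' := fun _ => 0) (C := 0)
    (fun s hs => ((h.deriv_tau s hs).sub
      ((hasDerivWithinAt_id s _).mul_const ((ε ^ 2)⁻¹))).congr_deriv (by simp))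
    (fun s _ => by simp) h0 ht
  simp only [zero_mul, sub_zero, h.init_tau] at this
  linarith [sub_eq_zero.1 (norm_le_zero_iff.1 this)]

theorem hasDerivWithinAt_of_integral_eq {φ y : ℝ → Euc n} {c : ℝ}
    (hφ : ContinuousOn φ (Ico 0 c)) (hy : ∀ t ∈ Ico 0 c, y t = x₀ + ∫ s in (0 : ℝ)..t, φ s)
    {t : ℝ} (ht : t ∈ Ico 0 c) : HasDerivWithinAt y (φ t) (Ico 0 c) t := by
  obtain ⟨c', h1, h2⟩ := exists_between ht.2
  have hc' : 0 ≤ c' := ht.1.trans h1.le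
  -- Clamping the argument to [0,c'] with t < c' < c extends φ continuously to ℝ without changing
  -- the integral near t.
  have hext : Continuous (fun s => φ (max 0 (min c' s))) := by
    refine hφ.comp_continuous (by fun_prop) fun s => ⟨le_max_left _ _, ?_⟩
    exact (max_le hc' (min_le_left _ _)).trans_lt h2
  have hid : ∀ s ∈ Icc 0 c', φ (max 0 (min c' s)) = φ s := fun s hs => by
    rw [min_eq_right hs.2, max_eq_right hs.1]
  have hd : HasDerivAt (fun t => x₀ + ∫ s in (0 : ℝ)..t, φ (max 0 (min c' s))) (φ t) t := by
    have := (hext.integral_hasStrictDerivAt 0 t).hasDerivAt.const_add x₀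
    rwa [hid t ⟨ht.1, h1.le⟩] at this
  refine hd.hasDerivWithinAt.congr_of_eventuallyEq ?_ ?_
  · filter_upwards [self_mem_nhdsWithin, mem_nhdsWithin_of_mem_nhds (Iio_mem_nhds h1)] with s hs hs'
    rw [hy s hs]
    congr 1
    refine intervalIntegral.integral_congr fun r hr => (hid r ?_).symm
    rw [uIcc_of_le hs.1] at hr
    exact ⟨hr.1, hr.2.trans (le_of_lt hs')⟩
  · rw [hy t ht]
    congr 1
    refine intervalIntegral.integral_congr fun r hr => (hid r ?_).symm
    rw [uIcc_of_le ht.1] at hr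
    exact ⟨hr.1, hr.2.trans h1.le⟩

/-- Local existence for a continuous field on the extended phase space. -/
theorem exists_local_solution
    (hF : ContinuousOn (fun q : Euc n × ℝ => F q.1 q.2) (univ ×ˢ Ici 0)) (y₀ : Euc n) {σ₀ c : ℝ}
    (hσ₀ : 0 ≤ σ₀) (hc : 0 ≤ c) :
    ∃ η > 0, ∃ X : ℝ → Euc n, Continuous X ∧
      ∀ t ∈ Icc (0 : ℝ) η, X t = y₀ + ∫ s in (0 : ℝ)..t, F (X s) (σ₀ + s * c) := by
  -- Retracting space to the unit ball about `y₀` and clamping time to [0,1] makes the field bounded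
  -- by some `M`. Up to time 1/(M+1) a solution has not left that ball, so the modification is
  -- invisible.
  set ρ : Euc n → Euc n := fun y => y₀ + (max 1 ‖y - y₀‖)⁻¹ • (y - y₀) with hρ
  have hρc : Continuous ρ := by
    have h1 : Continuous fun y : Euc n => max 1 ‖y - y₀‖ := by fun_prop
    have h2 : Continuous fun y : Euc n => y - y₀ := by fun_prop
    exact continuous_const.add ((h1.inv₀ fun y =>
      (lt_of_lt_of_le zero_lt_one (le_max_left _ _)).ne').smul h2)
  have hρb : ∀ y, ρ y ∈ Metric.closedBall y₀ 1 := fun y => by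
    have hpos : 0 < max 1 ‖y - y₀‖ := lt_of_lt_of_le zero_lt_one (le_max_left _ _)
    rw [Metric.mem_closedBall, dist_eq_norm, hρ]
    simp only [add_sub_cancel_left]
    rw [norm_smul, norm_inv, Real.norm_of_nonneg hpos.le, inv_mul_le_iff₀ hpos, mul_one]
    exact le_max_right _ _
  have hρid : ∀ y, ‖y - y₀‖ ≤ 1 → ρ y = y := fun y hy => by
    simp [hρ, max_eq_left hy]
  set κ : ℝ → ℝ := fun s => max 0 (min 1 s) with hκ
  have hκm : ∀ s, κ s ∈ Icc (0 : ℝ) 1 := fun s =>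
    ⟨le_max_left _ _, max_le zero_le_one (min_le_left _ _)⟩
  obtain ⟨M, hM⟩ := ((isCompact_closedBall y₀ 1).prod
    (isCompact_Icc (a := σ₀) (b := σ₀ + 1 * c))).exists_bound_of_continuousOn
    (hF.mono (prod_mono (subset_univ _) fun s hs => hσ₀.trans hs.1))
  have hmem : ∀ s, σ₀ + κ s * c ∈ Icc σ₀ (σ₀ + 1 * c) := fun s =>
    ⟨le_add_of_nonneg_right (mul_nonneg (hκm s).1 hc), by have := (hκm s).2; gcongr⟩
  have hG : Continuous fun p : ℝ × Euc n => F (ρ p.2) (σ₀ + κ p.1 * c) :=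
    hF.comp_continuous (f := fun p : ℝ × Euc n => (ρ p.2, σ₀ + κ p.1 * c))
      (by fun_prop) fun p => ⟨mem_univ _, hσ₀.trans (hmem p.1).1⟩
  have hGM : ∀ s y, ‖F (ρ y) (σ₀ + κ s * c)‖ ≤ M := fun s y =>
    hM (ρ y, σ₀ + κ s * c) ⟨hρb y, hmem s⟩
  have hM0 : 0 ≤ M := (norm_nonneg _).trans (hGM 0 0)
  obtain ⟨X, hXc, hX⟩ := exists_integral_solution (G := fun s y => F (ρ y) (σ₀ + κ s * c))
    hG hGM y₀
  have hη : 0 < 1 / (M + 1) := by positivity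
  have hη1 : 1 / (M + 1) ≤ 1 := by rw [div_le_one (by positivity)]; linarith
  refine ⟨1 / (M + 1), hη, X, hXc, fun t ht => ?_⟩
  rw [hX t ⟨ht.1, ht.2.trans hη1⟩]
  congr 1
  refine intervalIntegral.integral_congr fun s hs => ?_
  rw [uIcc_of_le ht.1] at hs
  have hs1 : s ≤ 1 / (M + 1) := hs.2.trans ht.2
  have hκs : κ s = s := by
    simp only [hκ]
    rw [min_eq_right (hs1.trans hη1), max_eq_right hs.1]
  have hXs : ‖X s - y₀‖ ≤ 1 := by
    rw [hX s ⟨hs.1, hs1.trans hη1⟩, add_sub_cancel_left]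
    refine (intervalIntegral.norm_integral_le_of_norm_le_const fun r _ => hGM r (X r)).trans ?_
    rw [sub_zero, abs_of_nonneg hs.1]
    calc M * s ≤ M * (1 / (M + 1)) := by gcongr
      _ ≤ 1 := by rw [mul_one_div, div_le_one (by positivity)]; linarith
  simp only [hκs, hρid _ hXs]

/-- Bounded solutions on a finite time interval can be continued. -/
theorem IsSolution.exists_continuation
    (hF : ContinuousOn (fun q : Euc n × ℝ => F q.1 q.2) (univ ×ˢ Ici 0)) {b B : ℝ}
    (h : IsSolution F ε x₀ τ₀ (b : EReal) x τ) (hB : ∀ t ∈ timeDom (b : EReal), ‖x t‖ ≤ B) :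
    ∃ b' > b, ∃ (x' : ℝ → Euc n) (τ' : ℝ → ℝ), IsSolution F ε x₀ τ₀ (b' : EReal) x' τ' ∧
      ∀ t ∈ timeDom (b : EReal), x' t = x t ∧ τ' t = τ t := by
  have hb : 0 < b := by simpa using h.pos
  set c : ℝ := (ε ^ 2)⁻¹ with hc
  have hc0 : 0 ≤ c := by positivity
  have hτ₀ : 0 ≤ τ₀ := by
    rw [← h.init_tau]; exact h.tau_nonneg 0 (zero_mem_timeDom h.pos)
  have hτ : ∀ t ∈ Ico 0 b, τ t = τ₀ + t * c := fun t ht => h.tau_eq (by rwa [timeDom_coe])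
  obtain ⟨M, hM⟩ := ((isCompact_closedBall (0 : Euc n) B).prod
    (isCompact_Icc (a := τ₀) (b := τ₀ + b * c))).exists_bound_of_continuousOn
    (hF.mono (prod_mono (subset_univ _) fun s hs => hτ₀.trans hs.1))
  have hmemτ : ∀ t, 0 ≤ t → 0 ≤ τ₀ + t * c := fun t ht => by positivity
  have hxI : ContinuousOn (fun t => F (x t) (τ₀ + t * c)) (Ico 0 b) := by
    have := h.cont_deriv
    rw [timeDom_coe] at this
    exact this.congr fun t ht => by simp only [hτ t ht]
  have hbd : ∀ t ∈ Ico 0 b, ‖F (x t) (τ₀ + t * c)‖ ≤ M := fun t ht =>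
    hM (x t, τ₀ + t * c) ⟨by simpa using hB t (by rwa [timeDom_coe]),
      le_add_of_nonneg_right (mul_nonneg ht.1 hc0),
        add_le_add_right (mul_le_mul_of_nonneg_right ht.2.le hc0) _⟩
  -- The endpoint value is defined by the integral, whose integrand is bounded because the solution
  -- is. Gluing at the level of the integral equation then yields continuity and differentiability
  -- across `b` together.
  set xb : Euc n := x₀ + ∫ s in (0 : ℝ)..b, F (x s) (τ₀ + s * c) with hxb
  obtain ⟨η, hη, X, hXc, hX⟩ := exists_local_solution hF xb (hmemτ b hb.le) hc0
  have hX0 : X 0 = xb := by simpa using hX 0 ⟨le_rfl, hη.le⟩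
  set x' : ℝ → Euc n := fun t => if t < b then x t else X (t - b) with hx'
  set φ : ℝ → Euc n := fun t => F (x' t) (τ₀ + t * c) with hφ
  have hx'1 : ∀ t, t < b → x' t = x t := fun t ht => by simp [hx', ht]
  have hx'2 : ∀ t, b ≤ t → x' t = X (t - b) := fun t ht => by simp [hx', not_lt.2 ht]
  have hφI : ContinuousOn φ (Ico 0 b) := hxI.congr fun t ht => by simp only [hφ, hx'1 t ht.2]
  have hφb : ContinuousOn φ (Icc b (b + η)) := by
    refine (hF.comp (f := fun t => (X (t - b), τ₀ + t * c)) (by fun_prop)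
      (s := Icc b (b + η)) fun t ht => ⟨mem_univ _, hmemτ t (hb.le.trans ht.1)⟩).congr
      fun t ht => by simp only [hφ, hx'2 t ht.1, Function.comp]
  have hi1 : IntervalIntegrable φ volume 0 b := by
    have hm : AEStronglyMeasurable φ (volume.restrict (Ico 0 b)) :=
      hφI.aestronglyMeasurable measurableSet_Ico
    rw [intervalIntegrable_iff_integrableOn_Ico_of_le hb.le]
    refine IntegrableOn.of_bound (by simp) hm M ?_
    filter_upwards [ae_restrict_mem measurableSet_Ico] with t ht
    simp only [hφ, hx'1 t ht.2]
    exact hbd t ht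
  have hi2 : IntervalIntegrable φ volume b (b + η) := by
    refine ContinuousOn.intervalIntegrable ?_
    rwa [uIcc_of_le (by linarith)]
  have hint : ∀ t ∈ Icc 0 (b + η), x' t = x₀ + ∫ s in (0 : ℝ)..t, φ s := by
    intro t ht
    rcases lt_or_ge t b with htb | htb
    · have hsub : Icc 0 t ⊆ Ico 0 b := fun s hs => ⟨hs.1, hs.2.trans_lt htb⟩
      have hd : ∀ s ∈ Icc 0 t, HasDerivWithinAt x (φ s) (Ico 0 b) s := fun s hs => by
        have := h.deriv_x s (by rw [timeDom_coe]; exact hsub hs)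
        rw [timeDom_coe, hτ s (hsub hs)] at this
        simpa only [hφ, hx'1 s (hsub hs).2] using this
      have hftc : ∫ s in (0 : ℝ)..t, φ s = x t - x 0 := by
        refine intervalIntegral.integral_eq_sub_of_hasDerivAt_of_le ht.1
          (fun s hs => ((hd s hs).continuousWithinAt).mono hsub) (fun s hs => ?_) ?_
        · exact (hd s ⟨hs.1.le, hs.2.le⟩).hasDerivAt (Ico_mem_nhds hs.1 (hs.2.trans htb))
        · refine ContinuousOn.intervalIntegrable ?_
          rw [uIcc_of_le ht.1]
          exact hφI.mono hsub
      rw [hftc, h.init_x, hx'1 t htb]; abel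
    · have e1 : ∫ s in (0 : ℝ)..b, φ s = ∫ s in (0 : ℝ)..b, F (x s) (τ₀ + s * c) := by
        rw [intervalIntegral.integral_of_le hb.le, intervalIntegral.integral_of_le hb.le,
          integral_Ioc_eq_integral_Ioo, integral_Ioc_eq_integral_Ioo]
        refine setIntegral_congr_fun measurableSet_Ioo fun s hs => ?_
        simp only [hφ, hx'1 s hs.2]
      have e2 : ∫ s in b..t, φ s
          = ∫ s in (0 : ℝ)..(t - b), F (X s) (τ₀ + b * c + s * c) := by
        have := intervalIntegral.integral_comp_add_right (a := 0) (b := t - b) φ b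
        rw [zero_add, sub_add_cancel] at this
        rw [← this]
        refine intervalIntegral.integral_congr fun s hs => ?_
        rw [uIcc_of_le (sub_nonneg.2 htb)] at hs
        simp only [hφ, hx'2 (s + b) (by linarith [hs.1]), add_sub_cancel_right]
        congr 1; ring
      have hi3 : IntervalIntegrable φ volume b t := by
        refine hi2.mono_set ?_
        rw [uIcc_of_le htb, uIcc_of_le (by linarith)]
        exact Icc_subset_Icc_right ht.2
      rw [← intervalIntegral.integral_add_adjacent_intervals hi1 hi3, e1, e2, ← add_assoc, ← hxb,
        hx'2 t htb]
      exact hX _ ⟨by linarith, by linarith [ht.2]⟩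
  have hx'c : ContinuousOn x' (Icc 0 (b + η)) := by
    have hp := intervalIntegral.continuousOn_primitive_interval' (hi1.trans hi2) left_mem_uIcc
    rw [uIcc_of_le (by linarith)] at hp
    exact (continuousOn_const.add hp).congr hint
  have hφc : ContinuousOn φ (Ico 0 (b + η)) := by
    have hpair : ContinuousOn (fun t => (x' t, τ₀ + t * c)) (Ico 0 (b + η)) :=
      (hx'c.mono Ico_subset_Icc_self).prodMk (by fun_prop)
    exact hF.comp hpair fun t ht => ⟨mem_univ _, hmemτ t ht.1⟩
  refine ⟨b + η, by linarith, x', fun t => τ₀ + t * c, ⟨?_, ?_, ?_, ?_, ?_, ?_, ?_⟩, ?_⟩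
  · have : 0 < b + η := by linarith
    exact_mod_cast this
  · rw [hx'1 0 hb, h.init_x]
  · simp
  · exact fun t ht => hmemτ t ht.1
  · rw [timeDom_coe]
    exact fun t ht => hasDerivWithinAt_of_integral_eq hφc
      (fun s hs => hint s (Ico_subset_Icc_self hs)) ht
  · intro t _
    simpa using ((hasDerivWithinAt_id t _).mul_const c).const_add τ₀
  · rw [timeDom_coe]; exact hφc
  · intro t ht
    rw [timeDom_coe] at ht
    exact ⟨hx'1 t ht.2, (hτ t ht).symm⟩

theorem IsMaximalSolution.complete
    (hF : ContinuousOn (fun q : Euc n × ℝ => F q.1 q.2) (univ ×ˢ Ici 0))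
    (h : IsMaximalSolution F ε x₀ τ₀ ts x τ) {B : ℝ} (hB : ∀ t ∈ timeDom ts, ‖x t‖ ≤ B) :
    ts = ⊤ := by
  induction ts with
  | bot => exact absurd h.1.pos (by simp)
  | top => rfl
  | coe b =>
    obtain ⟨b', hb', x', τ', hsol, hag⟩ := h.1.exists_continuation hF hB
    have := h.2 b' x' τ' hsol (by exact_mod_cast hb'.le) hag
    exact absurd (EReal.coe_injective this) hb'.ne'

end Continuation

/-! ### Comparison functions and the Lyapunov argument -/

section Comparison

theorem ClassK.nonneg {α : ℝ → ℝ} (h : ClassK α) {r : ℝ} (hr : 0 ≤ r) : 0 ≤ α r := by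
  rw [← h.2.2]
  exact h.2.1.monotoneOn (mem_Ici.2 le_rfl) hr hr

theorem ClassK.pos {α : ℝ → ℝ} (h : ClassK α) {r : ℝ} (hr : 0 < r) : 0 < α r := by
  rw [← h.2.2]
  exact h.2.1 (mem_Ici.2 le_rfl) hr.le hr

/-- A class-`K_∞` function has a class-`K_∞` inverse. -/
theorem ClassKInf.exists_inverse {α : ℝ → ℝ} (h : ClassKInf α) :
    ∃ γ, ClassKInf γ ∧ (∀ r, 0 ≤ r → γ (α r) = r) ∧ ∀ s, 0 ≤ s → α (γ s) = s := by
  obtain ⟨⟨hc, hm, h0⟩, ht⟩ := h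
  -- Extended by the identity on negative numbers, α becomes an order isomorphism of ℝ, whose
  -- inverse is automatically continuous.
  set A : ℝ → ℝ := fun r => if 0 ≤ r then α r else r with hA
  have hAp : ∀ r, 0 ≤ r → A r = α r := fun r hr => by simp [hA, hr]
  have hAn : ∀ r, r < 0 → A r = r := fun r hr => by simp [hA, not_le.2 hr]
  have hnn : ∀ r, 0 ≤ r → 0 ≤ α r := fun r hr => ClassK.nonneg ⟨hc, hm, h0⟩ hr
  have hAm : StrictMono A := by
    intro r s hrs
    rcases lt_or_ge r 0 with hr | hr
    · rw [hAn r hr]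
      rcases lt_or_ge s 0 with hs | hs
      · rwa [hAn s hs]
      · rw [hAp s hs]; exact hr.trans_le (hnn s hs)
    · rw [hAp r hr, hAp s (hr.trans hrs.le)]
      exact hm hr (hr.trans hrs.le) hrs
  have hsurj : Function.Surjective A := by
    intro s
    rcases lt_or_ge s 0 with hs | hs
    · exact ⟨s, hAn s hs⟩
    · obtain ⟨b, hb0, hb⟩ := ((eventually_ge_atTop (0 : ℝ)).and (ht.eventually_ge_atTop s)).exists
      obtain ⟨r, hr, hrs⟩ := intermediate_value_Icc hb0 (hc.mono fun r hr => hr.1)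
        (show s ∈ Icc (α 0) (α b) from ⟨by rwa [h0], hb⟩)
      exact ⟨r, by rw [hAp r hr.1, hrs]⟩
  set e := hAm.orderIsoOfSurjective A hsurj with he
  have heA : ∀ r, e r = A r := fun r => rfl
  have hA0 : A 0 = 0 := by rw [hAp 0 le_rfl, h0]
  have hs0 : e.symm 0 = 0 := by rw [OrderIso.symm_apply_eq, heA, hA0]
  have hsn : ∀ s, 0 ≤ s → 0 ≤ e.symm s := fun s hs => by
    rw [← hs0]; exact e.symm.monotone hs
  refine ⟨e.symm, ⟨⟨e.symm.continuous.continuousOn, e.symm.strictMono.strictMonoOn _, hs0⟩,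
    e.symm.tendsto_atTop⟩, fun r hr => ?_, fun s hs => ?_⟩
  · rw [OrderIso.symm_apply_eq, heA, hAp r hr]
  · rw [← hAp _ (hsn s hs), ← heA, OrderIso.apply_symm_apply]

/-- A class-`KL` function that dominates the linear decay `v - a t`. -/
noncomputable def decay (a v t : ℝ) : ℝ := v * ((1 + v) / (1 + v + a * t))

variable {a : ℝ}

/-- The sharper max(v - at, 0) is not strictly monotone, hence not of class KL. With u = at, the
bound is (v - u)(1 + v + u) = v(1 + v) - u - u² ≤ v(1 + v). -/
theorem sub_le_decay (ha : 0 < a) {v t : ℝ} (hv : 0 ≤ v) (ht : 0 ≤ t) :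
    v - a * t ≤ decay a v t := by
  have hd : 0 < 1 + v + a * t := by positivity
  rw [decay, ← mul_div_assoc, le_div_iff₀ hd]
  have : 0 ≤ a * t := by positivity
  nlinarith

theorem decay_nonneg (ha : 0 < a) {v t : ℝ} (hv : 0 ≤ v) (ht : 0 ≤ t) : 0 ≤ decay a v t := by
  unfold decay; positivity

theorem decay_strictMono (ha : 0 < a) {t v v' : ℝ} (ht : 0 ≤ t) (hv : 0 ≤ v) (h : v < v') :
    decay a v t < decay a v' t := by
  have hat : 0 ≤ a * t := by positivity
  have hd : 0 < 1 + v + a * t := by positivity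
  have hd' : 0 < 1 + v' + a * t := by linarith
  have hq : (1 + v) / (1 + v + a * t) ≤ (1 + v') / (1 + v' + a * t) := by
    rw [div_le_div_iff₀ hd hd']; nlinarith
  have hp : 0 < (1 + v') / (1 + v' + a * t) := div_pos (by linarith) hd'
  calc decay a v t ≤ v * ((1 + v') / (1 + v' + a * t)) := mul_le_mul_of_nonneg_left hq hv
    _ < v' * ((1 + v') / (1 + v' + a * t)) := mul_lt_mul_of_pos_right h hp

theorem decay_strictAnti (ha : 0 < a) {v t t' : ℝ} (hv : 0 < v) (ht : 0 ≤ t) (h : t < t') :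
    decay a v t' < decay a v t := by
  have : a * t < a * t' := mul_lt_mul_of_pos_left h ha
  have h0 : 0 ≤ a * t := by positivity
  unfold decay
  gcongr

theorem tendsto_decay_atTop (ha : 0 < a) {t : ℝ} (ht : 0 ≤ t) :
    Tendsto (fun v => decay a v t) atTop atTop := by
  have hat : 0 ≤ a * t := by positivity
  refine tendsto_atTop_mono' _ ?_ (tendsto_id.atTop_div_const (show 0 < 1 + a * t by positivity))
  filter_upwards [eventually_ge_atTop 0] with v hv
  rw [decay, id, div_eq_mul_inv, ← one_div]
  refine mul_le_mul_of_nonneg_left ?_ hv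
  rw [div_le_div_iff₀ (by positivity) (by positivity)]
  nlinarith [mul_nonneg hv hat]

theorem tendsto_decay_zero (ha : 0 < a) (v : ℝ) : Tendsto (decay a v) atTop (𝓝 0) := by
  have h1 : Tendsto (fun t : ℝ => 1 + v + a * t) atTop atTop :=
    tendsto_atTop_add_const_left _ _ (tendsto_id.const_mul_atTop ha)
  have h2 : Tendsto (decay a v) atTop (𝓝 (v * 0)) := (h1.const_div_atTop (1 + v)).const_mul v
  rwa [mul_zero] at h2

theorem continuousOn_decay (ha : 0 < a) :
    ContinuousOn (fun p : ℝ × ℝ => decay a p.1 p.2) (Ici 0 ×ˢ Ici 0) := by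
  unfold decay
  refine continuousOn_fst.mul (ContinuousOn.div (by fun_prop) (by fun_prop) ?_)
  rintro ⟨v, t⟩ ⟨hv, ht⟩
  have hv : 0 ≤ v := hv
  have ht : 0 ≤ t := ht
  have : 0 < 1 + v + a * t := by positivity
  exact this.ne'

theorem classKL_comp_decay (ha : 0 < a) {γ α : ℝ → ℝ} (hγ : ClassKInf γ) (hα : ClassKInf α) :
    ClassKL fun r t => γ (decay a (α r) t) := by
  have hαn : ∀ r, 0 ≤ r → 0 ≤ α r := fun r hr => hα.1.nonneg hr
  have hdn : ∀ r t, 0 ≤ r → 0 ≤ t → 0 ≤ decay a (α r) t := fun r t hr ht =>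
    decay_nonneg ha (hαn r hr) ht
  refine ⟨?_, fun t ht => ⟨⟨?_, ?_, ?_⟩, ?_⟩, fun r hr t ht t' ht' htt' => ?_, fun r hr => ?_⟩
  · refine hγ.1.1.comp (f := fun p : ℝ × ℝ => decay a (α p.1) p.2) ?_
      fun p hp => hdn _ _ hp.1 hp.2
    refine (continuousOn_decay ha).comp (f := fun p : ℝ × ℝ => (α p.1, p.2)) ?_
      fun p hp => ⟨hαn _ hp.1, hp.2⟩
    exact (hα.1.1.comp continuousOn_fst fun p hp => hp.1).prodMk continuousOn_snd
  · refine hγ.1.1.comp (f := fun r => decay a (α r) t) ?_ fun r hr => hdn _ _ hr ht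
    exact (continuousOn_decay ha).comp (f := fun r => (α r, t)) (hα.1.1.prodMk continuousOn_const)
      fun r hr => ⟨hαn _ hr, ht⟩
  · intro r hr s hs hrs
    exact hγ.1.2.1 (hdn _ _ hr ht) (hdn _ _ hs ht)
      (decay_strictMono ha ht (hαn _ hr) (hα.1.2.1 hr hs hrs))
  · simp [decay, hα.1.2.2, hγ.1.2.2]
  · exact hγ.2.comp ((tendsto_decay_atTop ha ht).comp hα.2)
  · exact hγ.1.2.1 (hdn _ _ hr.le ht') (hdn _ _ hr.le ht)
      (decay_strictAnti ha (hα.1.pos hr) ht htt')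
  · have h1 : Tendsto (decay a (α r)) atTop (𝓝[Ici 0] 0) :=
      tendsto_nhdsWithin_iff.2 ⟨tendsto_decay_zero ha _, by
        filter_upwards [eventually_ge_atTop 0] with t ht using hdn _ _ hr ht⟩
    have h2 := (hγ.1.1 0 (mem_Ici.2 le_rfl)).tendsto.comp h1
    rwa [hγ.1.2.2] at h2

theorem ClassKL.nonneg {β : ℝ → ℝ → ℝ} (h : ClassKL β) {r s : ℝ} (hr : 0 ≤ r) (hs : 0 ≤ s) :
    0 ≤ β r s := (h.2.1 s hs).1.nonneg hr

theorem ClassKL.mono {β : ℝ → ℝ → ℝ} (h : ClassKL β) {r r' s : ℝ} (hr : 0 ≤ r) (hrr' : r ≤ r')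
    (hs : 0 ≤ s) : β r s ≤ β r' s :=
  (h.2.1 s hs).1.2.1.monotoneOn hr (hr.trans hrr') hrr'

theorem ClassKL.anti {β : ℝ → ℝ → ℝ} (h : ClassKL β) {r s : ℝ} (hr : 0 ≤ r) (hs : 0 ≤ s) :
    β r s ≤ β r 0 := by
  rcases hr.eq_or_lt with rfl | hr
  · exact ((h.2.1 s hs).1.2.2.trans (h.2.1 0 le_rfl).1.2.2.symm).le
  · exact (h.2.2.1 r hr).antitoneOn (mem_Ici.2 le_rfl) hs hs

theorem ClassKL.betaTilde {β : ℝ → ℝ → ℝ} (h : ClassKL β) : ClassKL (betaTilde β) := by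
  have h3 : ∀ r : ℝ, 0 ≤ r → 0 ≤ 3 * r := fun r hr => by positivity
  unfold SecondOrderAveraging.betaTilde
  refine ⟨?_, fun s hs => ⟨⟨?_, ?_, ?_⟩, ?_⟩, fun r hr s hs s' hs' hss' => ?_, fun r hr => ?_⟩
  · refine continuousOn_const.mul (h.1.comp (f := fun p : ℝ × ℝ => (3 * p.1, p.2)) (by fun_prop)
      fun p hp => ⟨h3 _ hp.1, hp.2⟩)
  · exact continuousOn_const.mul ((h.2.1 s hs).1.1.comp (f := fun r => 3 * r) (by fun_prop)
      fun r hr => h3 r hr)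
  · intro r hr r' hr' hrr'
    exact mul_lt_mul_of_pos_left ((h.2.1 s hs).1.2.1 (h3 r hr) (h3 r' hr') (by linarith)) two_pos
  · simp only [mul_zero, (h.2.1 s hs).1.2.2]
  · exact ((h.2.1 s hs).2.comp (tendsto_id.const_mul_atTop three_pos)).const_mul_atTop two_pos
  · exact mul_lt_mul_of_pos_left (h.2.2.1 (3 * r) (by positivity) hs hs' hss') two_pos
  · simpa using (h.2.2.2 (3 * r) (h3 r hr)).const_mul 2

end Comparison

/-! ### From uniform decrease of a Lyapunov function to ultimate bounds. -/

section Lyapunov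

variable {n : ℕ}

/-- A function that decreases at rate `a` as long as it exceeds `c`. -/
theorem le_or_le_of_deriv_le {m m' : ℝ → ℝ} {a c t : ℝ} (ha : 0 < a) (ht : 0 ≤ t)
    (hd : ∀ s ∈ Icc 0 t, HasDerivWithinAt m (m' s) (Icc 0 t) s)
    (hm : ∀ s ∈ Icc 0 t, c < m s → m' s ≤ -a) : m t ≤ c ∨ m t ≤ m 0 - a * t := by
  have hc : ContinuousOn m (Icc 0 t) := fun s hs => (hd s hs).continuousWithinAt
  have key : ∀ s ∈ Icc 0 t, (∀ r ∈ Ioo s t, c < m r) → m t ≤ m s - a * (t - s) := by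
    intro s hs hr
    have hsub : Icc s t ⊆ Icc 0 t := Icc_subset_Icc_left hs.1
    have hda : ∀ r ∈ Ioo s t, HasDerivAt m (m' r) r := fun r hr =>
      (hd r (hsub (Ioo_subset_Icc_self hr))).hasDerivAt
        (Icc_mem_nhds (hs.1.trans_lt hr.1) hr.2)
    have := (convex_Icc s t).image_sub_le_mul_sub_of_deriv_le (f := m) (C := -a) (hc.mono hsub)
      (by
        rw [interior_Icc]
        exact fun r hr => (hda r hr).differentiableAt.differentiableWithinAt)
      (by
        rw [interior_Icc]
        intro r hr'
        rw [(hda r hr').deriv]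
        exact hm r (hsub (Ioo_subset_Icc_self hr')) (hr r hr'))
      s ⟨le_rfl, hs.2⟩ t ⟨hs.2, le_rfl⟩ hs.2
    linarith
  by_contra! hcon
  obtain ⟨h1, h2⟩ := hcon
  -- After the last time at which m ≤ c the function only decreases, so it cannot end above c; if
  -- there is no such time, the decrease lasts all along [0,t].
  set S := {s ∈ Icc 0 t | m s ≤ c} with hS
  have hScl : IsCompact S :=
    isCompact_Icc.of_isClosed_subset (hc.preimage_isClosed_of_isClosed isClosed_Icc isClosed_Iic)
      fun s hs => hs.1
  rcases S.eq_empty_or_nonempty with hE | hne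
  · have := key 0 ⟨le_rfl, ht⟩ fun r hr => by
      by_contra hle
      have : r ∈ S := ⟨Ioo_subset_Icc_self hr, not_lt.1 hle⟩
      rw [hE] at this
      exact this
    rw [sub_zero] at this
    linarith
  · obtain ⟨s, hs, hmax⟩ := hScl.exists_isGreatest hne
    have := key s hs.1 fun r hr => by
      by_contra hle
      exact absurd (hmax (show r ∈ S from ⟨⟨hs.1.1.trans hr.1.le, hr.2.le⟩, not_lt.1 hle⟩))
        (not_le.2 hr.1)
    have h3 := hs.2
    have : 0 ≤ a * (t - s) := mul_nonneg ha.le (sub_nonneg.2 hs.1.2)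
    linarith

theorem hasDerivWithinAt_comp_gradient {V : Euc n → ℝ} (hV : ContDiff ℝ 1 V) {x : ℝ → Euc n}
    {x' : Euc n} {s : Set ℝ} {t : ℝ} (hx : HasDerivWithinAt x x' s t) :
    HasDerivWithinAt (fun r => V (x r)) (inner ℝ (gradient V (x t)) x') s t := by
  have h1 := ((hV.differentiable (by simp)) (x t)).hasGradientAt.hasFDerivAt
  have h2 := h1.comp_hasDerivWithinAt t hx
  rwa [InnerProductSpace.toDual_apply_apply] at h2

/-- A Lyapunov function that decreases uniformly outside a ball gives a uniform ultimate bound. -/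
theorem exists_ultimateBound_of_lyapunov {V : Euc n → ℝ} (hV : ContDiff ℝ 1 V)
    {α₁ α₂ : ℝ → ℝ} (hα₁ : ClassKInf α₁) (hα₂ : ClassKInf α₂)
    (hVα : ∀ x, α₁ ‖x‖ ≤ V x ∧ V x ≤ α₂ ‖x‖) {R a : ℝ} (hR : 0 < R) (ha : 0 < a) :
    ∃ (β : ℝ → ℝ → ℝ) (Δ : ℝ), ClassKL β ∧ 0 < Δ ∧ ∀ (F : Euc n → ℝ → Euc n) (ε : ℝ),
      ContinuousOn (fun q : Euc n × ℝ => F q.1 q.2) (univ ×ˢ Ici 0) →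
      (∀ x ∈ outside n R, ∀ τ, 0 ≤ τ → inner ℝ (gradient V x) (F x τ) ≤ -a) →
      UltimateBound F ε β Δ := by
  obtain ⟨γ, hγ, hγα, hαγ⟩ := hα₁.exists_inverse
  have hc : 0 < α₂ R := hα₂.1.pos hR
  have hKL := classKL_comp_decay ha hγ hα₂
  -- Both comparison data are fixed before the field and ε, hence uniform. The level α₂(R) is used
  -- because V above it forces |x| ≥ R.
  refine ⟨fun r t => γ (decay a (α₂ r) t), γ (α₂ R), hKL,
    hγ.1.pos hc, fun F ε hF hdec x₀ τ₀ hτ₀ ts x τ => ?_⟩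
  have hbound : IsSolution F ε x₀ τ₀ ts x τ → ∀ t ∈ timeDom ts,
      ‖x t‖ ≤ γ (decay a (α₂ ‖x₀‖) t) + γ (α₂ R) := by
    intro h t ht
    have hsub := Icc_subset_timeDom ht
    have hle := le_or_le_of_deriv_le (c := α₂ R) ha ht.1
      (m := fun s => V (x s))
      (m' := fun s => inner ℝ (gradient V (x s)) (F (x s) (τ s)))
      (fun s hs => hasDerivWithinAt_comp_gradient hV ((h.deriv_x s (hsub hs)).mono hsub))
      (fun s hs hlt => hdec _ (by
        by_contra hnot
        have hlt' : ‖x s‖ < R := not_le.1 hnot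
        have := hα₂.1.2.1.monotoneOn (norm_nonneg (x s)) hR.le hlt'.le
        exact absurd (hlt.trans_le ((hVα _).2.trans this)) (lt_irrefl _)) _
        (h.tau_nonneg s (hsub hs)))
    have hα : ∀ v, 0 ≤ v → V (x t) ≤ v → ‖x t‖ ≤ γ v := fun v hv hVv => by
      rw [← hγα ‖x t‖ (norm_nonneg _)]
      exact hγ.1.2.1.monotoneOn (hα₁.1.nonneg (norm_nonneg _)) hv ((hVα _).1.trans hVv)
    have h0 := hα₂.1.nonneg (norm_nonneg x₀)
    have hdn := decay_nonneg ha h0 ht.1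
    rcases hle with hle | hle
    · exact (hα _ hc.le hle).trans (le_add_of_nonneg_left (hγ.1.nonneg hdn))
    · refine (hα _ hdn ?_).trans (le_add_of_nonneg_right (hγ.1.nonneg hc.le))
      refine hle.trans (le_trans ?_ (sub_le_decay ha h0 ht.1))
      rw [h.init_x]
      exact sub_le_sub_right (hVα x₀).2 _
  refine ⟨hbound, fun h => h.complete hF (B := γ (decay a (α₂ ‖x₀‖) 0) + γ (α₂ R))
    fun t ht => (hbound h.1 t ht).trans ?_⟩
  exact add_le_add (hKL.anti (norm_nonneg x₀) ht.1) le_rfl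

end Lyapunov

/-! ### Correctors of the truncated fields -/

section Construction

open MeasureTheory

variable {n : ℕ}

theorem continuousOn_hat {δ₁ δ₂ : ℝ} (h₁ : 0 ≤ δ₁) {f : Euc n → ℝ → Euc n}
    (hc : ContinuousOn (fun p : Euc n × ℝ => f p.1 p.2) (univ ×ˢ Ici 0)) :
    ContinuousOn (fun p : Euc n × ℝ => hat δ₁ δ₂ f p.1 p.2) (univ ×ˢ Ici 0) :=
  ((contDiff_bump h₁ 0).continuous.comp continuous_fst).continuousOn.smul hc

/-- The slow field minus its average is a periodic field of mean zero; its primitive is v₂ for τ ≥ 0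
and inherits every property required. `K` is the sum of all constants involved, plus 1 for
positivity. -/
theorem exists_correctors_of_periodic {h₁ h₂ : Euc n → ℝ → Euc n} {T K₁ K₂ K₃ : ℝ}
    (H₁ : PeriodicField h₁ T K₁) (H₂ : PeriodicField h₂ T K₂) (h0 : ∀ x, v₁ h₁ x T = 0)
    (hsm : ∀ τ, 0 ≤ τ → ContDiff ℝ 2 (fun x => h₁ x τ)) (hK₃ : 0 ≤ K₃)
    (hlip : ∀ r s, 0 ≤ r → 0 ≤ s → ∀ x y,
      ‖Dx h₁ x r (h₁ x s) - Dx h₁ y r (h₁ y s)‖ ≤ K₃ * ‖x - y‖) :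
    ∃ K, Correctors h₁ h₂ (v₁ h₁) (v₂ T h₁ h₂) (average T h₁ h₂) K := by
  have hT := H₁.period_pos
  have HS : PeriodicField (slow h₁ h₂) T (K₂ + T * K₃) := H₂.sub (H₁.drift h0 hsm hK₃ hlip)
  set Ks := K₂ + T * K₃ with hKs
  have havg := average_eq H₁ h0 H₂
  have hal : ∀ x y, ‖average T h₁ h₂ x - average T h₁ h₂ y‖ ≤ Ks * ‖x - y‖ := by
    intro x y
    rw [havg, havg, ← smul_sub, norm_smul, norm_inv, Real.norm_of_nonneg hT.le,
      inv_mul_le_iff₀ hT, ← mul_assoc]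
    exact HS.primitive_lipschitz hT.le x y
  have hac : ContDiff ℝ 1 (average T h₁ h₂) := by
    have e : average T h₁ h₂ = fun x => T⁻¹ • v₁ (slow h₁ h₂) x T := funext havg
    rw [e]
    exact (contDiff_parametric hT.le HS.const_nonneg
      (fun x => HS.intervalIntegrable x le_rfl hT.le) (fun r hr => HS.lip r hr.1)
      (fun r hr => HS.smooth r hr.1)).const_smul T⁻¹
  have HA : PeriodicField (fun x _ => average T h₁ h₂ x) T Ks :=
    ⟨hT, HS.const_nonneg, (hac.continuous.comp continuous_fst).continuousOn, fun _ _ => hal,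
      fun _ _ _ => rfl, fun _ _ => hac⟩
  have HD : PeriodicField (slowDev T h₁ h₂) T (Ks + Ks) := HS.sub HA
  have hD0 : ∀ x, v₁ (slowDev T h₁ h₂) x T = 0 := by
    intro x
    have e : v₁ (slowDev T h₁ h₂) x T = v₁ (slow h₁ h₂) x T -
        ∫ _ in (0 : ℝ)..T, average T h₁ h₂ x :=
      intervalIntegral.integral_sub (HS.intervalIntegrable x le_rfl hT.le)
        intervalIntegrable_const
    rw [e, intervalIntegral.integral_const, sub_zero, havg, smul_smul,
      mul_inv_cancel₀ hT.ne', one_smul, sub_self]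
  have HV := H₁.primitive h0
  have HW := HD.primitive hD0
  have ev : ∀ x τ, 0 ≤ τ → v₂ T h₁ h₂ x τ = v₁ (slowDev T h₁ h₂) x τ :=
    fun x τ hτ => v₂_eq H₁ H₂ x hτ
  have evf : ∀ τ, 0 ≤ τ → (fun x => v₂ T h₁ h₂ x τ) = fun x => v₁ (slowDev T h₁ h₂) x τ :=
    fun τ hτ => funext fun x => ev x τ hτ
  obtain ⟨C₁, hC₁, hC₁'⟩ := H₁.norm_zero_le
  obtain ⟨C₂, hC₂, hC₂'⟩ := H₂.norm_zero_le
  obtain ⟨C₃, hC₃, hC₃'⟩ := HV.norm_zero_le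
  obtain ⟨C₄, hC₄, hC₄'⟩ := HW.norm_zero_le
  have p1 := H₁.const_nonneg
  have p2 := H₂.const_nonneg
  have p3 := HV.const_nonneg
  have p4 := HW.const_nonneg
  have p5 := HS.const_nonneg
  set K := 1 + C₁ + C₂ + C₃ + C₄ + K₁ + K₂ + T * K₁ + T * (Ks + Ks) + Ks with hK
  have growth : ∀ {h : Euc n → ℝ → Euc n} {C L : ℝ}, C ≤ K → L ≤ K →
      (∀ τ, 0 ≤ τ → ‖h 0 τ‖ ≤ C) → (∀ τ, 0 ≤ τ → ∀ x y, ‖h x τ - h y τ‖ ≤ L * ‖x - y‖) →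
      ∀ x τ, 0 ≤ τ → ‖h x τ‖ ≤ K * (1 + ‖x‖) := by
    intro h C L hCK hLK hz hl x τ hτ
    have h1 := hl τ hτ x 0
    rw [sub_zero] at h1
    have h2 := norm_sub_norm_le (h x τ) (h 0 τ)
    have h3 := hz τ hτ
    have h4 := mul_le_mul_of_nonneg_right hLK (norm_nonneg x)
    linarith
  refine ⟨K, ⟨by positivity, H₁.cont, H₂.cont,
    growth (by linarith) (by linarith) hC₁' H₁.lip,
    growth (by linarith) (by linarith) hC₂' H₂.lip,
    fun x y => (hal x y).trans (mul_le_mul_of_nonneg_right (by linarith) (norm_nonneg _)),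
    HV.cont, HW.cont.congr fun q hq => ev q.1 q.2 hq.2,
    fun τ hτ => (hC₃' τ hτ).trans (by linarith),
    fun τ hτ => by rw [ev 0 τ hτ]; exact (hC₄' τ hτ).trans (by linarith),
    fun τ hτ x y => (HV.lip τ hτ x y).trans
      (mul_le_mul_of_nonneg_right (by linarith) (norm_nonneg _)),
    fun τ hτ x y => by
      rw [ev x τ hτ, ev y τ hτ]
      exact (HW.lip τ hτ x y).trans (mul_le_mul_of_nonneg_right (by linarith) (norm_nonneg _)),
    fun τ hτ => (HV.smooth τ hτ).differentiable (by simp),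
    fun τ hτ => by rw [evf τ hτ]; exact (HW.smooth τ hτ).differentiable (by simp),
    H₁.continuousOn_Dx_primitive,
    HD.continuousOn_Dx_primitive.congr fun q hq => by simp only [Dx, evf q.2 hq.2],
    fun x τ hτ => H₁.hasDerivWithinAt_primitive x hτ, fun x τ hτ => ?_⟩⟩
  have := (HD.hasDerivWithinAt_primitive x hτ).congr (fun σ hσ => ev x σ hσ) (ev x τ hτ)
  exact this

theorem Regular.exists_correctors {f₁ f₂ : Euc n → ℝ → Euc n} {δ₁ δ₂ δ₃ T e : ℝ}
    (hreg : Regular f₁ f₂ δ₁ T) (he : 0 < e) (hδ : Deltas e δ₁ δ₂ δ₃) :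
    ∃ K, Correctors (hat δ₁ δ₂ f₁) (hat δ₁ δ₂ f₂) (v₁ (hat δ₁ δ₂ f₁))
      (v₂ T (hat δ₁ δ₂ f₁) (hat δ₁ δ₂ f₂)) (fbar δ₁ δ₂ T f₁ f₂) K := by
  have h0 := hreg.delta_nonneg
  have h12 := hδ.le he
  have hor := hδ.lt_or_eq he
  have hT := hreg.period_pos
  obtain ⟨K₁, hK₁, hl₁⟩ := hat_lipschitz h0 h12 hor hT hreg.cont₁ hreg.periodic₁ hreg.lip₁
  obtain ⟨K₂, hK₂, hl₂⟩ := hat_lipschitz h0 h12 hor hT hreg.cont₂ hreg.periodic₂ hreg.lip₂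
  obtain ⟨K₃, hK₃, hl₃⟩ := Dx_hat_hat_lipschitz h0 h12 hor hT hreg.cont₁ hreg.periodic₁
    hreg.lip₁ hreg.smooth₁ hreg.lip₃
  have hs₁ : ∀ τ, 0 ≤ τ → ContDiff ℝ 2 (fun x => hat δ₁ δ₂ f₁ x τ) :=
    fun τ hτ => contDiff_hat h0 hor hreg.smooth₁ hτ
  have H₁ : PeriodicField (hat δ₁ δ₂ f₁) T K₁ :=
    ⟨hT, hK₁, continuousOn_hat h0 hreg.cont₁, hl₁,
      fun x τ hτ => by simp only [hat, hreg.periodic₁ x τ hτ],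
      fun τ hτ => (hs₁ τ hτ).of_le (by norm_num)⟩
  have H₂ : PeriodicField (hat δ₁ δ₂ f₂) T K₂ :=
    ⟨hT, hK₂, continuousOn_hat h0 hreg.cont₂, hl₂,
      fun x τ hτ => by simp only [hat, hreg.periodic₂ x τ hτ],
      fun τ hτ => contDiff_hat h0 hor hreg.smooth₂ hτ⟩
  refine exists_correctors_of_periodic H₁ H₂ (fun x => ?_) hs₁ hK₃ hl₃
  simp only [v₁, hat, intervalIntegral.integral_smul, hreg.zero_mean x, smul_zero]

theorem Ψ_eq_nearId (δ₁ δ₂ T : ℝ) (f₁ f₂ : Euc n → ℝ → Euc n) :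
    Ψ δ₁ δ₂ T f₁ f₂ = nearId (v₁ (hat δ₁ δ₂ f₁)) (v₂ T (hat δ₁ δ₂ f₁) (hat δ₁ δ₂ f₂)) := rfl

end Construction

/-! ### Independence of the truncation away from the origin -/

section Locality

variable {n : ℕ} {h₁ h₂ h₁' h₂' : Euc n → ℝ → Euc n} {O : Set (Euc n)}

theorem Dx_congr (hO : IsOpen O) (h : ∀ y ∈ O, ∀ τ, h₁ y τ = h₁' y τ) {y : Euc n} (hy : y ∈ O)
    (τ : ℝ) : Dx h₁ y τ = Dx h₁' y τ := by
  refine Filter.EventuallyEq.fderiv_eq ?_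
  filter_upwards [hO.mem_nhds hy] with z hz using h z hz τ

theorem v₁_congr (h : ∀ y ∈ O, ∀ τ, h₁ y τ = h₁' y τ) : ∀ y ∈ O, ∀ τ, v₁ h₁ y τ = v₁ h₁' y τ := by
  intro y hy τ
  simp only [v₁, h y hy]

theorem average_congr (hO : IsOpen O) (h : ∀ y ∈ O, ∀ τ, h₁ y τ = h₁' y τ)
    (h' : ∀ y ∈ O, ∀ τ, h₂ y τ = h₂' y τ) (T : ℝ) {y : Euc n} (hy : y ∈ O) :
    average T h₁ h₂ y = average T h₁' h₂' y := by
  simp only [average, bracket, h y hy, h' y hy, Dx_congr hO h hy, v₁_congr h y hy,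
    Dx_congr hO (v₁_congr h) hy]

theorem v₂_congr (hO : IsOpen O) (h : ∀ y ∈ O, ∀ τ, h₁ y τ = h₁' y τ)
    (h' : ∀ y ∈ O, ∀ τ, h₂ y τ = h₂' y τ) (T : ℝ) :
    ∀ y ∈ O, ∀ τ, v₂ T h₁ h₂ y τ = v₂ T h₁' h₂' y τ := by
  intro y hy τ
  simp only [v₂, w, average_congr hO h h' T hy, h' y hy, Dx_congr hO h hy, v₁_congr h y hy,
    Dx_congr hO (v₁_congr h) hy]

theorem nearId_congr (hO : IsOpen O) (h : ∀ y ∈ O, ∀ τ, h₁ y τ = h₁' y τ)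
    (h' : ∀ y ∈ O, ∀ τ, h₂ y τ = h₂' y τ) (T ε : ℝ) {y : Euc n} (hy : y ∈ O) (τ : ℝ) :
    nearId (v₁ h₁) (v₂ T h₁ h₂) ε (y, τ) = nearId (v₁ h₁') (v₂ T h₁' h₂') ε (y, τ) := by
  simp only [nearId, v₁_congr h y hy, v₂_congr hO h h' T y hy]

/-- The transformed field depends on the corrected fields only near the preimage. -/
theorem pushforward_congr {T K K' ε : ℝ} {p p' : Euc n → Euc n}
    (D : Correctors h₁ h₂ (v₁ h₁) (v₂ T h₁ h₂) p K)
    (D' : Correctors h₁' h₂' (v₁ h₁') (v₂ T h₁' h₂') p' K') (hε : 0 < ε) (hε1 : ε ≤ 1)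
    (hεK : 4 * K * ε ≤ 1) (hεK' : 4 * K' * ε ≤ 1) (hO : IsOpen O)
    (h : ∀ y ∈ O, ∀ τ, h₁ y τ = h₁' y τ) (h' : ∀ y ∈ O, ∀ τ, h₂ y τ = h₂' y τ)
    (F : Euc n → ℝ → Euc n) {x : Euc n} {τ : ℝ} (hτ : 0 ≤ τ)
    (hy : (phaseInv (nearId (v₁ h₁) (v₂ T h₁ h₂) ε) (x, τ)).1 ∈ O) :
    pushforward (nearId (v₁ h₁) (v₂ T h₁ h₂) ε) F ε x τ
      = pushforward (nearId (v₁ h₁') (v₂ T h₁' h₂') ε) F ε x τ := by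
  obtain ⟨e1, e2⟩ := D.phaseInv_spec hε hε1 hεK x hτ
  set y := (phaseInv (nearId (v₁ h₁) (v₂ T h₁ h₂) ε) (x, τ)).1 with hydef
  -- The two maps agree at `y`, so injectivity of the second makes `y` its preimage as well.
  have e3 : phaseInv (nearId (v₁ h₁') (v₂ T h₁' h₂') ε) (x, τ) = (y, τ) := by
    rw [nearId_congr hO h h' T ε hy τ] at e2
    rw [← e2, D'.phaseInv_apply hε hε1 hεK' y hτ]
  have e4 : fderiv ℝ (fun z => (nearId (v₁ h₁) (v₂ T h₁ h₂) ε (z, τ)).1) y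
      = fderiv ℝ (fun z => (nearId (v₁ h₁') (v₂ T h₁' h₂') ε (z, τ)).1) y := by
    refine Filter.EventuallyEq.fderiv_eq ?_
    filter_upwards [hO.mem_nhds hy] with z hz
    rw [nearId_congr hO h h' T ε hz τ]
  have e5 : (fun σ => (nearId (v₁ h₁) (v₂ T h₁ h₂) ε (y, σ)).1)
      = fun σ => (nearId (v₁ h₁') (v₂ T h₁' h₂') ε (y, σ)).1 :=
    funext fun σ => by rw [nearId_congr hO h h' T ε hy σ]
  simp only [pushforward, e1, e3, e4, e5]

theorem hat_congr {δ₁ δ₂ δ₂' : ℝ} (f : Euc n → ℝ → Euc n) :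
    ∀ y ∈ {y : Euc n | max δ₂ δ₂' < ‖y‖}, ∀ τ, hat δ₁ δ₂ f y τ = hat δ₁ δ₂' f y τ := by
  intro y hy τ
  rw [hat, hat, bump_eq_one ((le_max_left _ _).trans (le_of_lt hy)),
    bump_eq_one ((le_max_right _ _).trans (le_of_lt hy))]

end Locality

/-! ### Transfer of ultimate bounds -/

section Transfer

variable {n : ℕ}

theorem UltimateBound.mono {F : Euc n → ℝ → Euc n} {ε Δ Δ' : ℝ} {β : ℝ → ℝ → ℝ}
    (h : UltimateBound F ε β Δ) (hΔ : Δ ≤ Δ') : UltimateBound F ε β Δ' :=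
  fun x₀ τ₀ hτ₀ ts x τ => ⟨fun hs t ht => ((h x₀ τ₀ hτ₀ ts x τ).1 hs t ht).trans
    (add_le_add le_rfl hΔ), (h x₀ τ₀ hτ₀ ts x τ).2⟩

/-- With L = 4K, the image of the initial point has norm at most Lε + 2|x₀|, so at most 3|x₀| or 3Lε
according to which of |x₀| and Lε is larger. Bounding β at the maximum by the sum, and returning
through the inverse with factor 1 + Lε ≤ 2 on the |x₀| term, gives the modified bounds. -/
theorem Correctors.ultimateBound_of_pushforward {h₁ h₂ V W : Euc n → ℝ → Euc n}
    {p : Euc n → Euc n} {K ε Δ : ℝ} {β : ℝ → ℝ → ℝ} (D : Correctors h₁ h₂ V W p K) (hε : 0 < ε)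
    (hε1 : ε ≤ 1) (hεK : 4 * K * ε ≤ 1) {F : Euc n → ℝ → Euc n}
    (hF : ContinuousOn (fun q : Euc n × ℝ => F q.1 q.2) (univ ×ˢ Ici 0)) (hβ : ClassKL β)
    (h : UltimateBound (pushforward (nearId V W ε) F ε) ε β Δ) :
    UltimateBound F ε (betaTilde β) (deltaTilde (4 * K) Δ β ε) := by
  have hKε : 0 < 4 * K * ε := by have := D.pos; positivity
  intro x₀ τ₀ hτ₀ ts x τ
  have hbound : IsSolution F ε x₀ τ₀ ts x τ → ∀ t ∈ timeDom ts,
      ‖x t‖ ≤ betaTilde β ‖x₀‖ t + deltaTilde (4 * K) Δ β ε := by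
    intro hs t ht
    set y₀ := (nearId V W ε (x₀, τ₀)).1 with hy₀
    have hτ := hs.tau_nonneg t ht
    have h1 := (h y₀ τ₀ hτ₀ ts _ τ).1 (D.isSolution_pushforward hε hε1 hεK hF hs) t ht
    set y := (nearId V W ε (x t, τ t)).1 with hy
    have h2 : ‖x t‖ ≤ 4 * K * ε + (1 + 4 * K * ε) * ‖y‖ := by
      have e1 := D.phaseInv_lipschitz hε hε1 hεK hτ y 0
      rw [hy, D.phaseInv_apply hε hε1 hεK _ hτ, ← hy, sub_zero] at e1
      have e2 := D.phaseInv_zero hε hε1 hεK hτ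
      have e3 := norm_sub_norm_le (x t) (phaseInv (nearId V W ε) (0, τ t)).1
      simp only at e1
      linarith
    have h3 : ‖y₀‖ ≤ 4 * K * ε + 2 * ‖x₀‖ := by
      have e1 := D.nearId_lipschitz hε hε1 hτ₀ x₀ 0
      rw [sub_zero, ← hy₀] at e1
      have e2 := D.nearId_zero hε hε1 hτ₀
      have e3 := norm_sub_norm_le y₀ (nearId V W ε (0, τ₀)).1
      have e4 := norm_nonneg x₀
      nlinarith
    have hx0 := norm_nonneg x₀
    have h4 : β ‖y₀‖ t ≤ β (3 * ‖x₀‖) t + β (3 * (4 * K) * ε) 0 := by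
      have n1 : 0 ≤ β (3 * ‖x₀‖) t := hβ.nonneg (by positivity) ht.1
      have n2 : 0 ≤ β (3 * (4 * K) * ε) 0 := hβ.nonneg (by linarith) le_rfl
      rcases le_total (4 * K * ε) ‖x₀‖ with hle | hle
      · have := hβ.mono (norm_nonneg y₀) (show ‖y₀‖ ≤ 3 * ‖x₀‖ by linarith) ht.1
        linarith
      · have := hβ.mono (norm_nonneg y₀) (show ‖y₀‖ ≤ 3 * (4 * K) * ε by linarith) ht.1
        have := hβ.anti (r := 3 * (4 * K) * ε) (by linarith) ht.1
        linarith
    have h5 : ‖y‖ ≤ β (3 * ‖x₀‖) t + β (3 * (4 * K) * ε) 0 + Δ := by linarith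
    have h6 : (1 + 4 * K * ε) * ‖y‖ ≤
        (1 + 4 * K * ε) * (β (3 * ‖x₀‖) t + β (3 * (4 * K) * ε) 0 + Δ) := by gcongr
    have h7 : (1 + 4 * K * ε) * β (3 * ‖x₀‖) t ≤ 2 * β (3 * ‖x₀‖) t :=
      mul_le_mul_of_nonneg_right (by linarith) (hβ.nonneg (by positivity) ht.1)
    unfold betaTilde deltaTilde
    linarith
  refine ⟨hbound, fun hm => hm.complete hF
    (B := betaTilde β ‖x₀‖ 0 + deltaTilde (4 * K) Δ β ε) fun t ht => (hbound hm.1 t ht).trans ?_⟩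
  exact add_le_add (hβ.betaTilde.anti (norm_nonneg x₀) ht.1) le_rfl

end Transfer

/-! ### The main estimate -/

section Main

variable {n : ℕ} {f₁ f₂ : Euc n → ℝ → Euc n} {δ₁ δ₂ δ₂' T : ℝ}

theorem Regular.continuousOn_oscField (hreg : Regular f₁ f₂ δ₁ T) (ε : ℝ) :
    ContinuousOn (fun q : Euc n × ℝ => oscField f₁ f₂ ε q.1 q.2) (univ ×ˢ Ici 0) :=
  (hreg.cont₁.const_smul ε⁻¹).add hreg.cont₂

theorem hat_eq_of_le {f : Euc n → ℝ → Euc n} {y : Euc n} (hy : δ₂ ≤ ‖y‖) (τ : ℝ) :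
    hat δ₁ δ₂ f y τ = f y τ := by
  rw [hat, bump_eq_one hy, one_smul]

/-- Far from the origin the preimage under the near-identity map stays far from the origin. -/
theorem Correctors.lt_norm_phaseInv {h₁ h₂ V W : Euc n → ℝ → Euc n} {p : Euc n → Euc n}
    {K ε R : ℝ} (D : Correctors h₁ h₂ V W p K) (hε : 0 < ε) (hε1 : ε ≤ 1) (hεK : 4 * K * ε ≤ 1)
    (hR : 1 ≤ R) (hRε : 8 * K * R * ε < 1) {x : Euc n} (hx : R ≤ ‖x‖) {τ : ℝ} (hτ : 0 ≤ τ) :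
    R - 1 < ‖(phaseInv (nearId V W ε) (x, τ)).1‖ := by
  have h1 := D.phaseInv_sub_le hε hε1 hεK x hτ
  rw [norm_sub_rev] at h1
  have h2 := norm_sub_norm_le x (phaseInv (nearId V W ε) (x, τ)).1
  have hc : 0 < K * ε := mul_pos D.pos hε
  -- As |x| ≥ 1, the preimage has norm at least (1 - 8Kε)|x| ≥ R - 8KRε > R - 1.
  have h3 : 4 * K * ε * (1 + ‖x‖) ≤ 8 * (K * ε) * ‖x‖ := by nlinarith
  have h4 : 8 * (K * ε) ≤ 1 := by nlinarith
  have h5 : (1 - 8 * (K * ε)) * R ≤ (1 - 8 * (K * ε)) * ‖x‖ := by gcongr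
  nlinarith

/-- For large `x` and small `ε` the transformed field is a perturbation, of size `ε φ(x)`, of the
average field of any other truncation. -/
theorem exists_pushedField_sub_le {K K' R A : ℝ}
    (D : Correctors (hat δ₁ δ₂ f₁) (hat δ₁ δ₂ f₂) (v₁ (hat δ₁ δ₂ f₁))
      (v₂ T (hat δ₁ δ₂ f₁) (hat δ₁ δ₂ f₂)) (fbar δ₁ δ₂ T f₁ f₂) K)
    (D' : Correctors (hat δ₁ δ₂' f₁) (hat δ₁ δ₂' f₂) (v₁ (hat δ₁ δ₂' f₁))
      (v₂ T (hat δ₁ δ₂' f₁) (hat δ₁ δ₂' f₂)) (fbar δ₁ δ₂' T f₁ f₂) K')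
    {δ₃ : ℝ} {φ : Euc n → ℝ} (hR : 1 ≤ R) (h2 : δ₂ ≤ R - 1) (h2' : δ₂' ≤ R - 1) (h3 : δ₃ ≤ R)
    (hA : 0 < A) (hφ : ∀ x : Euc n, R ≤ ‖x‖ → A ≤ φ x)
    (hcase : (∃ ε₀ > 0, ∃ Lg > 0, ∀ x ∈ outside n δ₃, ∀ τ, 0 ≤ τ → ∀ ε ∈ Ioc 0 ε₀,
        ‖remainder δ₁ δ₂' T f₁ f₂ x τ ε‖ ≤ Lg * (φ x + 1)) ∨
      (∃ α₃ : ℝ → ℝ, ClassK α₃ ∧ ∀ x, α₃ ‖x‖ * ‖x‖ ≤ φ x)) :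
    ∃ M ε₁, 0 ≤ M ∧ 0 < ε₁ ∧ ∀ ε ∈ Ioo 0 ε₁, ε ≤ 1 → 4 * K * ε ≤ 1 → 4 * K' * ε ≤ 1 →
      8 * K * R * ε < 1 → ∀ x : Euc n, R ≤ ‖x‖ → ∀ τ, 0 ≤ τ →
      ‖pushedField δ₁ δ₂ T f₁ f₂ ε x τ - fbar δ₁ δ₂' T f₁ f₂ x‖ ≤ ε * M * φ x := by
  have hO : IsOpen {y : Euc n | max δ₂ δ₂' < ‖y‖} := isOpen_lt continuous_const continuous_norm
  have hmax : max δ₂ δ₂' ≤ R - 1 := max_le h2 h2'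
  rcases hcase with ⟨ε₀, hε₀, Lg, hLg, hg⟩ | ⟨α₃, hα₃, hαφ⟩
  -- The pushed fields of both truncations coincide here, so the assumed remainder bound applies; φ
  -- ≥ A turns φ + 1 into a multiple of φ.
  · refine ⟨Lg * (1 + 1 / A), ε₀, by positivity, hε₀, ?_⟩
    intro ε hε hε1 hεK hεK' hεR x hx τ hτ
    have hfar := D.lt_norm_phaseInv hε.1 hε1 hεK hR hεR hx hτ
    have e : pushedField δ₁ δ₂ T f₁ f₂ ε x τ = pushedField δ₁ δ₂' T f₁ f₂ ε x τ :=
      pushforward_congr D D' hε.1 hε1 hεK hεK' hO (hat_congr f₁) (hat_congr f₂) _ hτ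
        (hmax.trans_lt hfar)
    have e' : pushedField δ₁ δ₂' T f₁ f₂ ε x τ - fbar δ₁ δ₂' T f₁ f₂ x
        = ε • remainder δ₁ δ₂' T f₁ f₂ x τ ε := by
      rw [remainder, smul_smul, mul_inv_cancel₀ hε.1.ne', one_smul]
    rw [e, e', norm_smul, Real.norm_of_nonneg hε.1.le, mul_assoc]
    refine mul_le_mul_of_nonneg_left ?_ hε.1.le
    refine (hg x (h3.trans hx) τ hτ ε ⟨hε.1, hε.2.le⟩).trans ?_
    rw [mul_assoc]
    refine mul_le_mul_of_nonneg_left ?_ hLg.le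
    have : 1 ≤ 1 / A * φ x := by
      rw [one_div, le_inv_mul_iff₀ hA, mul_one]; exact hφ x hx
    linarith
  · have hα := hα₃.pos (show 0 < R by linarith)
    -- Here the averages coincide, and the general error 10K²(1 + |x|) ≤ 20K²|x| is dominated
    -- through |x| ≤ φ(x)/α₃(R).
    refine ⟨20 * K ^ 2 / α₃ R, 1, by positivity, one_pos, ?_⟩
    intro ε hε hε1 hεK hεK' hεR x hx τ hτ
    have hfar := D.lt_norm_phaseInv hε.1 hε1 hεK hR hεR hx hτ
    have hxO : x ∈ {y : Euc n | max δ₂ δ₂' < ‖y‖} :=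
      lt_of_le_of_lt hmax (by linarith)
    have e : fbar δ₁ δ₂' T f₁ f₂ x = fbar δ₁ δ₂ T f₁ f₂ x :=
      (average_congr hO (hat_congr f₁) (hat_congr f₂) T hxO).symm
    rw [e]
    refine (D.pushforward_sub_average_le hε.1 hε1 hεK hτ fun y hy => ?_).trans ?_
    · have hy2 : δ₂ ≤ ‖y‖ := by rw [hy]; exact h2.trans hfar.le
      simp only [oscField, hat_eq_of_le hy2]
    · rw [mul_assoc ε, mul_assoc ε]
      refine mul_le_mul_of_nonneg_left ?_ hε.1.le
      have hα' : α₃ R ≤ α₃ ‖x‖ := hα₃.2.1.monotoneOn (show (0 : ℝ) ≤ R by linarith)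
        (norm_nonneg x) hx
      have h4 : α₃ R * ‖x‖ ≤ φ x :=
        (mul_le_mul_of_nonneg_right hα' (norm_nonneg x)).trans (hαφ x)
      have h5 : ‖x‖ ≤ φ x / α₃ R := by rwa [le_div_iff₀' hα]
      calc 10 * K ^ 2 * (1 + ‖x‖) ≤ 20 * K ^ 2 * ‖x‖ := by nlinarith [sq_nonneg K]
        _ ≤ 20 * K ^ 2 * (φ x / α₃ R) := by gcongr
        _ = 20 * K ^ 2 / α₃ R * φ x := by ring

/-- Decrease and perturbation are both quadratic in s = φ(x), so for small ε half of the decrease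
survives for all s at once. -/
theorem inner_le_of_perturbation {g p q : Euc n} {c₁ c₂ M ε A s : ℝ} (hA : 0 < A) (hs : A ≤ s)
    (hc₁ : 0 < c₁) (hc₂ : 0 < c₂) (hg : ‖g‖ ≤ c₂ * s)
    (hp : inner ℝ g p ≤ -c₁ * s ^ 2) (hq : ‖q - p‖ ≤ ε * M * s)
    (hsmall : 2 * c₂ * M / c₁ * ε ≤ 1) : inner ℝ g q ≤ -(c₁ / 2 * A ^ 2) := by
  have h0 : 0 < s := hA.trans_le hs
  have e : inner ℝ g q = inner ℝ g p + inner ℝ g (q - p) := by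
    rw [← inner_add_right]; congr 1; abel
  have h1 : inner ℝ g (q - p) ≤ (c₂ * s) * (ε * M * s) :=
    (real_inner_le_norm _ _).trans (mul_le_mul hg hq (norm_nonneg _) (by positivity))
  have h2 : c₂ * M * ε ≤ c₁ / 2 := by
    rw [div_mul_eq_mul_div, div_le_one hc₁] at hsmall
    linarith
  have h3 : (c₂ * s) * (ε * M * s) ≤ c₁ / 2 * s ^ 2 := by
    calc (c₂ * s) * (ε * M * s) = (c₂ * M * ε) * s ^ 2 := by ring
      _ ≤ c₁ / 2 * s ^ 2 := by gcongr
  have h4 : c₁ / 2 * A ^ 2 ≤ c₁ / 2 * s ^ 2 := by gcongr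
  rw [e]
  linarith

/-- Ultimate bounds for the transformed and for the original system. -/
theorem exists_transformed_bounds (hreg : Regular f₁ f₂ δ₁ T)
    (hlyap : LyapunovCondition f₁ f₂ δ₁ T) {e δ₃ : ℝ} (he : 0 < e) (hδ : Deltas e δ₁ δ₂ δ₃) :
    ∃ (β : ℝ → ℝ → ℝ) (Δ L εs : ℝ),
      ClassKL β ∧ 0 < Δ ∧ 0 < L ∧ 0 < εs ∧
      NearIdentityBounds (Ψ δ₁ δ₂ T f₁ f₂) L εs ∧
      ∀ ε ∈ Set.Ioo 0 εs,
        UltimateBound (pushedField δ₁ δ₂ T f₁ f₂ ε) ε β Δ ∧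
        UltimateBound (oscField f₁ f₂ ε) ε (betaTilde β) (deltaTilde L Δ β ε) := by
  obtain ⟨e', δ₂', δ₃', he', hδ', V, φ, α₁, α₂, c₁, c₂, hV, ⟨-, α, hα, hαφ⟩, hα₁, hα₂, hc₁, hc₂,
    hVα, hgrad, hdec, hcase⟩ := hlyap
  obtain ⟨K, D⟩ := hreg.exists_correctors he hδ
  obtain ⟨K', D'⟩ := hreg.exists_correctors he' hδ'
  have hK := D.pos
  have hK' := D'.pos
  -- The margin 1 allows for the displacement of preimages: beyond `R` they still lie outside both
  -- truncation radii.
  set R := max 0 (max (max δ₂ δ₂') δ₃') + 1 with hRdef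
  have hR : 1 ≤ R := by have := le_max_left 0 (max (max δ₂ δ₂') δ₃'); linarith
  have hm : max (max δ₂ δ₂') δ₃' ≤ R - 1 := by
    have := le_max_right 0 (max (max δ₂ δ₂') δ₃'); linarith
  have hR2 : δ₂ ≤ R - 1 := ((le_max_left _ _).trans (le_max_left _ _)).trans hm
  have hR2' : δ₂' ≤ R - 1 := ((le_max_right _ _).trans (le_max_left _ _)).trans hm
  have hR3' : δ₃' ≤ R := by have := (le_max_right (max δ₂ δ₂') δ₃').trans hm; linarith
  have hR0 : 0 < R := by linarith
  have hA := hα.pos hR0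
  have hAφ : ∀ x : Euc n, R ≤ ‖x‖ → α R ≤ φ x := fun x hx =>
    (hα.2.1.monotoneOn hR0.le (norm_nonneg x) hx).trans (hαφ x)
  obtain ⟨M, ε₁, hM, hε₁, hpert⟩ :=
    exists_pushedField_sub_le D D' hR hR2 hR2' hR3' hA hAφ hcase
  obtain ⟨β, Δ, hβ, hΔ, hub⟩ := exists_ultimateBound_of_lyapunov hV hα₁ hα₂ hVα hR0
    (show 0 < c₁ / 2 * α R ^ 2 by positivity)
  -- Each smallness condition has the form aε ≤ 1 or aε < 1 with `a` a summand of `S`, so ε < 1/S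
  -- meets them all.
  set S := 1 + 4 * K + 4 * K' + 8 * K * R + 2 * c₂ * M / c₁ with hS
  have hq : 0 ≤ 2 * c₂ * M / c₁ := by positivity
  have hp1 : 0 < 8 * K * R := by positivity
  have hSpos : 0 < S := by positivity
  have hsm : ∀ {ε a : ℝ}, 0 < ε → ε < min ε₁ (1 / S) → a ≤ S → a * ε < 1 := by
    intro ε a hε hlt ha
    have h1 : ε < 1 / S := hlt.trans_le (min_le_right _ _)
    rw [lt_div_iff₀' hSpos] at h1
    exact (mul_le_mul_of_nonneg_right ha hε.le).trans_lt h1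
  have hεs1 : 1 / S ≤ 1 := by rw [div_le_one hSpos]; linarith
  have hεs2 : 4 * K * min ε₁ (1 / S) ≤ 1 := by
    calc 4 * K * min ε₁ (1 / S) ≤ S * (1 / S) := by
          gcongr
          · linarith
          · exact min_le_right _ _
      _ = 1 := mul_one_div_cancel hSpos.ne'
  refine ⟨β, Δ, 4 * K, min ε₁ (1 / S), hβ, hΔ, by positivity, lt_min hε₁ (by positivity), ?_, ?_⟩
  · rw [Ψ_eq_nearId]
    exact D.nearIdentityBounds ((min_le_right _ _).trans hεs1) hεs2
  · rintro ε ⟨hε, hlt⟩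
    have hε1 : ε ≤ 1 := by simpa using (hsm hε hlt (a := 1) (by linarith)).le
    have hεK : 4 * K * ε ≤ 1 := (hsm hε hlt (by linarith)).le
    have hεK' : 4 * K' * ε ≤ 1 := (hsm hε hlt (by linarith)).le
    have hεR : 8 * K * R * ε < 1 := hsm hε hlt (by linarith)
    have hεM : 2 * c₂ * M / c₁ * ε ≤ 1 := (hsm hε hlt (by linarith)).le
    have hosc := hreg.continuousOn_oscField ε
    have hpush : UltimateBound (pushedField δ₁ δ₂ T f₁ f₂ ε) ε β Δ := by
      refine hub _ ε (D.continuousOn_pushforward hε hε1 hεK hosc) fun x hx τ hτ => ?_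
      exact inner_le_of_perturbation hA (hAφ x hx) hc₁ hc₂ (hgrad x)
        (hdec x (hR3'.trans hx))
        (hpert ε ⟨hε, hlt.trans_le (min_le_left _ _)⟩ hε1 hεK hεK' hεR x hx τ hτ) hεM
    exact ⟨hpush, D.ultimateBound_of_pushforward hε hε1 hεK hosc hβ hpush⟩

end Main

end SecondOrderAveraging

theorem corollary1 {n : ℕ} (f₁ f₂ : SecondOrderAveraging.Euc n → ℝ → SecondOrderAveraging.Euc n)
    (δ₁ T : ℝ)
    (hreg : SecondOrderAveraging.Regular f₁ f₂ δ₁ T)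
    (hlyap : SecondOrderAveraging.LyapunovCondition f₁ f₂ δ₁ T)
    (e δ₂ δ₃ : ℝ) (he : 0 < e) (hδ : SecondOrderAveraging.Deltas e δ₁ δ₂ δ₃) :
    (∃ Δt : ℝ,
      SecondOrderAveraging.UGUB (SecondOrderAveraging.oscField f₁ f₂) Δt) ∧
    ∃ (β : ℝ → ℝ → ℝ) (Δ L εs : ℝ),
      SecondOrderAveraging.ClassKL β ∧ 0 < Δ ∧ 0 < L ∧ 0 < εs ∧
      SecondOrderAveraging.NearIdentityBounds
        (SecondOrderAveraging.Ψ δ₁ δ₂ T f₁ f₂) L εs ∧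
      ∀ ε ∈ Set.Ioo 0 εs,
        SecondOrderAveraging.UltimateBound
          (SecondOrderAveraging.pushedField δ₁ δ₂ T f₁ f₂ ε) ε β Δ ∧
        SecondOrderAveraging.UltimateBound
          (SecondOrderAveraging.oscField f₁ f₂ ε) ε
          (SecondOrderAveraging.betaTilde β)
          (SecondOrderAveraging.deltaTilde L Δ β ε) := by
  have h := SecondOrderAveraging.exists_transformed_bounds hreg hlyap he hδ
  refine ⟨?_, h⟩
  obtain ⟨β, Δ, L, εs, hβ, hΔ, hL, hεs, hnear, hub⟩ := h
  have h3 : 0 ≤ β 3 0 := hβ.nonneg (by norm_num) le_rfl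
  -- The ε-dependent bound increases with Lε; its value at Lε = 1 serves for every admissible ε.
  refine ⟨2 * Δ + 1 + 2 * β 3 0, by positivity, SecondOrderAveraging.betaTilde β, hβ.betaTilde,
    εs, hεs, fun ε hε => (hub ε hε).2.mono ?_⟩
  have hLε : L * ε ≤ 1 := (hnear ε hε).1
  have hLε0 : 0 < L * ε := mul_pos hL hε.1
  have hb : β (3 * L * ε) 0 ≤ β 3 0 := hβ.mono (by linarith) (by linarith) le_rfl
  have h1 : (1 + L * ε) * Δ ≤ 2 * Δ := mul_le_mul_of_nonneg_right (by linarith) hΔ.le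
  have h2 : (1 + L * ε) * β (3 * L * ε) 0 ≤ 2 * β 3 0 :=
    (mul_le_mul_of_nonneg_left hb (by linarith)).trans
      (mul_le_mul_of_nonneg_right (by linarith) h3)
  unfold SecondOrderAveraging.deltaTilde
  linarith
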